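/- **Setting.** Let $G_{\mathbb C}\subset GL(n,\mathbb C)$ be a connected complex linear algebraic group with an antiholomorphic involutive automorphism $\sigma$, let $\sigma_c=C_x\circ\sigma$ ($x\in G_{\mathbb C}$, $C_x$ conjugation by $x$) be another such automorphism, and assume that $G_c=\{g\in G_{\mathbb C}:\sigma_c(g)=g\}$ is compact. Let $G$ be the identity component of $\{g\in G_{\mathbb C}:\sigma(g)=g\}$, and assume that its Lie algebra $\mathfrak g$ is semisimple. Let $K<G$ be a maximal compact subgroup and $T<K$ a maximal torus whose Lie algebra $\mathfrak t$ is a Cartan subalgebra of $\mathfrak g$. The compact form $G_c$ is positioned such that $K\subset G_c$. Let $\mathfrak g_c$ be the Lie algebra of $G_c$, $R$ the root system of $(\mathfrak g^{\mathbb C},\mathfrak t^{\mathbb C})$ and $R^+\subset R$ a positive system. Let $\mathfrak t^\perp\subset\mathfrak g$ and $\mathfrak t^{\perp_c}\subset\mathfrak g_c$ be the orthogonal complements of $\mathfrak t$ for $\mathrm{Ad}(T)$-invariant inner products. For a positive system $S$, let $p_S\colon\mathfrak g^{\mathbb C}\to\bigoplus_{\alpha\in S}\mathfrak g^{\mathbb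 C}_\alpha$ be the projection given by the root space decomposition, and let $J_S$ be the invariant complex structure on $G/T$ (or on $G_c/T$) for which $p_S$ is complex linear on the tangent space $\mathfrak t^\perp$ (or $\mathfrak t^{\perp_c}$) at $eT$. For $w\in N_{G_c}(T)$ put $w^{-1}R^+=\{\alpha\circ \mathrm{Ad}(w^{-1}):\alpha\in R^+\}$, and let $\psi_w\colon\mathfrak t^\perp\to\mathfrak t^{\perp_c}$ be the real linear isomorphism determined by $p_{R^+}(\psi_wX)=\mathrm{Ad}(w^{-1})\,p_{w^{-1}R^+}(X)$. Let $\eta(X)=\exp(X)T\in G/T$ for $X\in\mathfrak t^\perp$, and $\eta_c(Y)=\exp(Y)T\in G_c/T$ for $Y\in\mathfrak t^{\perp_c}$. Let $W_G=N_{G_c}(T)/T$ and $W_K=N_K(T)/T\subset W_G$. Let $\mathcal W=W_K\backslash W_G$ be the quotient of $W_G$ by left multiplication by $W_K$, with classes $[w]=W_Kw$; for every class fix a representative $w\in N_{G_c}(T)$. Let $M=G/T\times \mathcal W$, with $G$ acting on the first factor and with the complex structure $J_{w^{-1}R^+}$ on $G/T\times\{[w]\}$, $w$ being the fixed representative. Give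 $G_c/T$ the complex structure $J_{R^+}$. **Proposition.** There is an $\mathrm{Ad}(T)$-invariant open neighbourhood $O$ of $0$ in $\mathfrak t^\perp$ such that the following holds for every $\mathrm{Ad}(T)$-invariant open neighbourhood $\tilde U\subset O$ of $0$. 1. $\eta$ is a diffeomorphism from $\tilde U$ onto an open subset $U$ of $G/T$. With $U_c^w=\eta_c(\psi_w(\tilde U))$, the sets $kU$ belonging to different classes of $k\in N_K(T)$ in $W_K$ are disjoint, and so are the sets $wU_c^w$ belonging to different classes of $w\in N_{G_c}(T)$ in $W_G$. 2. With $V=\bigcup_{k\in N_K(T)}kU$, there is a well-defined map $\varphi\colon V\times \mathcal W\to G_c/T$ with $$\varphi(k\,\eta(X),[w])=k\,w\,\eta_c(\psi_w X)\qquad (k\in N_K(T),\ X\in\tilde U,\ w \text{ a fixed representative}).$$ 3. $V\times\mathcal W$ is an open $T$-invariant neighbourhood of $M^T$ in $M$, and the image of $\varphi$ is an open $T$-invariant neighbourhood of $(G_c/T)^T$ in $G_c/T$. If $\tilde U$ is $\mathrm{Ad}(N_K(T))$-invariant, this image is $V_c=\bigcup_{w\in N_{G_c}(T)}wU_c^w$.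 4. $\varphi$ is a $T$-equivariant diffeomorphism from $V\times\mathcal W$ onto its image. 5. $\varphi$ is holomorphic up to a homotopy of complex structures: there is a smooth family $(J_s)_{s\in[0,1]}$ of $T$-invariant almost complex structures on $V\times\mathcal W$ for which $J_0$ is the restriction of the complex structure of $M$, and $J_1$ is the pullback along $\varphi$ of the complex structure of $G_c/T$. 6. For every integral weight $\nu$ of $T$ (in particular $\nu=\lambda-\rho$, where $\rho$ is half the sum of the positive roots and $\lambda\in i\mathfrak t^*$ is dominant and regular with $\lambda-\rho$ integral), there is a $T$-equivariant isomorphism of smooth complex line bundles $$\varphi^*(G_c\times_T\mathbb C_\nu)\cong L|_{V\times\mathcal W},\qquad L|_{G/T\times\{[w]\}}=G\times_T\mathbb C_{w^{-1}\nu},$$ where $T$ acts on $\mathbb C_{w^{-1}\nu}$ by $t\mapsto e^{\nu}(w^{-1}tw)$. -/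

import Mathlib

open scoped ContDiff Topology

attribute [local instance] Matrix.normedAddCommGroup Matrix.normedSpace LieRing.ofAssociativeRing

noncomputable section

namespace ShelstadGeometry

/-! ### Linear groups, exponential, Lie algebras -/

/-- The algebra of complex `n × n` matrices. -/
abbrev Mat (n : ℕ) : Type := Matrix (Fin n) (Fin n) ℂ

/-- The general linear group `GL(n, ℂ)`. -/
abbrev GLn (n : ℕ) : Type := GL (Fin n) ℂ

/-- The matrix exponential, as an invertible matrix. -/
def expGL {n : ℕ} (X : Mat n) : GLn n := (Matrix.isUnit_exp X).unit

/-- The adjoint action `Ad(g) X = g X g⁻¹`. -/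
def Ad {n : ℕ} (g : GLn n) (X : Mat n) : Mat n := (g : Mat n) * X * ((g⁻¹ : GLn n) : Mat n)

/-- The Lie algebra of a closed subgroup `H` of `GL(n, ℂ)`, consisting of the matrices `X` with
`exp (t X) ∈ H` for all real `t`. For closed `H` these matrices already form a real Lie
subalgebra, so that passing to the generated Lie subalgebra adds nothing. -/
def lieAlg {n : ℕ} (H : Subgroup (GLn n)) : LieSubalgebra ℝ (Mat n) :=
  LieSubalgebra.lieSpan ℝ (Mat n) {X | ∀ t : ℝ, expGL (t • X) ∈ H}

/-- `H` is a (Zariski closed) complex linear algebraic group. -/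
def IsAlgebraicGroup {n : ℕ} (H : Subgroup (GLn n)) : Prop :=
  ∃ S : Set (MvPolynomial (Fin n × Fin n) ℂ), ∀ g : GLn n,
    g ∈ H ↔ ∀ f ∈ S, MvPolynomial.eval (fun p => (g : Mat n) p.1 p.2) f = 0

/-- A real form of `GC`: an involutive automorphism `σ` of the Lie group `GC` which is
antiholomorphic, i.e. if `Y = T_e σ (X)`, then `T_e σ (i X) = - i Y`. -/
structure IsRealForm {n : ℕ} {GC : Subgroup (GLn n)} (σ : GC ≃* GC) : Prop where
  continuous : Continuous σ
  involutive : ∀ g, σ (σ g) = g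
  antiholomorphic : ∀ X Y : Mat n,
    (∀ t : ℝ, ∃ h : expGL (t • X) ∈ GC, (σ ⟨_, h⟩ : GLn n) = expGL (t • Y)) →
    ∀ t : ℝ, ∃ h : expGL (t • (Complex.I • X)) ∈ GC,
      (σ ⟨_, h⟩ : GLn n) = expGL (t • (-(Complex.I • Y)))

/-- The group of real points `G(ℝ, σ) = {g ∈ GC : σ g = g}`, as a subgroup of `GL(n, ℂ)`. -/
def realPoints {n : ℕ} {GC : Subgroup (GLn n)} (σ : GC ≃* GC) : Subgroup (GLn n) where
  carrier := {g | ∃ h : g ∈ GC, (σ ⟨g, h⟩ : GLn n) = g}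
  one_mem' := ⟨GC.one_mem, congrArg Subtype.val (map_one σ)⟩
  mul_mem' := by
    rintro a b ⟨ha, ha'⟩ ⟨hb, hb'⟩
    refine ⟨GC.mul_mem ha hb, ?_⟩
    have h := congrArg Subtype.val (map_mul σ ⟨a, ha⟩ ⟨b, hb⟩)
    rw [Subgroup.coe_mul, ha', hb'] at h
    exact h
  inv_mem' := by
    rintro a ⟨ha, ha'⟩
    refine ⟨GC.inv_mem ha, ?_⟩
    have h := congrArg Subtype.val (map_inv σ ⟨a, ha⟩)
    rw [Subgroup.coe_inv, ha'] at h
    exact h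

/-- The identity component of a subgroup `H` of `GL(n, ℂ)`. -/
def identityComponent {n : ℕ} (H : Subgroup (GLn n)) : Subgroup (GLn n) :=
  (Subgroup.connectedComponentOfOne H).map H.subtype

/-- `K` is a maximal compact subgroup of `H`. -/
structure IsMaximalCompact {n : ℕ} (H K : Subgroup (GLn n)) : Prop where
  le : K ≤ H
  isCompact : IsCompact (K : Set (GLn n))
  maximal : ∀ K' : Subgroup (GLn n), K' ≤ H → IsCompact (K' : Set (GLn n)) → K ≤ K' → K' = K

/-- `T` is a torus: compact, connected and abelian. -/
structure IsTorus {n : ℕ} (T : Subgroup (GLn n)) : Prop where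
  isCompact : IsCompact (T : Set (GLn n))
  isConnected : IsConnected (T : Set (GLn n))
  comm : ∀ a ∈ T, ∀ b ∈ T, a * b = b * a

/-- `T` is a maximal torus of `K`. -/
structure IsMaximalTorus {n : ℕ} (K T : Subgroup (GLn n)) : Prop where
  le : T ≤ K
  isTorus : IsTorus T
  maximal : ∀ T' : Subgroup (GLn n), T' ≤ K → IsTorus T' → T ≤ T' → T' = T

/-- The groups: a connected complex algebraic group `GC` with a real form `σ` and a compact real
form `σc` inner to it; the connected real group `G` of `σ`, assumed to be semisimple; a maximal
compact subgroup `K` of `G`, and a maximal torus `T` of `K` which is a Cartan subgroup of `G`.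
The compact group `Gc` contains `K`. -/
structure InnerFormData (n : ℕ) where
  GC : Subgroup (GLn n)
  algebraic : IsAlgebraicGroup GC
  connected : IsConnected (GC : Set (GLn n))
  σ : GC ≃* GC
  σc : GC ≃* GC
  isRealForm : IsRealForm σ
  isRealForm_c : IsRealForm σc
  inner : ∃ x : GC, ∀ y : GC, σc y = x * σ y * x⁻¹
  compact_c : IsCompact (realPoints σc : Set (GLn n))
  semisimple : LieAlgebra.IsSemisimple ℝ (lieAlg (identityComponent (realPoints σ)))
  K : Subgroup (GLn n)
  maximalCompact : IsMaximalCompact (identityComponent (realPoints σ)) K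
  T : Subgroup (GLn n)
  maximalTorus : IsMaximalTorus K T
  cartan : ((lieAlg T).comap
    (lieAlg (identityComponent (realPoints σ))).incl).IsCartanSubalgebra
  K_le : K ≤ realPoints σc

/-! ### Cosets, smooth maps -/

/-- `H/T = {gT : g ∈ H}`, for a subgroup `H` of `GL(n, ℂ)` containing `T`. -/
def cosetSpace {n : ℕ} (H T : Subgroup (GLn n)) : Set (GLn n ⧸ T) :=
  {x | ∃ g ∈ H, x = (g : GLn n ⧸ T)}

/-- The elements of `H` whose cosets lie in `Ω`. -/
def preimageIn {n : ℕ} (H : Subgroup (GLn n)) {T : Subgroup (GLn n)} (Ω : Set (GLn n ⧸ T)) :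
    Set (GLn n) :=
  {g | g ∈ H ∧ (g : GLn n ⧸ T) ∈ Ω}

/-- `Ω` is an open subset of `H/T` in the quotient topology. -/
def IsOpenInCosetSpace {n : ℕ} (H : Subgroup (GLn n)) {T : Subgroup (GLn n)}
    (Ω : Set (GLn n ⧸ T)) : Prop :=
  Ω ⊆ cosetSpace H T ∧
    ∃ O : Set (GLn n), IsOpen O ∧ preimageIn H Ω = O ∩ (H : Set (GLn n))

/-- `f` is smooth on `A`, where `A` is viewed as a subset of a normed space `E` via `e`: locally,
`f` is the restriction of a smooth map defined on an open subset of `E`. -/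
def SmoothVia {ι E F : Type*} [NormedAddCommGroup E] [NormedSpace ℝ E]
    [NormedAddCommGroup F] [NormedSpace ℝ F] (e : ι → E) (A : Set ι) (f : ι → F) : Prop :=
  ∀ a ∈ A, ∃ O : Set E, IsOpen O ∧ e a ∈ O ∧ ∃ f' : E → F, ContDiffOn ℝ ∞ f' O ∧
    ∀ b ∈ A, e b ∈ O → f b = f' (e b)

/-- A map `F` from the open subset `Ω` of `H/T` to a normed space is smooth if its composition
with `H → H/T` is. -/
def SmoothFunOn {n : ℕ} {F : Type*} [NormedAddCommGroup F] [NormedSpace ℝ F]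
    (H : Subgroup (GLn n)) {T : Subgroup (GLn n)} (Ω : Set (GLn n ⧸ T))
    (f : GLn n ⧸ T → F) : Prop :=
  SmoothVia (fun g : GLn n => (g : Mat n)) (preimageIn H Ω) (fun g => f (g : GLn n ⧸ T))

/-- A map `F` from the open subset `Ω` of `H/T` to `H'/T` is smooth if its composition with
the submersion `H → H/T` lifts locally to smooth maps to `H'`. -/
def SmoothMapOn {n : ℕ} (H H' : Subgroup (GLn n)) {T : Subgroup (GLn n)} (Ω : Set (GLn n ⧸ T))
    (F : GLn n ⧸ T → GLn n ⧸ T) : Prop :=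
  ∀ g ∈ preimageIn H Ω, ∃ N : Set (GLn n), IsOpen N ∧ g ∈ N ∧ ∃ l : GLn n → GLn n,
    (∀ g' ∈ preimageIn H Ω ∩ N, l g' ∈ H' ∧ F (g' : GLn n ⧸ T) = (l g' : GLn n ⧸ T)) ∧
    SmoothVia (fun g' : GLn n => (g' : Mat n)) (preimageIn H Ω ∩ N) (fun g' => (l g' : Mat n))

/-- `Ω` is an open `T`-invariant neighbourhood in `H/T` of the fixed point set `(H/T)^T`. -/
structure IsInvariantNhd {n : ℕ} (H : Subgroup (GLn n)) {T : Subgroup (GLn n)}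
    (Ω : Set (GLn n ⧸ T)) : Prop where
  isOpen : IsOpenInCosetSpace H Ω
  invariant : ∀ h ∈ T, ∀ x ∈ Ω, h • x ∈ Ω
  fixed : ∀ x ∈ cosetSpace H T, (∀ h ∈ T, h • x = x) → x ∈ Ω

/-- `F : Ω × Q → H'/T`, with `Ω` open in `H/T` and `Q` discrete, is a diffeomorphism onto its
image, which is open in `H'/T`. -/
structure IsDiffeoOntoOpen {n : ℕ} (H H' : Subgroup (GLn n)) {T : Subgroup (GLn n)} {Q : Type*}
    (Ω : Set (GLn n ⧸ T)) (F : (GLn n ⧸ T) × Q → GLn n ⧸ T) : Prop where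
  injOn : Set.InjOn F (Ω ×ˢ Set.univ)
  isOpen_image : ∀ q, IsOpenInCosetSpace H' ((fun x => F (x, q)) '' Ω)
  smooth : ∀ q, SmoothMapOn H H' Ω (fun x => F (x, q))
  smooth_inverse : ∀ q, ∃ F' : GLn n ⧸ T → GLn n ⧸ T,
    (∀ x ∈ Ω, F' (F (x, q)) = x) ∧ SmoothMapOn H' H ((fun x => F (x, q)) '' Ω) F'

/-- An inner product on the Lie algebra `L` (given by a bilinear form on matrices, of which only
the restriction to `L` matters), invariant under `Ad(T)`. -/
structure IsInvariantInner {n : ℕ} (T : Subgroup (GLn n)) (L : LieSubalgebra ℝ (Mat n))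
    (B : Mat n →ₗ[ℝ] Mat n →ₗ[ℝ] ℝ) : Prop where
  symm : ∀ X ∈ L, ∀ Y ∈ L, B X Y = B Y X
  pos : ∀ X ∈ L, X ≠ 0 → 0 < B X X
  invariant : ∀ t ∈ T, ∀ X ∈ L, ∀ Y ∈ L, B (Ad t X) (Ad t Y) = B X Y

/-- The orthogonal complement of the Lie algebra of `T` in the Lie algebra of `H`. -/
def perp {n : ℕ} (H T : Subgroup (GLn n)) (B : Mat n →ₗ[ℝ] Mat n →ₗ[ℝ] ℝ) :
    Submodule ℝ (Mat n) where
  carrier := {X | X ∈ lieAlg H ∧ ∀ Z ∈ lieAlg T, B X Z = 0}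
  zero_mem' := ⟨(lieAlg H).zero_mem, fun Z _ => by simp⟩
  add_mem' := by
    rintro X Y ⟨hX, hX'⟩ ⟨hY, hY'⟩
    exact ⟨(lieAlg H).add_mem hX hY, fun Z hZ => by simp [hX' Z hZ, hY' Z hZ]⟩
  smul_mem' := by
    rintro c X ⟨hX, hX'⟩
    exact ⟨(lieAlg H).smul_mem c hX, fun Z hZ => by simp [hX' Z hZ]⟩

/-- `Ad(T)`-invariance of a subset of an orthogonal complement as above. -/
def AdInvariant {n : ℕ} (A : Subgroup (GLn n)) {m : Submodule ℝ (Mat n)} (U : Set m) : Prop :=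
  ∀ a ∈ A, ∀ X Y : m, (Y : Mat n) = Ad a X → X ∈ U → Y ∈ U

/-- The map `X ↦ exp(X) T`. -/
def eta {n : ℕ} (T : Subgroup (GLn n)) (X : Mat n) : GLn n ⧸ T := (expGL X : GLn n ⧸ T)

/-! ### Roots, complex structures -/

/-- Real-linear functionals on the Lie algebra of `T`, with complex values. -/
abbrev Functional {n : ℕ} (T : Subgroup (GLn n)) : Type := lieAlg T →ₗ[ℝ] ℂ

namespace InnerFormData

variable {n : ℕ} (D : InnerFormData n)

/-- The connected real group defined by `σ`. -/
def G : Subgroup (GLn n) := identityComponent (realPoints D.σ)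

/-- The compact inner form. -/
def Gc : Subgroup (GLn n) := realPoints D.σc

/-- The complexification of the Lie algebra of `G`, inside the complex matrices. -/
def gC : Submodule ℂ (Mat n) := Submodule.span ℂ (lieAlg D.G : Set (Mat n))

/-- The space of `X` in the complexified Lie algebra with `[H, X] = α(H) X` for `H` in the Lie
algebra of `T`. -/
def rootSpace (α : Functional D.T) : Submodule ℂ (Mat n) where
  carrier := {X | X ∈ D.gC ∧ ∀ H : lieAlg D.T, (H : Mat n) * X - X * (H : Mat n) = α H • X}
  zero_mem' := ⟨D.gC.zero_mem, fun H => by simp⟩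
  add_mem' := by
    rintro X Y ⟨hX, hX'⟩ ⟨hY, hY'⟩
    refine ⟨D.gC.add_mem hX hY, fun H => ?_⟩
    rw [smul_add, ← hX' H, ← hY' H]
    noncomm_ring
  smul_mem' := by
    rintro c X ⟨hX, hX'⟩
    refine ⟨D.gC.smul_mem c hX, fun H => ?_⟩
    rw [smul_comm, ← hX' H, smul_sub, Matrix.mul_smul, Matrix.smul_mul]

/-- The root system `R`. -/
def roots : Set (Functional D.T) := {α | α ≠ 0 ∧ D.rootSpace α ≠ ⊥}

/-- Positive systems of roots. -/
structure IsPositiveSystem (P : Set (Functional D.T)) : Prop where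
  subset : P ⊆ D.roots
  pos_or_neg : ∀ α ∈ D.roots, Xor (α ∈ P) (-α ∈ P)
  closed : ∀ α ∈ P, ∀ β ∈ P, α + β ∈ D.roots → α + β ∈ P

/-- The sum of the root spaces for the roots in `S`. -/
def rootSum (S : Set (Functional D.T)) : Submodule ℂ (Mat n) := ⨆ α ∈ S, D.rootSpace α

open Classical in
/-- The projection `p_S` of the complexified Lie algebra onto the sum of the root spaces for the
roots in the positive system `S`, along the complexified Lie algebra of `T` and the root spaces
for the roots in `-S`. -/
def proj (S : Set (Functional D.T)) (X : Mat n) : Mat n :=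
  if h : ∃ Z ∈ D.rootSum S, X - Z ∈
      Submodule.span ℂ (lieAlg D.T : Set (Mat n)) ⊔ D.rootSum {α | -α ∈ S}
  then h.choose else 0

/-- The set of functionals `α ∘ Ad(w⁻¹)`, for `α ∈ P` (and `w` normalising `T`). -/
def twistRoots (w : GLn n) (P : Set (Functional D.T)) : Set (Functional D.T) :=
  {β | ∃ α ∈ P, ∀ H H' : lieAlg D.T, (H' : Mat n) = Ad w⁻¹ (H : Mat n) → β H = α H'}

/-- The normaliser `N_{Gc}(T)`. -/
def NGc : Subgroup (GLn n) := D.Gc ⊓ Subgroup.normalizer (D.T : Set (GLn n))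

/-- The normaliser `N_K(T)`. -/
def NK : Subgroup (GLn n) := D.K ⊓ Subgroup.normalizer (D.T : Set (GLn n))

instance normal_T : (D.T.subgroupOf D.NGc).Normal where
  conj_mem := by
    rintro ⟨t, ht⟩ h ⟨w, hw⟩
    exact (Subgroup.mem_normalizer_iff.mp hw.2 t).mp h

/-- The Weyl group `W_G = N_{Gc}(T)/T`. -/
abbrev WG : Type := D.NGc ⧸ D.T.subgroupOf D.NGc

/-- The Weyl group `W_K = N_K(T)/T`, as a subgroup of `W_G`. -/
def WK : Subgroup D.WG :=
  (D.NK.subgroupOf D.NGc).map (QuotientGroup.mk' (D.T.subgroupOf D.NGc))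

/-- The quotient of `W_G` by left multiplication by `W_K`; its elements are the classes
`[w] = W_K w`. -/
abbrev WeylCosets : Type := Quotient (QuotientGroup.rightRel D.WK)

/-- The class `[w] = W_K w` of an element `w` of `N_{Gc}(T)`. -/
def weylClass (w : D.NGc) : D.WeylCosets :=
  Quotient.mk (QuotientGroup.rightRel D.WK) (QuotientGroup.mk w : D.WG)

variable (B Bc : Mat n →ₗ[ℝ] Mat n →ₗ[ℝ] ℝ)

/-- The complement of the Lie algebra of `T` in the Lie algebra of `G`. -/
abbrev tPerp : Submodule ℝ (Mat n) := perp D.G D.T B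

/-- The complement of the Lie algebra of `T` in the Lie algebra of `Gc`. -/
abbrev tPerpC : Submodule ℝ (Mat n) := perp D.Gc D.T Bc

/-- The map `ψ_w`, determined by `p_P (ψ_w X) = Ad(w⁻¹) (p_S X)`, where `S = twistRoots w P`. -/
def psi (P : Set (Functional D.T)) (w : GLn n) (X : D.tPerp B) : D.tPerpC Bc :=
  Function.invFun (fun Y : D.tPerpC Bc => D.proj P (Y : Mat n))
    (Ad w⁻¹ (D.proj (D.twistRoots w P) (X : Mat n)))

/-- The set `V`: the union of the translates `k U`, for `k ∈ N_K(T)` and `U = eta(Ũ)`. -/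
def V {B : Mat n →ₗ[ℝ] Mat n →ₗ[ℝ] ℝ} (U : Set (D.tPerp B)) : Set (GLn n ⧸ D.T) :=
  {x | ∃ k ∈ D.NK, ∃ X ∈ U, x = k • eta D.T (X : Mat n)}

/-- The set `V_c`: the union over `w` in `N_{Gc}(T)` of the sets `w U_c^w`, where
`U_c^w = eta_c (ψ_w (Ũ))`. -/
def Vc {B : Mat n →ₗ[ℝ] Mat n →ₗ[ℝ] ℝ} (P : Set (Functional D.T)) (U : Set (D.tPerp B)) :
    Set (GLn n ⧸ D.T) :=
  {x | ∃ w ∈ D.NGc, ∃ X ∈ U, x = w • eta D.T (D.psi B Bc P w X : Mat n)}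

/-- The set `Ũ` is small: `eta` is a diffeomorphism from `Ũ` onto an open subset `U` of `G/T`, the
translates `k U`, for different classes of `k ∈ N_K(T)` in `W_K`, are disjoint, and so are the
sets `w U_c^w`, for different classes of `w` in `W_G`. -/
structure IsSmall {B : Mat n →ₗ[ℝ] Mat n →ₗ[ℝ] ℝ} (P : Set (Functional D.T))
    (U : Set (D.tPerp B)) : Prop where
  isOpen : IsOpenInCosetSpace D.G ((fun X : D.tPerp B => eta D.T (X : Mat n)) '' U)
  inverse : ∃ f : GLn n ⧸ D.T → Mat n, (∀ X ∈ U, f (eta D.T (X : Mat n)) = X) ∧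
    SmoothFunOn D.G ((fun X : D.tPerp B => eta D.T (X : Mat n)) '' U) f
  disjoint : ∀ k ∈ D.NK, ∀ k' ∈ D.NK, ∀ X ∈ U, ∀ X' ∈ U,
    k • eta D.T (X : Mat n) = k' • eta D.T (X' : Mat n) → k⁻¹ * k' ∈ D.T
  disjoint_c : ∀ w ∈ D.NGc, ∀ w' ∈ D.NGc, ∀ X ∈ U, ∀ X' ∈ U,
    w • eta D.T (D.psi B Bc P w X : Mat n) = w' • eta D.T (D.psi B Bc P w' X' : Mat n) →
      w⁻¹ * w' ∈ D.T

/-! The tangent space of `G/T` at `gT` is identified with the complement `m` of the Lie algebra of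
`T`, where `X ∈ m` corresponds to the velocity `[g, X]` at `s = 0` of the curve `g exp(sX) T`; one
has `[g t, X] = [g, Ad(t) X]` for `t ∈ T`. An almost complex structure `J` on an open subset of
`G/T` is thus given by endomorphisms `j g` of `m`, with `J [g, X] = [g, j g X]`. -/

/-- `j s`, for `s ∈ [0, 1]`, is a smooth family of `T`-invariant almost complex structures on the
open subset `Ω` of `G/T`. -/
structure IsHomotopy {B : Mat n →ₗ[ℝ] Mat n →ₗ[ℝ] ℝ} (Ω : Set (GLn n ⧸ D.T))
    (j : ℝ → GLn n → Module.End ℝ (D.tPerp B)) : Prop where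
  sq : ∀ s ∈ Set.Icc (0 : ℝ) 1, ∀ g ∈ preimageIn D.G Ω, ∀ X, j s g (j s g X) = -X
  descends : ∀ s ∈ Set.Icc (0 : ℝ) 1, ∀ g ∈ preimageIn D.G Ω, ∀ t ∈ D.T, ∀ X X' : D.tPerp B,
    (X' : Mat n) = Ad t (X : Mat n) → (j s g X' : Mat n) = Ad t (j s (g * t) X : Mat n)
  invariant : ∀ s ∈ Set.Icc (0 : ℝ) 1, ∀ g ∈ preimageIn D.G Ω, ∀ h ∈ D.T, j s (h * g) = j s g
  smooth : ∀ X : D.tPerp B,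
    SmoothVia (fun a : ℝ × GLn n => (a.1, (a.2 : Mat n)))
      (Set.Icc (0 : ℝ) 1 ×ˢ preimageIn D.G Ω) (fun a => (j a.1 a.2 X : Mat n))

/-- The velocity at `s = 0` of the curve `γ` in `Gc/T`, with `γ 0 = yT`, is `[y, Y]`. -/
def HasVelocity (γ : ℝ → GLn n ⧸ D.T) (y : GLn n) (Y : Mat n) : Prop :=
  ∃ c : ℝ → GLn n, c 0 = y ∧ (∀ᶠ s in 𝓝 0, c s ∈ D.Gc ∧ γ s = (c s : GLn n ⧸ D.T)) ∧
    ∃ Z ∈ lieAlg D.T, HasDerivAt (fun s => (c s : Mat n)) ((y : Mat n) * (Y + Z)) 0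

/-- The linear map `d` is the tangent map of `F : G/T → Gc/T` at `gT`, where `F(gT) = yT`. -/
def HasTangentMap {B Bc : Mat n →ₗ[ℝ] Mat n →ₗ[ℝ] ℝ} (F : GLn n ⧸ D.T → GLn n ⧸ D.T)
    (g y : GLn n) (d : D.tPerp B →ₗ[ℝ] D.tPerpC Bc) : Prop :=
  ∀ X : D.tPerp B,
    D.HasVelocity (fun s : ℝ => F ((g * expGL (s • (X : Mat n)) : GLn n) : GLn n ⧸ D.T)) y
      (d X : Mat n)

/-- `F`, from the open subset `Ω` of `G/T` to `Gc/T`, is holomorphic up to a homotopy of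
`T`-invariant almost complex structures on `Ω`, for the `G`-invariant complex structure on `G/T`
for which `p_S` is complex linear on the tangent space at `eT`, and the `Gc`-invariant complex
structure on `Gc/T` for which `p_P` is. -/
def HolomorphicUpToHomotopy (S P : Set (Functional D.T)) (Ω : Set (GLn n ⧸ D.T))
    (F : GLn n ⧸ D.T → GLn n ⧸ D.T) : Prop :=
  ∃ j : ℝ → GLn n → Module.End ℝ (D.tPerp B), D.IsHomotopy Ω j ∧
    (∀ g ∈ preimageIn D.G Ω, ∀ X : D.tPerp B,
      D.proj S (j 0 g X : Mat n) = Complex.I • D.proj S (X : Mat n)) ∧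
    (∀ g ∈ preimageIn D.G Ω, ∀ y ∈ D.Gc, F (g : GLn n ⧸ D.T) = (y : GLn n ⧸ D.T) →
      ∃ d : D.tPerp B →ₗ[ℝ] D.tPerpC Bc, D.HasTangentMap F g y d ∧
        ∀ X : D.tPerp B,
          D.proj P (d (j 1 g X) : Mat n) = Complex.I • D.proj P (d X : Mat n))

end InnerFormData

/-! ### Line bundles -/

/-- The equivalence relation `(g t, z) ~ (g, χ(t) z)` on `GL(n, ℂ) × ℂ`. -/
def lineSetoid {n : ℕ} {T : Subgroup (GLn n)} (χ : T →* Circle) : Setoid (GLn n × ℂ) where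
  r a b := ∃ t : T, a.1 = b.1 * t ∧ b.2 = (χ t : ℂ) * a.2
  iseqv :=
    { refl := fun a => ⟨1, by simp, by simp⟩
      symm := by
        rintro ⟨a, z⟩ ⟨b, z'⟩ ⟨t, h, h'⟩
        refine ⟨t⁻¹, ?_, ?_⟩
        · simp only at h
          simp [h]
        · simp only at h'
          simp [h']
      trans := by
        rintro ⟨a, z⟩ ⟨b, z'⟩ ⟨c, z''⟩ ⟨t, h, h'⟩ ⟨u, k, k'⟩
        refine ⟨u * t, ?_, ?_⟩
        · simp only at h k
          simp [h, k, mul_assoc]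
        · simp only at h' k'
          simp [h', k', mul_assoc] }

/-- The space `GL(n, ℂ) ×_T ℂ_χ`. For a subgroup `H` containing `T`, the total space of the line
bundle `H ×_T ℂ_χ → H/T` consists of the points `[g, z]` with `g ∈ H`. -/
def LineTotal {n : ℕ} {T : Subgroup (GLn n)} (χ : T →* Circle) : Type := Quotient (lineSetoid χ)

/-- The point `[g, z]`. -/
def LineTotal.mk {n : ℕ} {T : Subgroup (GLn n)} (χ : T →* Circle) (g : GLn n) (z : ℂ) :
    LineTotal χ :=
  Quotient.mk (lineSetoid χ) (g, z)

/-- The character `t ↦ χ(w⁻¹ t w)`, for `w` normalising `T`. -/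
def twistChar {n : ℕ} {T : Subgroup (GLn n)} (χ : T →* Circle) (w : GLn n)
    (hw : w ∈ Subgroup.normalizer (T : Set (GLn n))) : T →* Circle where
  toFun t := χ ⟨w⁻¹ * t * w, (Subgroup.mem_normalizer_iff''.mp hw t).mp t.2⟩
  map_one' := by
    rw [← map_one χ]
    congr 1
    ext1
    simp
  map_mul' a b := by
    rw [← map_mul]
    congr 1
    ext1
    simp [mul_assoc]

/-- The `T`-equivariant line bundles `F^* (Gc ×_T ℂ_χ)` and `G ×_T ℂ_χ'` on the open subset `Ω` of
`G/T` are isomorphic, where `F : Ω → Gc/T` is `T`-equivariant: there are maps `Ψ x`, for `x ∈ Ω`,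
from the fibre at `F x` of the first bundle to the fibre at `x` of the second one. They are
described by `Ψ (gT) [y, z] = [g, u(g, y) z]` for a nowhere vanishing smooth function `u`
(this includes linearity and bijectivity on fibres), and they are `T`-equivariant. -/
def PullbackLineIso {n : ℕ} (H H' : Subgroup (GLn n)) {T : Subgroup (GLn n)}
    (χ χ' : T →* Circle) (Ω : Set (GLn n ⧸ T)) (F : GLn n ⧸ T → GLn n ⧸ T) : Prop :=
  ∃ Ψ : GLn n ⧸ T → LineTotal χ → LineTotal χ', ∃ u : GLn n × GLn n → ℂ,
    (∀ g ∈ preimageIn H Ω, ∀ y ∈ H', F (g : GLn n ⧸ T) = (y : GLn n ⧸ T) →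
      u (g, y) ≠ 0 ∧
      (∀ z : ℂ, Ψ (g : GLn n ⧸ T) (LineTotal.mk χ y z) = LineTotal.mk χ' g (u (g, y) * z)) ∧
      ∀ h ∈ T, ∀ z : ℂ, Ψ ((h * g : GLn n) : GLn n ⧸ T) (LineTotal.mk χ (h * y) z) =
        LineTotal.mk χ' (h * g) (u (g, y) * z)) ∧
    SmoothVia (fun a : GLn n × GLn n => ((a.1 : Mat n), (a.2 : Mat n)))
      {a | a.1 ∈ preimageIn H Ω ∧ a.2 ∈ H' ∧ F (a.1 : GLn n ⧸ T) = (a.2 : GLn n ⧸ T)} u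

end ShelstadGeometry

end

open ShelstadGeometry

/-! The fixed points of `T` on `G/T` and on `Gc/T` are cosets of elements normalising `T`. Near the
fixed point of k ∈ N_K(T), G/T is modelled on 𝔱^⊥ through X ↦ k exp(X)T; near that of v ∈ N_{Gc}(T),
Gc/T is modelled on 𝔱^{⊥_c} in the same way. Every v is a product k w t with one chosen w for each
class in W_K\W_G, so one copy of G/T per class accounts for all fixed points of Gc/T. The map φ
matches the chart at k in the copy [w] with the chart at k w, through the linear isomorphism ψ_w.

The linear algebra rests on two facts. The Lie algebras of G and Gc have the same complexification
(`mem_gC_iff`), and an `Ad(T)`-invariant inner product makes the brackets with 𝔱 skew. Hence the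
complexification is the sum of the root spaces (`IsFormWithInner.iSup_rootSpace`), the roots are
imaginary on 𝔱, and conjugation for either real form exchanges α and -α. So p_S maps each orthogonal
complement isomorphically onto the sum of the root spaces in S (`projEquiv`). Then ψ_w is
characterised by p_P(ψ_w X) = p_P(Ad(w⁻¹)X) (`psi_eq_iff`), from which its equivariance, its
dependence on w and its complex linearity follow (`psi_Ad`, `psi_mul_NK`, `psi_mul_T`,
`psi_cpxStr`).

That V contains all fixed points of G/T means that the normaliser of T in G lies in K. This is
`normalizer_le_K`, which combines the maximality of K with a polar decomposition for σc
(`exists_polar`); the latter uses unitarization of Gc and the algebraicity of GC. Smallness of the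
neighbourhoods comes from slice charts X ↦ exp(X)T, compactness of T and finiteness of W_G
(`nonempty_sliceChart`, `exists_isFine`). It makes k unique up to T, so that φ is well defined
(`IsFine.phiAt_eq`) and injective, with exponential lifts for both φ and its inverse.

Up to the action of T on both sides, the tangent map of φ at k exp(X)T is ψ_w A_X, where A_X depends
smoothly on X and A_0 = 1. For ‖A_X - 1‖ < 1 the segment A_s = (1 - s) + s A_X consists of
invertible operators, and J_s = A_s⁻¹ J A_s joins the invariant structure J to the structure A_X⁻¹ J
A_X. The latter is the pullback along φ because ψ_w is complex linear
(`IsFine.holomorphicUpToHomotopy`). For the line bundles, if g = k exp(X) t and y = k w exp(ψ_w X)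
t', the factor χ'(t)⁻¹ χ(t') does not depend on the decomposition and gives the isomorphism
(`IsFine.pullbackLineIso`). -/

open ShelstadGeometry
namespace ShelstadGeometry
open Filter

/-! ### The matrix exponential and one-parameter groups -/

/-- Continuous one-parameter groups in a Banach algebra are exponentials. -/
theorem exists_exp_of_continuous_hom {A : Type*} [NormedRing A] [NormedAlgebra ℂ A]
    [CompleteSpace A] (f : ℝ → A) (hf : Continuous f) (h0 : f 0 = 1)
    (hadd : ∀ s t, f (s + t) = f s * f t) : ∃ Y : A, ∀ t : ℝ, f t = NormedSpace.exp (t • Y) := by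
  let _ : NormedAlgebra ℝ A := NormedAlgebra.restrictScalars ℝ ℂ A
  let _ : NormedAlgebra ℚ A := NormedAlgebra.restrictScalars ℚ ℂ A
  have hint : ∀ a b, IntervalIntegrable f MeasureTheory.volume a b :=
    fun a b => hf.intervalIntegrable a b
  set F : ℝ → A := fun x => ∫ s in (0 : ℝ)..x, f s with hF
  have hFd : ∀ x, HasDerivAt F (f x) x := fun x =>
    intervalIntegral.integral_hasDerivAt_right (hint 0 x)
      hf.aestronglyMeasurable.stronglyMeasurableAtFilter hf.continuousAt
  -- the mean of `f` over a short interval is invertible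
  obtain ⟨a, ha, u, hu⟩ : ∃ a : ℝ, a ≠ 0 ∧ ∃ u : Aˣ, (u : A) = a⁻¹ • F a := by
    have h1 : Tendsto (fun a : ℝ => a⁻¹ • F a) (𝓝[≠] 0) (𝓝 1) := by
      have := (hFd 0).tendsto_slope_zero
      simpa [hF, h0] using this
    have h2 := (h1.eventually (Units.isOpen.mem_nhds isUnit_one)).and self_mem_nhdsWithin
    obtain ⟨a, ⟨u, hu⟩, ha⟩ := h2.exists
    exact ⟨a, ha, u, hu⟩
  have hFt : ∀ t, f t * F a = F (t + a) - F t := by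
    intro t
    have h1 : f t * F a = ∫ s in (0 : ℝ)..a, f (t + s) := by
      simp only [hF, hadd]
      exact ((ContinuousLinearMap.mul ℝ A (f t)).intervalIntegral_comp_comm (hint 0 a)).symm
    rw [h1, intervalIntegral.integral_comp_add_left, add_zero]
    exact (intervalIntegral.integral_interval_sub_left (hint _ _) (hint _ _)).symm
  -- Dividing by the invertible `F a` expresses `f` through its primitive, so continuity of `f`
  -- improves to differentiability.
  have hft : ∀ t, f t = (F (t + a) - F t) * (a⁻¹ • (↑u⁻¹ : A)) := by
    intro t
    have h3 : F a * (a⁻¹ • (↑u⁻¹ : A)) = 1 := by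
      rw [mul_smul_comm, ← smul_mul_assoc, ← hu, Units.mul_inv]
    rw [← hFt, mul_assoc, h3, mul_one]
  obtain ⟨Y, hY⟩ : ∃ Y, HasDerivAt f Y 0 := by
    have h := (((hFd (0 + a)).comp_add_const 0 a).sub (hFd 0)).mul_const (a⁻¹ • (↑u⁻¹ : A))
    have h' : f = fun t => (F (t + a) - F t) * (a⁻¹ • (↑u⁻¹ : A)) := funext hft
    exact ⟨_, h'.symm ▸ h⟩
  have hYt : ∀ t, HasDerivAt f (f t * Y) t := by
    intro t
    have h4 : HasDerivAt (fun s => f t * f (s - t)) (f t * Y) t := by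
      refine HasDerivAt.const_mul (f t) ?_
      have : HasDerivAt f Y (t - t) := by simpa using hY
      exact this.comp_sub_const t t
    have h5 : (fun s => f t * f (s - t)) = f := by
      funext s
      rw [← hadd]
      congr 1
      ring
    rwa [h5] at h4
  refine ⟨Y, fun t => ?_⟩
  have hE : ∀ s : ℝ, HasDerivAt (fun s : ℝ => NormedSpace.exp (s • (-Y)))
      (-Y * NormedSpace.exp (s • (-Y))) s := fun s => hasDerivAt_exp_smul_const' (-Y) s
  have hconst : ∀ s, f s * NormedSpace.exp (s • (-Y)) = 1 := by
    have hd : ∀ s, HasDerivAt (fun s => f s * NormedSpace.exp (s • (-Y))) 0 s := by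
      intro s
      have := (hYt s).mul (hE s)
      convert! this using 1
      noncomm_ring
    intro s
    have := is_const_of_deriv_eq_zero (fun s => (hd s).differentiableAt)
      (fun s => (hd s).deriv) s 0
    simpa [h0] using this
  have h6 : NormedSpace.exp (t • (-Y)) * NormedSpace.exp (t • Y) = 1 := by
    rw [smul_neg, ← NormedSpace.exp_add_of_commute (Commute.neg_left (Commute.refl _))]
    simp
  calc f t = f t * (NormedSpace.exp (t • (-Y)) * NormedSpace.exp (t • Y)) := by rw [h6, mul_one]
    _ = _ := by rw [← mul_assoc, hconst, one_mul]

/-- The operators on `ℂⁿ`, a Banach algebra isomorphic to the algebra of matrices. -/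
abbrev Op (n : ℕ) : Type := EuclideanSpace ℂ (Fin n) →L[ℂ] EuclideanSpace ℂ (Fin n)

/-- The identification of matrices and operators. -/
@[irreducible] noncomputable def toOp (n : ℕ) : Mat n ≃ₐ[ℂ] Op n :=
  Matrix.toEuclideanCLM.toAlgEquiv

theorem continuous_toOp (n : ℕ) : Continuous (toOp n) :=
  LinearMap.continuous_of_finiteDimensional (toOp n).toLinearMap

theorem continuous_toOp_symm (n : ℕ) : Continuous (toOp n).symm :=
  LinearMap.continuous_of_finiteDimensional (toOp n).symm.toLinearMap

/-- `toOp` as a continuous real-linear equivalence. -/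
noncomputable def toOpL (n : ℕ) : Mat n ≃L[ℝ] Op n where
  toLinearEquiv := (toOp n).toLinearEquiv.restrictScalars ℝ
  continuous_toFun := continuous_toOp n
  continuous_invFun := continuous_toOp_symm n

theorem toOpL_apply {n : ℕ} (X : Mat n) : toOpL n X = toOp n X := rfl

theorem toOpL_mul {n : ℕ} (X Y : Mat n) : toOpL n (X * Y) = toOpL n X * toOpL n Y :=
  map_mul (toOp n) X Y

/-- The entrywise norm on matrices is not submultiplicative; routing products through the operator
algebra makes the calculus of Banach algebras available. -/
theorem matrix_mul_eq {n : ℕ} (X Y : Mat n) :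
    X * Y = (toOpL n).symm (toOpL n X * toOpL n Y) := by
  rw [← toOpL_mul, ContinuousLinearEquiv.symm_apply_apply]

/-- A continuous algebra isomorphism commutes with the exponential series. This transports
smoothness and the derivative of the exponential from operators to matrices. -/
theorem toOpL_exp {n : ℕ} (X : Mat n) :
    toOpL n (NormedSpace.exp X) = NormedSpace.exp (toOpL n X) := by
  simp only [NormedSpace.exp_eq_tsum ℝ, ContinuousLinearEquiv.map_tsum, map_smul, toOpL_apply,
    map_pow]

theorem exp_eq_toOp {n : ℕ} :
    (NormedSpace.exp : Mat n → Mat n) =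
      fun X => (toOpL n).symm (NormedSpace.exp (toOpL n X)) := by
  funext X
  rw [← toOpL_exp, ContinuousLinearEquiv.symm_apply_apply]

theorem contDiff_matrix_exp (n : ℕ) : ContDiff ℝ ω (NormedSpace.exp : Mat n → Mat n) := by
  rw [exp_eq_toOp]
  refine (toOpL n).symm.contDiff.comp (ContDiff.comp ?_ (toOpL n).contDiff)
  exact contDiff_iff_contDiffAt.mpr fun x => (NormedSpace.exp_analytic (𝕂 := ℝ) x).contDiffAt

theorem hasStrictFDerivAt_matrix_exp_zero (n : ℕ) :
    HasStrictFDerivAt (NormedSpace.exp : Mat n → Mat n) (ContinuousLinearMap.id ℝ (Mat n)) 0 := by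
  rw [exp_eq_toOp]
  have h1 : HasStrictFDerivAt (NormedSpace.exp : Op n → Op n) (1 : Op n →L[ℝ] Op n) (toOpL n 0) := by
    rw [map_zero]
    exact hasStrictFDerivAt_exp_zero
  have h2 := ((toOpL n).symm.hasStrictFDerivAt (x := NormedSpace.exp (toOpL n 0))).comp 0
    (h1.comp 0 ((toOpL n).hasStrictFDerivAt (x := 0)))
  refine h2.congr_fderiv ?_
  ext1 X
  exact (toOpL n).symm_apply_apply X

theorem continuous_matrix_exp (n : ℕ) : Continuous (NormedSpace.exp : Mat n → Mat n) :=
  (contDiff_matrix_exp n).continuous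

theorem contDiffOn_matrix_mul {n : ℕ} {E : Type*} [NormedAddCommGroup E] [NormedSpace ℝ E]
    {k : WithTop ℕ∞} {s : Set E} {f g : E → Mat n} (hf : ContDiffOn ℝ k f s)
    (hg : ContDiffOn ℝ k g s) : ContDiffOn ℝ k (fun x => f x * g x) s := by
  simp only [matrix_mul_eq]
  exact (toOpL n).symm.contDiff.comp_contDiffOn
    (((toOpL n).contDiff.comp_contDiffOn hf).mul ((toOpL n).contDiff.comp_contDiffOn hg))

theorem hasDerivAt_matrix_mul {n : ℕ} {f g : ℝ → Mat n} {f' g' : Mat n} {x : ℝ}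
    (hf : HasDerivAt f f' x) (hg : HasDerivAt g g' x) :
    HasDerivAt (fun s => f s * g s) (f' * g x + f x * g') x := by
  have h1 := ((toOpL n).hasFDerivAt (x := f x)).comp_hasDerivAt x hf
  have h2 := ((toOpL n).hasFDerivAt (x := g x)).comp_hasDerivAt x hg
  have h3 := ((toOpL n).symm.hasFDerivAt (x := toOpL n (f x) * toOpL n (g x))).comp_hasDerivAt x
    (h1.mul h2)
  rw [matrix_mul_eq f', matrix_mul_eq (f x) g', ← map_add]
  simp only [matrix_mul_eq (f _)]
  exact h3

end ShelstadGeometry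

namespace ShelstadGeometry
open Filter

variable {n : ℕ}

/-! ### The general linear group -/

/-- The topology of a unit group also records the inverse; as matrix inversion is continuous at
invertible matrices, it agrees with the subspace topology. -/
theorem isEmbedding_coe : Topology.IsEmbedding (fun g : GLn n => (g : Mat n)) := by
  refine Units.isEmbedding_val_mk' (f := fun X : Mat n => X⁻¹) ?_ fun u => (Matrix.coe_units_inv u).symm
  intro X hX
  have h : ContinuousAt Ring.inverse X.det := by
    rw [show (Ring.inverse : ℂ → ℂ) = Inv.inv from Ring.inverse_eq_inv']
    exact continuousAt_inv₀ ((Matrix.isUnit_iff_isUnit_det X).mp hX).ne_zero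
  exact (continuousAt_matrix_inv X h).continuousWithinAt

theorem continuous_coe : Continuous (fun g : GLn n => (g : Mat n)) := isEmbedding_coe.continuous

@[simp] theorem coe_expGL (X : Mat n) : (expGL X : Mat n) = NormedSpace.exp X := rfl

theorem continuous_expGL : Continuous (expGL : Mat n → GLn n) :=
  isEmbedding_coe.continuous_iff.mpr (continuous_matrix_exp n)

@[simp] theorem expGL_zero : expGL (0 : Mat n) = 1 := by
  ext1
  simp

theorem expGL_add {X Y : Mat n} (h : Commute X Y) : expGL (X + Y) = expGL X * expGL Y := by
  ext1
  simpa using Matrix.exp_add_of_commute X Y h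

theorem expGL_add_smul (X : Mat n) (s t : ℝ) :
    expGL ((s + t) • X) = expGL (s • X) * expGL (t • X) := by
  rw [add_smul]
  exact expGL_add (((Commute.refl X).smul_left s).smul_right t)

theorem expGL_neg (X : Mat n) : expGL (-X) = (expGL X)⁻¹ := by
  rw [eq_inv_iff_mul_eq_one, ← expGL_add (Commute.neg_left (Commute.refl X))]
  simp

theorem expGL_nsmul (m : ℕ) (X : Mat n) : expGL (m • X) = expGL X ^ m := by
  ext1
  simpa using Matrix.exp_nsmul m X

theorem expGL_zsmul (m : ℤ) (X : Mat n) : expGL (m • X) = expGL X ^ m := by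
  obtain ⟨k, rfl | rfl⟩ := m.eq_nat_or_neg
  · rw [natCast_zsmul, expGL_nsmul, zpow_natCast]
  · rw [neg_smul, natCast_zsmul, expGL_neg, expGL_nsmul, zpow_neg, zpow_natCast]

theorem expGL_Ad (g : GLn n) (X : Mat n) : expGL (Ad g X) = g * expGL X * g⁻¹ := by
  ext1
  simpa [Ad] using Matrix.exp_units_conj g X

/-- `Ad g` as a complex linear equivalence. -/
noncomputable def adEquiv (g : GLn n) : Mat n ≃ₗ[ℂ] Mat n where
  toFun := Ad g
  invFun := Ad g⁻¹
  map_add' X Y := by simp [Ad, mul_add, add_mul]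
  map_smul' c X := by simp [Ad]
  left_inv X := by simp [Ad, ← mul_assoc]
  right_inv X := by simp [Ad, ← mul_assoc]

theorem Ad_mul (g h : GLn n) (X : Mat n) : Ad (g * h) X = Ad g (Ad h X) := by
  simp [Ad, mul_assoc]

@[simp] theorem Ad_one (X : Mat n) : Ad 1 X = X := by simp [Ad]

@[simp] theorem Ad_inv_Ad (g : GLn n) (X : Mat n) : Ad g⁻¹ (Ad g X) = X := by
  rw [← Ad_mul]; simp

@[simp] theorem Ad_Ad_inv (g : GLn n) (X : Mat n) : Ad g (Ad g⁻¹ X) = X := by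
  rw [← Ad_mul]; simp

theorem Ad_add (g : GLn n) (X Y : Mat n) : Ad g (X + Y) = Ad g X + Ad g Y := map_add (adEquiv g) X Y

theorem Ad_sub (g : GLn n) (X Y : Mat n) : Ad g (X - Y) = Ad g X - Ad g Y := map_sub (adEquiv g) X Y

theorem Ad_smul (g : GLn n) (c : ℂ) (X : Mat n) : Ad g (c • X) = c • Ad g X :=
  map_smul (adEquiv g) c X

theorem Ad_rsmul (g : GLn n) (c : ℝ) (X : Mat n) : Ad g (c • X) = c • Ad g X := by
  simp [Ad]

@[simp] theorem Ad_zero (g : GLn n) : Ad g 0 = 0 := map_zero (adEquiv g)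

theorem Ad_lie (g : GLn n) (X Y : Mat n) : Ad g (X * Y - Y * X) = Ad g X * Ad g Y - Ad g Y * Ad g X := by
  simp [Ad, mul_sub, sub_mul, mul_assoc]

/-! ### Powers along a curve -/

theorem hasDerivAt_coe_expGL_smul (X : Mat n) :
    HasDerivAt (fun s : ℝ => (expGL (s • X) : Mat n)) X 0 := by
  have h1 : HasDerivAt (fun s : ℝ => s • X) X 0 := by
    have h := (hasDerivAt_id (0 : ℝ)).smul_const X
    rw [one_smul] at h
    exact h
  have h2 : HasFDerivAt (NormedSpace.exp : Mat n → Mat n) (ContinuousLinearMap.id ℝ (Mat n))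
      ((0 : ℝ) • X) := by
    rw [zero_smul]
    exact (hasStrictFDerivAt_matrix_exp_zero n).hasFDerivAt
  exact h2.comp_hasDerivAt (0 : ℝ) h1

/-- With L a local inverse of the exponential, c(t/m)^m = exp(m L(c(t/m))) for large m, and m
L(c(t/m)) tends to tX because L ∘ c has derivative X at 0. -/
theorem tendsto_pow_curve {c : ℝ → GLn n} {X : Mat n} (h0 : c 0 = 1)
    (hc : HasDerivAt (fun s => (c s : Mat n)) X 0) (t : ℝ) :
    Tendsto (fun m : ℕ => c (t / m) ^ m) atTop (𝓝 (expGL (t • X))) := by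
  have hs : HasStrictFDerivAt (NormedSpace.exp : Mat n → Mat n)
      ((ContinuousLinearEquiv.refl ℝ (Mat n) : Mat n ≃L[ℝ] Mat n) : Mat n →L[ℝ] Mat n) 0 :=
    hasStrictFDerivAt_matrix_exp_zero n
  set L : Mat n → Mat n := hs.localInverse _ _ _ with hL
  have hL0 : L 1 = 0 := by
    have := hs.localInverse_apply_image
    simpa using this
  have hLr : ∀ᶠ g in 𝓝 (1 : Mat n), NormedSpace.exp (L g) = g := by
    have := hs.eventually_right_inverse
    rw [NormedSpace.exp_zero] at this
    exact this
  have hLd : HasFDerivAt L (ContinuousLinearMap.id ℝ (Mat n)) (1 : Mat n) := by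
    have := hs.to_localInverse.hasFDerivAt
    rw [NormedSpace.exp_zero] at this
    exact this
  have hLd' : HasDerivAt (fun s => L (c s)) X 0 := by
    have h : HasFDerivAt L (ContinuousLinearMap.id ℝ (Mat n)) (c 0 : Mat n) := by
      rw [h0]
      simpa using hLd
    exact h.comp_hasDerivAt (0 : ℝ) hc
  have hdiv : Tendsto (fun m : ℕ => t / (m : ℝ)) atTop (𝓝 0) :=
    tendsto_const_div_atTop_nhds_zero_nat t
  have hlim : Tendsto (fun m : ℕ => (m : ℝ) • L (c (t / m))) atTop (𝓝 (t • X)) := by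
    rcases eq_or_ne t 0 with rfl | ht
    · simp [h0, hL0]
    have h1 := hLd'.tendsto_slope_zero
    simp only [zero_add, h0, Units.val_one, hL0, sub_zero] at h1
    have h2 : Tendsto (fun m : ℕ => t / (m : ℝ)) atTop (𝓝[≠] 0) := by
      refine tendsto_nhdsWithin_iff.mpr ⟨hdiv, ?_⟩
      filter_upwards [eventually_gt_atTop 0] with m hm
      exact div_ne_zero ht (by exact_mod_cast hm.ne')
    refine ((h1.comp h2).const_smul t).congr' ?_
    filter_upwards [eventually_gt_atTop 0] with m hm
    have hm' : (m : ℝ) ≠ 0 := by exact_mod_cast hm.ne'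
    simp only [Function.comp, smul_smul]
    congr 1
    field_simp
  have hev : ∀ᶠ m : ℕ in atTop, expGL (L (c (t / m))) = c (t / m) := by
    have hcc : ContinuousAt (fun s => (c s : Mat n)) 0 := hc.continuousAt
    have h3 : Tendsto (fun m : ℕ => (c (t / m) : Mat n)) atTop (𝓝 1) := by
      have := hcc.tendsto.comp hdiv
      simpa [h0, Function.comp_def] using this
    filter_upwards [h3.eventually hLr] with m hm
    ext1
    exact hm
  refine ((continuous_expGL.tendsto _).comp hlim).congr' ?_
  filter_upwards [hev] with m hm
  simp only [Function.comp]
  rw [Nat.cast_smul_eq_nsmul, expGL_nsmul, hm]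

theorem exists_expGL_of_continuous_hom (f : ℝ → GLn n) (hf : Continuous f) (h0 : f 0 = 1)
    (hadd : ∀ s t, f (s + t) = f s * f t) : ∃ Y : Mat n, ∀ t : ℝ, f t = expGL (t • Y) := by
  obtain ⟨Y, hY⟩ := exists_exp_of_continuous_hom (fun t => toOpL n (f t))
    ((toOpL n).continuous.comp (continuous_coe.comp hf)) (by simp [h0, toOpL_apply])
    (fun s t => by simp [hadd, toOpL_mul])
  refine ⟨(toOpL n).symm Y, fun t => ?_⟩
  ext1
  apply (toOpL n).injective
  rw [hY, coe_expGL, toOpL_exp, map_smul, ContinuousLinearEquiv.apply_symm_apply]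

/-! ### The Lie algebra of a closed subgroup -/

section Closed
variable {H : Subgroup (GLn n)}

/-- The powers c(t/m)^m lie in `H` for large m, and so does their limit. Applied to the curve
exp(sX) exp(sY), this shows that generators of one-parameter subgroups can be added. -/
theorem expGL_mem_of_hasDerivAt (hH : IsClosed (H : Set (GLn n))) {c : ℝ → GLn n} {X : Mat n}
    (h0 : c 0 = 1) (hc : HasDerivAt (fun s => (c s : Mat n)) X 0)
    (hcH : ∀ᶠ s in 𝓝 0, c s ∈ H) (t : ℝ) : expGL (t • X) ∈ H := by
  refine hH.mem_of_tendsto (tendsto_pow_curve h0 hc t) ?_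
  filter_upwards [(tendsto_const_div_atTop_nhds_zero_nat t).eventually hcH] with m hm
  exact H.pow_mem hm m

theorem hasDerivAt_expGL_mul_expGL (X Y : Mat n) :
    HasDerivAt (fun s : ℝ => ((expGL (s • X) * expGL (s • Y) : GLn n) : Mat n)) (X + Y) 0 := by
  have := hasDerivAt_matrix_mul (hasDerivAt_coe_expGL_smul X) (hasDerivAt_coe_expGL_smul Y)
  simpa using this

/-- The matrices generating one-parameter subgroups of a closed subgroup. -/
noncomputable def lieSubmodule (hH : IsClosed (H : Set (GLn n))) : Submodule ℝ (Mat n) where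
  carrier := {X | ∀ t : ℝ, expGL (t • X) ∈ H}
  zero_mem' t := by simp
  add_mem' {X Y} hX hY t :=
    expGL_mem_of_hasDerivAt hH (by simp) (hasDerivAt_expGL_mul_expGL X Y)
      (Eventually.of_forall fun s => H.mul_mem (hX s) (hY s)) t
  smul_mem' c X hX t := by
    rw [smul_smul]
    exact hX _

theorem hasDerivAt_Ad (X Y : Mat n) :
    HasDerivAt (fun s : ℝ => Ad (expGL (s • X)) Y) (X * Y - Y * X) 0 := by
  have h1 := hasDerivAt_coe_expGL_smul X
  have h2 : HasDerivAt (fun s : ℝ => ((expGL (s • X))⁻¹ : GLn n).val) (-X) 0 := by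
    have := hasDerivAt_coe_expGL_smul (-X)
    simpa only [smul_neg, expGL_neg] using this
  have h3 := hasDerivAt_matrix_mul (hasDerivAt_matrix_mul h1 (hasDerivAt_const (0 : ℝ) Y)) h2
  refine h3.congr_deriv ?_
  simp
  abel

/-- Finite-dimensional subspaces are closed, so they contain limits of difference quotients. -/
theorem hasDerivAt_mem {V : Type*} [NormedAddCommGroup V] [NormedSpace ℝ V] [FiniteDimensional ℝ V]
    (W : Submodule ℝ V) {c : ℝ → V} {v : V} (hc : HasDerivAt c v 0)
    (hW : ∀ᶠ s in 𝓝 0, c s ∈ W) : v ∈ W := by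
  have hcl : IsClosed (W : Set V) := W.closed_of_finiteDimensional
  have h0 : c 0 ∈ W := hW.self_of_nhds
  have h1 := hc.tendsto_slope_zero
  refine hcl.mem_of_tendsto h1 ?_
  have h2 : ∀ᶠ s in 𝓝[≠] (0 : ℝ), c (0 + s) ∈ W := by
    simpa using hW.filter_mono nhdsWithin_le_nhds
  filter_upwards [h2] with s hs
  exact W.smul_mem _ (W.sub_mem hs h0)

/-- For closed `H` the generating set of `lieAlg` is already a Lie subalgebra: sums are handled by
`lieSubmodule`, and [X, Y] is the derivative at 0 of the curve Ad(exp(sX))Y inside that subspace. -/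
theorem mem_lieAlg_iff (hH : IsClosed (H : Set (GLn n))) {X : Mat n} :
    X ∈ lieAlg H ↔ ∀ t : ℝ, expGL (t • X) ∈ H := by
  refine ⟨fun hX => ?_, fun hX => LieSubalgebra.subset_lieSpan hX⟩
  let K : LieSubalgebra ℝ (Mat n) :=
    { lieSubmodule hH with
      lie_mem' := by
        intro X Y hX hY
        change ⁅X, Y⁆ ∈ lieSubmodule hH
        rw [LieRing.of_associative_ring_bracket]
        refine hasDerivAt_mem _ (hasDerivAt_Ad X Y) (Eventually.of_forall fun s t => ?_)
        rw [← Ad_rsmul, expGL_Ad]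
        exact H.mul_mem (H.mul_mem (hX s) (hY t)) (H.inv_mem (hX s)) }
  have h : lieAlg H ≤ K := LieSubalgebra.lieSpan_le.mpr fun Y hY => hY
  exact h hX

theorem expGL_mem (hH : IsClosed (H : Set (GLn n))) {X : Mat n} (hX : X ∈ lieAlg H) :
    expGL X ∈ H := by
  simpa using (mem_lieAlg_iff hH).mp hX 1

theorem mem_lieAlg_of_hasDerivAt (hH : IsClosed (H : Set (GLn n))) {c : ℝ → GLn n} {X : Mat n}
    (h0 : c 0 = 1) (hc : HasDerivAt (fun s => (c s : Mat n)) X 0)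
    (hcH : ∀ᶠ s in 𝓝 0, c s ∈ H) : X ∈ lieAlg H :=
  (mem_lieAlg_iff hH).mpr (expGL_mem_of_hasDerivAt hH h0 hc hcH)

theorem Ad_mem_lieAlg (hH : IsClosed (H : Set (GLn n))) {g : GLn n}
    (hg : ∀ h ∈ H, g * h * g⁻¹ ∈ H) {X : Mat n} (hX : X ∈ lieAlg H) : Ad g X ∈ lieAlg H := by
  rw [mem_lieAlg_iff hH] at hX ⊢
  intro t
  rw [← Ad_rsmul, expGL_Ad]
  exact hg _ (hX t)

theorem lie_mem_lieAlg {X Y : Mat n} (hX : X ∈ lieAlg H) (hY : Y ∈ lieAlg H) :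
    X * Y - Y * X ∈ lieAlg H := by
  rw [← LieRing.of_associative_ring_bracket]
  exact (lieAlg H).lie_mem hX hY

theorem lieAlg_mono {H H' : Subgroup (GLn n)} (h : H ≤ H') : lieAlg H ≤ lieAlg H' :=
  LieSubalgebra.lieSpan_mono fun _ hX t => h (hX t)

/-- Near `0`, a complement of the Lie algebra of `H` meets `log H` in `0` only. -/
theorem eventually_eq_zero_of_expGL_mem (hH : IsClosed (H : Set (GLn n)))
    (W : Submodule ℝ (Mat n)) (hW : ∀ X ∈ W, X ∈ lieAlg H → X = 0) :
    ∀ᶠ Y in 𝓝 (0 : Mat n), Y ∈ W → expGL Y ∈ H → Y = 0 := by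
  by_contra hcon
  have hfr : ∃ᶠ Y in 𝓝 (0 : Mat n), Y ∈ W ∧ expGL Y ∈ H ∧ Y ≠ 0 := by
    refine (not_eventually.mp hcon).mono fun Y hY => ?_
    push Not at hY
    exact hY
  have : (𝓝 (0 : Mat n)).IsCountablyGenerated :=
    (inferInstance : FirstCountableTopology (Fin n → Fin n → ℂ)).nhds_generated_countable 0
  -- Otherwise some nonzero vectors of `W` tending to 0 have exponentials in `H`; their directions
  -- accumulate at a unit vector `Y` of `W`.
  obtain ⟨y, hy0, hy⟩ := exists_seq_forall_of_frequently hfr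
  have hsph : ∀ k, ‖y k‖⁻¹ • y k ∈ Metric.sphere (0 : Mat n) 1 := fun k => by
    have : ‖y k‖ ≠ 0 := norm_ne_zero_iff.mpr (hy k).2.2
    simp [norm_smul, this]
  obtain ⟨Y, hY1, ψ, hψ, hYlim⟩ := (isCompact_sphere (0 : Mat n) 1).tendsto_subseq hsph
  have hYW : Y ∈ W := by
    have hcl : IsClosed (W : Set (Mat n)) := W.closed_of_finiteDimensional
    exact hcl.mem_of_tendsto hYlim (Eventually.of_forall fun k => W.smul_mem _ (hy _).1)
  have hYH : Y ∈ lieAlg H := by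
    rw [mem_lieAlg_iff hH]
    intro t
    have hn0 : Tendsto (fun k => ‖y (ψ k)‖) atTop (𝓝 0) := by
      simpa using (hy0.comp hψ.tendsto_atTop).norm
    -- Integer multiples of the y's approximate tY with error at most the norm of y, and their
    -- exponentials are powers of elements of `H`. So `Y` lies in the Lie algebra as well.
    have hlim : Tendsto (fun k => (⌊t / ‖y (ψ k)‖⌋ : ℤ) • y (ψ k)) atTop (𝓝 (t • Y)) := by
      have h1 : Tendsto (fun k => (⌊t / ‖y (ψ k)‖⌋ : ℝ) * ‖y (ψ k)‖) atTop (𝓝 t) := by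
        have h2 : ∀ k, |(⌊t / ‖y (ψ k)‖⌋ : ℝ) * ‖y (ψ k)‖ - t| ≤ ‖y (ψ k)‖ := by
          intro k
          have hp : 0 < ‖y (ψ k)‖ := norm_pos_iff.mpr (hy _).2.2
          have h3 := Int.floor_le (t / ‖y (ψ k)‖)
          have h4 := Int.lt_floor_add_one (t / ‖y (ψ k)‖)
          rw [le_div_iff₀ hp] at h3
          rw [div_lt_iff₀ hp] at h4
          rw [abs_le]
          constructor <;> nlinarith
        rw [tendsto_iff_norm_sub_tendsto_zero]
        exact squeeze_zero (fun k => norm_nonneg _) h2 hn0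
      refine (h1.smul hYlim).congr fun k => ?_
      have hp : ‖y (ψ k)‖ ≠ 0 := norm_ne_zero_iff.mpr (hy _).2.2
      simp only [Function.comp]
      rw [smul_smul, mul_assoc, mul_inv_cancel₀ hp, mul_one, Int.cast_smul_eq_zsmul]
    refine hH.mem_of_tendsto ((continuous_expGL.tendsto _).comp hlim)
      (Eventually.of_forall fun k => ?_)
    simp only [Function.comp, expGL_zsmul]
    exact H.zpow_mem (hy _).2.1 _
  have := hW Y hYW hYH
  simp [this] at hY1

end Closed

end ShelstadGeometry

namespace ShelstadGeometry
open Filter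

variable {n : ℕ}

/-! ### Slices -/

theorem hasFDerivAt_matrix_mul_of_one {E : Type*} [NormedAddCommGroup E] [NormedSpace ℝ E]
    {f g : E → Mat n} {f' g' : E →L[ℝ] Mat n} {x : E} (hf : HasFDerivAt f f' x)
    (hg : HasFDerivAt g g' x) (hf1 : f x = 1) (hg1 : g x = 1) :
    HasFDerivAt (fun y => f y * g y) (f' + g') x := by
  simp only [matrix_mul_eq (f _)]
  have h1 := ((toOpL n).hasFDerivAt (x := f x)).comp x hf
  have h2 := ((toOpL n).hasFDerivAt (x := g x)).comp x hg
  have h3 := ((toOpL n).symm.hasFDerivAt (x := toOpL n (f x) * toOpL n (g x))).comp x (h1.mul' h2)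
  refine h3.congr_fderiv ?_
  have h4 : toOpL n 1 = 1 := map_one (toOp n)
  ext1 v
  change (toOpL n).symm (toOpL n (f x) * toOpL n (g' v) + toOpL n (f' v) * toOpL n (g x)) =
    f' v + g' v
  rw [hf1, hg1, h4, one_mul, mul_one, ← map_add, ContinuousLinearEquiv.symm_apply_apply, add_comm]

/-- The Lie algebra of `H` as a subspace. -/
noncomputable def lieSub (H : Subgroup (GLn n)) : Submodule ℝ (Mat n) := (lieAlg H).toSubmodule

theorem completeSpace_of_finiteDimensional (E : Type*) [NormedAddCommGroup E] [NormedSpace ℝ E]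
    [FiniteDimensional ℝ E] : CompleteSpace E := FiniteDimensional.complete ℝ E

theorem finiteDimensional_prod (E F : Type*) [NormedAddCommGroup E] [NormedSpace ℝ E]
    [FiniteDimensional ℝ E] [NormedAddCommGroup F] [NormedSpace ℝ F]
    [FiniteDimensional ℝ F] : FiniteDimensional ℝ (E × F) := inferInstance

/-- For a complement c of the Lie algebra of `H` in all matrices, (X, Z, Y) ↦ exp(X) exp(Z) exp(Y)
on m × 𝔱 × c has the sum map as derivative at 0, an isomorphism, so it is invertible near 0. On `H`
the third coordinate vanishes near 1, because small elements of c with exponential in `H` are zero.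
-/
theorem exists_slice_chart {H T : Subgroup (GLn n)} (hH : IsClosed (H : Set (GLn n)))
    (hT : IsClosed (T : Set (GLn n))) (hTH : T ≤ H) (m : Submodule ℝ (Mat n))
    (hm : m ≤ lieSub H) (hdisj : ∀ X ∈ m, X ∈ lieAlg T → X = 0)
    (hsup : ∀ X ∈ lieAlg H, ∃ Y ∈ m, X - Y ∈ lieAlg T) :
    ∃ (N : Set (Mat n)) (f : Mat n → m) (z : Mat n → lieSub T), IsOpen N ∧ 1 ∈ N ∧
      ContDiffOn ℝ ∞ f N ∧ ContDiffOn ℝ ∞ z N ∧ f 1 = 0 ∧ z 1 = 0 ∧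
      (∀ g ∈ H, (g : Mat n) ∈ N → g = expGL (f g : Mat n) * expGL (z g : Mat n)) ∧
      ∀ᶠ p in 𝓝 (0 : m × lieSub T),
        f (NormedSpace.exp (p.1 : Mat n) * NormedSpace.exp (p.2 : Mat n)) = p.1 ∧
        z (NormedSpace.exp (p.1 : Mat n) * NormedSpace.exp (p.2 : Mat n)) = p.2 := by
  obtain ⟨c, hc⟩ := (lieSub H).exists_isCompl
  let E := m × lieSub T × c
  let p1 : E →L[ℝ] Mat n := m.subtypeL.comp (ContinuousLinearMap.fst ℝ _ _)
  let p2 : E →L[ℝ] Mat n := (lieSub T).subtypeL.comp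
    ((ContinuousLinearMap.fst ℝ _ _).comp (ContinuousLinearMap.snd ℝ _ _))
  let p3 : E →L[ℝ] Mat n := c.subtypeL.comp
    ((ContinuousLinearMap.snd ℝ _ _).comp (ContinuousLinearMap.snd ℝ _ _))
  let Φ : E → Mat n := fun p => NormedSpace.exp (p1 p) * NormedSpace.exp (p2 p) *
    NormedSpace.exp (p3 p)
  have hbij : Function.Bijective (p1 + p2 + p3).toLinearMap := by
    constructor
    · rw [← LinearMap.ker_eq_bot, LinearMap.ker_eq_bot']
      rintro ⟨X, Z, Y⟩ h
      have h' : (X : Mat n) + (Z : Mat n) + (Y : Mat n) = 0 := h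
      have hTH' : (Z : Mat n) ∈ lieSub H := lieAlg_mono hTH Z.2
      have hY : (Y : Mat n) = 0 := by
        refine Submodule.disjoint_def.mp hc.disjoint _ ?_ Y.2
        rw [← neg_eq_of_add_eq_zero_right h']
        exact (lieSub H).neg_mem ((lieSub H).add_mem (hm X.2) hTH')
      rw [hY, add_zero] at h'
      have hX : (X : Mat n) = 0 := by
        refine hdisj _ X.2 ?_
        rw [eq_neg_of_add_eq_zero_left h']
        exact (lieSub T).neg_mem Z.2
      rw [hX, zero_add] at h'
      ext1
      · exact Subtype.ext hX
      · exact Prod.ext (Subtype.ext h') (Subtype.ext hY)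
    · intro X
      have hX : X ∈ lieSub H ⊔ c := by rw [hc.sup_eq_top]; trivial
      obtain ⟨A, hA, Y, hY, rfl⟩ := Submodule.mem_sup.mp hX
      obtain ⟨M, hM, hZ⟩ := hsup A hA
      refine ⟨(⟨M, hM⟩, ⟨A - M, hZ⟩, ⟨Y, hY⟩), ?_⟩
      change M + (A - M) + Y = A + Y
      abel
  have hfd' := finiteDimensional_prod (lieSub T) c
  have hfd := finiteDimensional_prod m (lieSub T × c)
  have hcs := completeSpace_of_finiteDimensional E
  let e : E ≃L[ℝ] Mat n := (LinearEquiv.ofBijective _ hbij).toContinuousLinearEquiv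
  have he : (e : E →L[ℝ] Mat n) = p1 + p2 + p3 :=
    ContinuousLinearMap.ext fun _ => rfl
  have hΦ0 : Φ 0 = 1 := by simp [Φ]
  have hΦd : HasFDerivAt Φ (e : E →L[ℝ] Mat n) 0 := by
    rw [he]
    have hexp : ∀ q : E →L[ℝ] Mat n, HasFDerivAt (fun p => NormedSpace.exp (q p)) q 0 := by
      intro q
      have h1 : HasFDerivAt (NormedSpace.exp : Mat n → Mat n) (ContinuousLinearMap.id ℝ (Mat n))
          (q 0) := by
        rw [map_zero]
        exact (hasStrictFDerivAt_matrix_exp_zero n).hasFDerivAt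
      exact h1.comp 0 q.hasFDerivAt
    exact hasFDerivAt_matrix_mul_of_one
      (hasFDerivAt_matrix_mul_of_one (hexp p1) (hexp p2) (by simp) (by simp)) (hexp p3)
      (by simp) (by simp)
  have hΦs : ContDiff ℝ ω Φ := by
    have hexp : ∀ q : E →L[ℝ] Mat n, ContDiffOn ℝ ω (fun p => NormedSpace.exp (q p)) Set.univ :=
      fun q => ((contDiff_matrix_exp n).comp q.contDiff).contDiffOn
    exact contDiffOn_univ.mp
      (contDiffOn_matrix_mul (contDiffOn_matrix_mul (hexp p1) (hexp p2)) (hexp p3))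
  have hs : ContDiffAt ℝ ω Φ 0 := hΦs.contDiffAt
  let L : Mat n → E := hs.localInverse hΦd (by simp)
  have hL1 : L 1 = 0 := by
    have := hs.localInverse_apply_image hΦd (by simp)
    rwa [hΦ0] at this
  have hLs : ContDiffAt ℝ ω L 1 := by
    have := hs.to_localInverse hΦd (by simp)
    rwa [hΦ0] at this
  have hstrict := hs.hasStrictFDerivAt' hΦd (by simp)
  have hLl : ∀ᶠ p in 𝓝 (0 : E), L (Φ p) = p := hstrict.eventually_left_inverse
  have hLr : ∀ᶠ g in 𝓝 (1 : Mat n), Φ (L g) = g := by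
    have := hstrict.eventually_right_inverse
    rwa [hΦ0] at this
  have hcont : ContinuousAt L 1 := hLs.continuousAt
  have hvN : ∀ᶠ g in 𝓝 (1 : Mat n), expGL (p3 (L g)) ∈ H → p3 (L g) = 0 := by
    have h1 := eventually_eq_zero_of_expGL_mem hH c
      (fun X hX hXH => Submodule.disjoint_def.mp hc.disjoint _ hXH hX)
    have h2 : Tendsto (fun g => p3 (L g)) (𝓝 (1 : Mat n)) (𝓝 0) := by
      have h3 : Tendsto (fun g => p3 (L g)) (𝓝 (1 : Mat n)) (𝓝 (p3 (L 1))) :=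
        (p3.continuous.continuousAt.comp hcont).tendsto
      rwa [hL1, map_zero] at h3
    filter_upwards [h2.eventually h1] with g hg hgH
    exact hg (L g).2.2.2 hgH
  -- Analyticity at a point spreads to a neighbourhood, whereas this argument is not available for
  -- smoothness of order ∞ at a point; this is why the order is `ω` so far.
  have hLs' : ∀ᶠ g in 𝓝 (1 : Mat n), ContDiffAt ℝ ω L g := hLs.eventually (by simp)
  obtain ⟨N, hN, hNo, h1N⟩ := eventually_nhds_iff.mp (hLr.and (hvN.and hLs'))
  refine ⟨N, fun g => (L g).1, fun g => (L g).2.1, hNo, h1N, ?_, ?_, by simp [hL1],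
    by simp [hL1], ?_, ?_⟩
  · intro g hg
    exact (contDiff_fst.contDiffAt.comp g
      ((hN g hg).2.2.of_le (by exact le_top))).contDiffWithinAt
  · intro g hg
    exact (contDiff_fst.contDiffAt.comp g (contDiff_snd.contDiffAt.comp g
      ((hN g hg).2.2.of_le (by exact le_top)))).contDiffWithinAt
  · intro g hg hgN
    obtain ⟨h1, h2, -⟩ := hN g hgN
    have h3 : g = expGL (p1 (L g)) * expGL (p2 (L g)) * expGL (p3 (L g)) := by
      ext1
      exact h1.symm
    have h4 : expGL (p1 (L g)) * expGL (p2 (L g)) ∈ H :=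
      H.mul_mem (expGL_mem hH (hm (L g).1.2)) (hTH (expGL_mem hT (L g).2.1.2))
    have h5 : expGL (p3 (L g)) ∈ H := by
      rw [h3] at hg
      exact (H.mul_mem_cancel_left h4).mp hg
    rw [h2 h5, expGL_zero, mul_one] at h3
    exact h3
  · have h1 : Tendsto (fun p : m × lieSub T => ((p.1, p.2, 0) : E)) (𝓝 0) (𝓝 0) := by
      have : Continuous (fun p : m × lieSub T => ((p.1, p.2, 0) : E)) := by fun_prop
      exact this.tendsto 0
    filter_upwards [h1.eventually hLl] with p hp
    have h2 : Φ (p.1, p.2, 0) =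
        NormedSpace.exp (p.1 : Mat n) * NormedSpace.exp (p.2 : Mat n) := by
      change NormedSpace.exp (p.1 : Mat n) * NormedSpace.exp (p.2 : Mat n) *
        NormedSpace.exp (0 : Mat n) = _
      rw [NormedSpace.exp_zero, mul_one]
    rw [h2] at hp
    rw [hp]
    exact ⟨rfl, rfl⟩

/-- Near `1`, a closed subgroup is the image of its Lie algebra. -/
theorem eventually_eq_expGL {H : Subgroup (GLn n)} (hH : IsClosed (H : Set (GLn n))) :
    ∃ z : Mat n → lieSub H, ContinuousAt z 1 ∧ z 1 = 0 ∧
      ∀ᶠ g : GLn n in 𝓝 1, g ∈ H → g = expGL (z g : Mat n) := by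
  -- With `T` replaced by `H` and with m = 0, the slice chart is a logarithm on `H`.
  obtain ⟨N, f, z, hN, h1, -, hz, -, hz1, h, -⟩ := exists_slice_chart hH hH le_rfl ⊥ bot_le
    (fun X hX _ => hX) (fun X hX => ⟨0, Submodule.zero_mem _, by simpa using hX⟩)
  refine ⟨z, hz.continuousOn.continuousAt (hN.mem_nhds h1), hz1, ?_⟩
  have : ∀ᶠ g : GLn n in 𝓝 1, (g : Mat n) ∈ N :=
    continuous_coe.continuousAt.eventually (hN.mem_nhds h1)
  filter_upwards [this] with g hg hgH
  have h2 := h g hgH hg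
  rwa [(Submodule.mem_bot ℝ).mp (f g).2, expGL_zero, one_mul] at h2

/-- The intersection of `H'` with `H` contains a neighbourhood of 1 in `H`, so it is an open, hence
also closed, subgroup of the connected group `H`. -/
theorem le_of_expGL_mem {H H' : Subgroup (GLn n)} (hH : IsClosed (H : Set (GLn n)))
    (hc : IsConnected (H : Set (GLn n))) (h : ∀ X ∈ lieAlg H, expGL X ∈ H') : H ≤ H' := by
  obtain ⟨z, -, -, hz⟩ := eventually_eq_expGL hH
  have : ConnectedSpace H := isConnected_iff_connectedSpace.mp hc
  have ho : IsOpen ((H'.subgroupOf H : Subgroup H) : Set H) := by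
    refine Subgroup.isOpen_of_mem_nhds _ (g := 1) ?_
    have h1 : ∀ᶠ g : H in 𝓝 1, (g : GLn n) ∈ H → (g : GLn n) = expGL (z (g : GLn n) : Mat n) :=
      ((continuous_subtype_val (p := fun g : GLn n => g ∈ H)).tendsto 1).eventually hz
    filter_upwards [h1] with g hg
    change (g : GLn n) ∈ H'
    rw [hg g.2]
    exact h _ (z _).2
  have hcl : IsClopen ((H'.subgroupOf H : Subgroup H) : Set H) :=
    ⟨Subgroup.isClosed_of_isOpen _ ho, ho⟩
  have hu := hcl.eq_univ ⟨1, one_mem _⟩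
  intro g hg
  have : (⟨g, hg⟩ : H) ∈ ((H'.subgroupOf H : Subgroup H) : Set H) := by rw [hu]; trivial
  exact this

/-- A chart of `H` near `1` adapted to the decomposition of the Lie algebra of `H` into `m` and
the Lie algebra of `T`, together with a neighbourhood `O` of `0` in `m` on which
`X ↦ exp(X) T` is injective. -/
structure SliceChart (H T : Subgroup (GLn n)) (m : Submodule ℝ (Mat n)) where
  N : Set (Mat n)
  f : Mat n → m
  z : Mat n → lieSub T
  O : Set m
  isOpen_N : IsOpen N
  contDiffOn_f : ContDiffOn ℝ ∞ f N
  contDiffOn_z : ContDiffOn ℝ ∞ z N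
  eq_mul : ∀ g ∈ H, (g : Mat n) ∈ N → g = expGL (f g : Mat n) * expGL (z g : Mat n)
  isOpen_O : IsOpen O
  zero_mem : 0 ∈ O
  exp_mem : ∀ X ∈ O, NormedSpace.exp (X : Mat n) ∈ N
  f_exp : ∀ X ∈ O, f (NormedSpace.exp (X : Mat n)) = X
  inj : ∀ X ∈ O, ∀ X' ∈ O, ∀ t ∈ T, expGL (X : Mat n) = expGL (X' : Mat n) * t → X = X'

/-- For injectivity: if exp(X) = exp(X') t with X and X' small, then t = exp(-X') exp(X) is near 1
in `T`, so t = exp(ζ) with ζ small, and the first chart coordinate of exp(X) = exp(X') exp(ζ) is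
both X and X'. -/
theorem nonempty_sliceChart {H T : Subgroup (GLn n)} (hH : IsClosed (H : Set (GLn n)))
    (hT : IsClosed (T : Set (GLn n))) (hTH : T ≤ H) (m : Submodule ℝ (Mat n))
    (hm : m ≤ lieSub H) (hdisj : ∀ X ∈ m, X ∈ lieAlg T → X = 0)
    (hsup : ∀ X ∈ lieAlg H, ∃ Y ∈ m, X - Y ∈ lieAlg T) : Nonempty (SliceChart H T m) := by
  obtain ⟨N, f, z, hN, h1N, hf, hz, hf1, hz1, hmul, hev⟩ :=
    exists_slice_chart hH hT hTH m hm hdisj hsup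
  obtain ⟨ζ, hζ, hζ1, hζT⟩ := eventually_eq_expGL hT
  have hcX : Continuous fun X : m => NormedSpace.exp (X : Mat n) :=
    (continuous_matrix_exp n).comp continuous_subtype_val
  have e1 : ∀ᶠ X : m in 𝓝 0, NormedSpace.exp (X : Mat n) ∈ N := by
    refine hcX.continuousAt.eventually (hN.mem_nhds ?_)
    simpa using h1N
  have e2 : ∀ᶠ X : m in 𝓝 0, f (NormedSpace.exp (X : Mat n)) = X := by
    have hc : Tendsto (fun X : m => ((X, 0) : m × lieSub T)) (𝓝 0) (𝓝 0) := by
      have : Continuous fun X : m => ((X, 0) : m × lieSub T) := by fun_prop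
      exact this.tendsto 0
    filter_upwards [hc.eventually hev] with X hX
    simpa using hX.1
  -- the element of `T` relating two exponentials
  let τ : m × m → GLn n := fun p => expGL (-(p.2 : Mat n)) * expGL (p.1 : Mat n)
  have hτ : Continuous τ := by
    refine (continuous_expGL.comp ?_).mul (continuous_expGL.comp ?_)
    · exact (continuous_subtype_val.comp continuous_snd).neg
    · exact continuous_subtype_val.comp continuous_fst
  have hτ0 : τ 0 = 1 := by simp [τ]
  have e3 : ∀ᶠ p : m × m in 𝓝 0, τ p ∈ T → τ p = expGL (ζ (τ p) : Mat n) := by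
    have := hτ.continuousAt (x := 0)
    rw [ContinuousAt, hτ0] at this
    exact this.eventually hζT
  have e4 : ∀ᶠ p : m × m in 𝓝 0,
      f (NormedSpace.exp (p.2 : Mat n) * NormedSpace.exp (ζ (τ p) : Mat n)) = p.2 := by
    have hc : Tendsto (fun p : m × m => ((p.2, ζ (τ p)) : m × lieSub T)) (𝓝 0) (𝓝 0) := by
      have h1 : Tendsto (fun p : m × m => p.2) (𝓝 0) (𝓝 0) := continuous_snd.tendsto 0
      have h2 : Tendsto (fun p : m × m => (τ p : Mat n)) (𝓝 0) (𝓝 1) := by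
        have := (continuous_coe.comp hτ).tendsto (0 : m × m)
        simpa [hτ0, Function.comp_def] using this
      have h3 : Tendsto (fun p : m × m => ζ (τ p)) (𝓝 0) (𝓝 0) := by
        have := hζ.tendsto.comp h2
        rwa [hζ1] at this
      exact h1.prodMk_nhds h3
    filter_upwards [hc.eventually hev] with p hp
    exact hp.1
  obtain ⟨O1, hO1, hO1o, h01⟩ := eventually_nhds_iff.mp (e1.and e2)
  obtain ⟨u, hu, hu2⟩ : ∃ u ∈ 𝓝 (0 : m), ∀ X ∈ u, ∀ X' ∈ u,
      (τ (X, X') ∈ T → τ (X, X') = expGL (ζ (τ (X, X')) : Mat n)) ∧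
        f (NormedSpace.exp (X' : Mat n) * NormedSpace.exp (ζ (τ (X, X')) : Mat n)) = X' := by
    have e34 := e3.and e4
    rw [← Prod.mk_zero_zero, nhds_prod_eq] at e34
    obtain ⟨u, hu, hu2⟩ := mem_prod_self_iff.mp e34
    exact ⟨u, hu, fun X hX X' hX' => hu2 (Set.mk_mem_prod hX hX')⟩
  obtain ⟨O2, hO2u, hO2o, h02⟩ := mem_nhds_iff.mp hu
  refine ⟨⟨N, f, z, O1 ∩ O2, hN, hf, hz, hmul, hO1o.inter hO2o, ⟨h01, h02⟩,
    fun X hX => (hO1 X hX.1).1, fun X hX => (hO1 X hX.1).2, ?_⟩⟩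
  intro X hX X' hX' t ht htX
  obtain ⟨h3, h4⟩ := hu2 X (hO2u hX.2) X' (hO2u hX'.2)
  have hτt : τ (X, X') = t := by
    simp only [τ, htX, expGL_neg, inv_mul_cancel_left]
  have h5 := h3 (by rw [hτt]; exact ht)
  have h6 : NormedSpace.exp (X : Mat n) =
      NormedSpace.exp (X' : Mat n) * NormedSpace.exp (ζ (τ (X, X')) : Mat n) := by
    have h7 : expGL (X : Mat n) = expGL (X' : Mat n) * expGL (ζ (τ (X, X')) : Mat n) := by
      rw [← h5, hτt, htX]
    exact congrArg Units.val h7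
  rw [← (hO1 X hX.1).2, h6]
  exact h4

end ShelstadGeometry

namespace ShelstadGeometry
open Filter

variable {n : ℕ}

/-! ### Closed subgroups -/

theorem IsAlgebraicGroup.isClosed {H : Subgroup (GLn n)} (h : IsAlgebraicGroup H) :
    IsClosed (H : Set (GLn n)) := by
  obtain ⟨S, hS⟩ := h
  have : (H : Set (GLn n)) = ⋂ f ∈ S,
      {g : GLn n | MvPolynomial.eval (fun p => (g : Mat n) p.1 p.2) f = 0} := by
    ext g
    simp [hS g]
  rw [this]
  refine isClosed_biInter fun f _ => isClosed_eq ?_ continuous_const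
  refine (MvPolynomial.continuous_eval f).comp ?_
  exact continuous_pi fun p => continuous_coe.matrix_elem p.1 p.2

theorem isClosed_realPoints {GC : Subgroup (GLn n)} (hGC : IsClosed (GC : Set (GLn n)))
    {σ : GC ≃* GC} (hσ : Continuous σ) : IsClosed (realPoints σ : Set (GLn n)) := by
  have h : (realPoints σ : Set (GLn n)) = Subtype.val '' {g : GC | σ g = g} := by
    ext g
    constructor
    · rintro ⟨h, h'⟩
      exact ⟨⟨g, h⟩, Subtype.ext h', rfl⟩
    · rintro ⟨⟨g', h⟩, h', rfl⟩
      exact ⟨h, congrArg Subtype.val h'⟩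
  rw [h]
  exact hGC.isClosedEmbedding_subtypeVal.isClosedMap _ (isClosed_eq hσ continuous_id)

theorem identityComponent_le (H : Subgroup (GLn n)) : identityComponent H ≤ H := by
  rintro _ ⟨g, -, rfl⟩
  exact g.2

theorem isClosed_identityComponent {H : Subgroup (GLn n)} (hH : IsClosed (H : Set (GLn n))) :
    IsClosed (identityComponent H : Set (GLn n)) := by
  have h : (identityComponent H : Set (GLn n)) = Subtype.val '' connectedComponent (1 : H) := rfl
  rw [h]
  exact hH.isClosedEmbedding_subtypeVal.isClosedMap _ isClosed_connectedComponent

/-- A one-parameter subgroup is connected and contains 1, so it stays in the identity component. -/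
theorem lieAlg_identityComponent {H : Subgroup (GLn n)} (hH : IsClosed (H : Set (GLn n))) :
    lieAlg (identityComponent H) = lieAlg H := by
  refine le_antisymm (lieAlg_mono (identityComponent_le H)) fun X hX => ?_
  rw [mem_lieAlg_iff (isClosed_identityComponent hH)]
  rw [mem_lieAlg_iff hH] at hX
  intro t
  let c : ℝ → H := fun s => ⟨expGL (s • X), hX s⟩
  have hc : Continuous c :=
    (continuous_expGL.comp (continuous_id.smul continuous_const)).subtype_mk _
  have hr : IsPreconnected (Set.range c) := isPreconnected_range hc
  have h0 : (1 : H) ∈ Set.range c := ⟨0, Subtype.ext (by simp [c])⟩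
  exact ⟨c t, hr.subset_connectedComponent h0 ⟨t, rfl⟩, rfl⟩

theorem eq_of_expGL_smul_eq {X Y : Mat n} (h : ∀ t : ℝ, expGL (t • X) = expGL (t • Y)) : X = Y := by
  have h1 := hasDerivAt_coe_expGL_smul X
  simp only [h] at h1
  exact h1.unique (hasDerivAt_coe_expGL_smul Y)

/-! ### Real forms -/

section RealForm
variable {GC : Subgroup (GLn n)} {σ : GC ≃* GC}

/-- The tangent map of `σ` at `1` maps `X` to `Y`. -/
def IsTangent (σ : GC ≃* GC) (X Y : Mat n) : Prop :=
  ∀ t : ℝ, ∃ h : expGL (t • X) ∈ GC, (σ ⟨_, h⟩ : GLn n) = expGL (t • Y)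

theorem IsTangent.smul {X Y : Mat n} (h : IsTangent σ X Y) (c : ℝ) :
    IsTangent σ (c • X) (c • Y) := by
  intro t
  rw [smul_smul, smul_smul]
  exact h _

theorem IsTangent.neg {X Y : Mat n} (h : IsTangent σ X Y) : IsTangent σ (-X) (-Y) := by
  simpa using h.smul (-1)

theorem IsTangent.mem {X Y : Mat n} (h : IsTangent σ X Y) : X ∈ lieAlg GC :=
  LieSubalgebra.subset_lieSpan fun t => (h t).1

theorem IsTangent.unique {X Y Y' : Mat n} (h : IsTangent σ X Y) (h' : IsTangent σ X Y') : Y = Y' :=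
  eq_of_expGL_smul_eq fun t => (h t).2.symm.trans (h' t).2

/-- The automorphism is only assumed continuous; its differential exists because the image of a
one-parameter group is a continuous one-parameter group, hence exponential. -/
theorem exists_isTangent (hGC : IsClosed (GC : Set (GLn n))) (hσ : Continuous σ) {X : Mat n}
    (hX : X ∈ lieAlg GC) : ∃ Y, IsTangent σ X Y := by
  have hX' := (mem_lieAlg_iff hGC).mp hX
  let c : ℝ → GC := fun s => ⟨expGL (s • X), hX' s⟩
  have hc : Continuous c :=
    (continuous_expGL.comp (continuous_id.smul continuous_const)).subtype_mk _
  have hc0 : c 0 = 1 := Subtype.ext (by simp [c])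
  have hca : ∀ s t, c (s + t) = c s * c t := fun s t => Subtype.ext (expGL_add_smul X s t)
  obtain ⟨Y, hY⟩ := exists_expGL_of_continuous_hom (fun s => (σ (c s) : GLn n))
    (continuous_subtype_val.comp (hσ.comp hc)) (by simp [hc0])
    (fun s t => by simp [hca])
  exact ⟨Y, fun t => ⟨hX' t, hY t⟩⟩

/-- Additivity of the tangent map follows by applying σ to the powers of exp(tX/m) exp(tX'/m) and
passing to the limit on both sides. -/
theorem IsTangent.add (hGC : IsClosed (GC : Set (GLn n))) (hσ : Continuous σ) {X Y X' Y' : Mat n}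
    (h : IsTangent σ X Y) (h' : IsTangent σ X' Y') : IsTangent σ (X + X') (Y + Y') := by
  intro t
  have hm : ∀ s : ℝ, expGL (s • X) * expGL (s • X') ∈ GC := fun s =>
    GC.mul_mem (h s).1 (h' s).1
  have hlim := tendsto_pow_curve (by simp) (hasDerivAt_expGL_mul_expGL X X') t
  have hlim' := tendsto_pow_curve (by simp) (hasDerivAt_expGL_mul_expGL Y Y') t
  have hmem : expGL (t • (X + X')) ∈ GC :=
    hGC.mem_of_tendsto hlim (Eventually.of_forall fun m => GC.pow_mem (hm _) m)
  refine ⟨hmem, ?_⟩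
  let a : ℕ → GC := fun m => ⟨_, hm (t / m)⟩ ^ m
  have ha : Tendsto a atTop (𝓝 ⟨_, hmem⟩) := tendsto_subtype_rng.mpr hlim
  have hb := (continuous_subtype_val.comp hσ).continuousAt.tendsto.comp ha
  refine tendsto_nhds_unique hb (hlim'.congr fun m => ?_)
  have h1 : (⟨_, hm (t / m)⟩ : GC) = ⟨_, (h (t / m)).1⟩ * ⟨_, (h' (t / m)).1⟩ := rfl
  simp only [Function.comp, a, map_pow, h1, map_mul, Subgroup.coe_pow, Subgroup.coe_mul,
    (h (t / m)).2, (h' (t / m)).2]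

theorem mem_lieAlg_realPoints_iff (hGC : IsClosed (GC : Set (GLn n))) (hσ : Continuous σ)
    {X : Mat n} : X ∈ lieAlg (realPoints σ) ↔ IsTangent σ X X :=
  mem_lieAlg_iff (isClosed_realPoints hGC hσ)

theorem IsRealForm.symm (hσ : IsRealForm σ) {X Y : Mat n} (h : IsTangent σ X Y) :
    IsTangent σ Y X := by
  intro t
  obtain ⟨h1, h2⟩ := h t
  have h3 : expGL (t • Y) ∈ GC := by
    rw [← h2]
    exact (σ _).2
  refine ⟨h3, ?_⟩
  have h4 : (⟨_, h3⟩ : GC) = σ ⟨_, h1⟩ := Subtype.ext h2.symm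
  rw [h4, hσ.involutive]

theorem IsRealForm.I_smul (hσ : IsRealForm σ) {X Y : Mat n} (h : IsTangent σ X Y) :
    IsTangent σ (Complex.I • X) (-(Complex.I • Y)) := hσ.antiholomorphic X Y h

/-- If the tangent map sends X to Y, then A = (X + Y)/2 and B = i(Y - X)/2 are fixed by it, by
additivity and antilinearity, and A + iB = X. -/
theorem IsRealForm.exists_add_I_smul (hGC : IsClosed (GC : Set (GLn n))) (hσ : IsRealForm σ)
    {X : Mat n} (hX : X ∈ lieAlg GC) : ∃ A ∈ lieAlg (realPoints σ), ∃ B ∈ lieAlg (realPoints σ),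
      X = A + Complex.I • B := by
  obtain ⟨Y, h⟩ := exists_isTangent hGC hσ.continuous hX
  have hA := (h.add hGC hσ.continuous (hσ.symm h)).smul (1 / 2)
  have hB := ((hσ.I_smul h).neg.add hGC hσ.continuous (hσ.I_smul (hσ.symm h))).smul (1 / 2)
  rw [add_comm Y X] at hA
  rw [neg_neg, add_comm (Complex.I • Y)] at hB
  refine ⟨_, (mem_lieAlg_realPoints_iff hGC hσ.continuous).mpr hA, _,
    (mem_lieAlg_realPoints_iff hGC hσ.continuous).mpr hB, ?_⟩
  ext i j
  simp
  linear_combination (1 / 2 * (X i j - Y i j)) * Complex.I_mul_I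

/-- If A is fixed, antilinearity sends iA to -iA; if iA is fixed as well, it vanishes. -/
theorem IsRealForm.eq_zero_of_I_smul_mem (hGC : IsClosed (GC : Set (GLn n))) (hσ : IsRealForm σ)
    {A : Mat n} (hA : A ∈ lieAlg (realPoints σ))
    (hiA : Complex.I • A ∈ lieAlg (realPoints σ)) : A = 0 := by
  rw [mem_lieAlg_realPoints_iff hGC hσ.continuous] at hA hiA
  have h := hiA.unique (hσ.I_smul hA)
  have h2 : (2 : ℂ) • Complex.I • A = 0 := by
    rw [two_smul]
    nth_rewrite 1 [h]
    simp
  simpa using h2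

theorem realPoints_le : realPoints σ ≤ GC := fun _ h => h.1

end RealForm

/-! ### The Lie algebras of the inner form data -/

namespace InnerFormData
variable (D : InnerFormData n)

theorem isClosed_GC : IsClosed (D.GC : Set (GLn n)) := D.algebraic.isClosed

theorem isClosed_G : IsClosed (D.G : Set (GLn n)) :=
  isClosed_identityComponent (isClosed_realPoints D.isClosed_GC D.isRealForm.continuous)

theorem isClosed_Gc : IsClosed (D.Gc : Set (GLn n)) :=
  isClosed_realPoints D.isClosed_GC D.isRealForm_c.continuous

theorem isClosed_T : IsClosed (D.T : Set (GLn n)) := D.maximalTorus.isTorus.isCompact.isClosed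

theorem K_le_G : D.K ≤ D.G := D.maximalCompact.le

theorem K_le_Gc : D.K ≤ D.Gc := D.K_le

theorem T_le_G : D.T ≤ D.G := D.maximalTorus.le.trans D.K_le_G

theorem T_le_Gc : D.T ≤ D.Gc := D.maximalTorus.le.trans D.K_le_Gc

theorem G_le_GC : D.G ≤ D.GC := (identityComponent_le _).trans realPoints_le

theorem Gc_le_GC : D.Gc ≤ D.GC := realPoints_le

theorem lieAlg_G : lieAlg D.G = lieAlg (realPoints D.σ) :=
  lieAlg_identityComponent (isClosed_realPoints D.isClosed_GC D.isRealForm.continuous)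

theorem I_smul_mem_lieAlg_GC {X : Mat n} (hX : X ∈ lieAlg D.GC) :
    Complex.I • X ∈ lieAlg D.GC := by
  obtain ⟨Y, h⟩ := exists_isTangent D.isClosed_GC D.isRealForm.continuous hX
  exact (D.isRealForm.I_smul h).mem

theorem smul_mem_lieAlg_GC (c : ℂ) {X : Mat n} (hX : X ∈ lieAlg D.GC) : c • X ∈ lieAlg D.GC := by
  have h : c • X = c.re • X + c.im • (Complex.I • X) := by
    nth_rewrite 1 [← Complex.re_add_im c]
    rw [add_smul, mul_smul, Complex.coe_smul, Complex.coe_smul]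
  rw [h]
  exact (lieAlg D.GC).add_mem ((lieAlg D.GC).smul_mem _ hX)
    ((lieAlg D.GC).smul_mem _ (D.I_smul_mem_lieAlg_GC hX))

/-- A real form of the complexified Lie algebra, containing the Lie algebra of `T` as its own
centraliser, with an invariant inner product. -/
structure IsRealSubalgebra (L : LieSubalgebra ℝ (Mat n)) : Prop where
  le : ∀ X ∈ L, X ∈ D.gC
  exists_add : ∀ X ∈ D.gC, ∃ A ∈ L, ∃ B ∈ L, X = A + Complex.I • B
  eq_zero : ∀ A ∈ L, Complex.I • A ∈ L → A = 0
  T_le : ∀ X ∈ lieAlg D.T, X ∈ L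

/-- The Lie algebra of `GC` is complex and is the sum of that of `G` and its multiple by i. Since
the same holds for `Gc`, both real forms share one complexification, and one root decomposition
serves both. -/
theorem mem_gC_iff {X : Mat n} : X ∈ D.gC ↔ X ∈ lieAlg D.GC := by
  constructor
  · intro h
    induction h using Submodule.span_induction with
    | mem X hX => exact lieAlg_mono D.G_le_GC hX
    | zero => exact (lieAlg D.GC).zero_mem
    | add X Y _ _ hX hY => exact (lieAlg D.GC).add_mem hX hY
    | smul c X _ hX => exact D.smul_mem_lieAlg_GC c hX
  · intro h
    obtain ⟨A, hA, B, hB, rfl⟩ := D.isRealForm.exists_add_I_smul D.isClosed_GC h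
    rw [← D.lieAlg_G] at hA hB
    exact D.gC.add_mem (Submodule.subset_span hA)
      (D.gC.smul_mem _ (Submodule.subset_span hB))

theorem isRealSubalgebra_G : D.IsRealSubalgebra (lieAlg D.G) where
  le _ hX := Submodule.subset_span hX
  exists_add X hX := by
    rw [D.lieAlg_G]
    exact D.isRealForm.exists_add_I_smul D.isClosed_GC (D.mem_gC_iff.mp hX)
  eq_zero _ := by
    rw [D.lieAlg_G]
    exact D.isRealForm.eq_zero_of_I_smul_mem D.isClosed_GC
  T_le _ hX := lieAlg_mono D.T_le_G hX

theorem isRealSubalgebra_Gc : D.IsRealSubalgebra (lieAlg D.Gc) where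
  le _ hX := D.mem_gC_iff.mpr (lieAlg_mono D.Gc_le_GC hX)
  exists_add _ hX :=
    D.isRealForm_c.exists_add_I_smul D.isClosed_GC (D.mem_gC_iff.mp hX)
  eq_zero _ := D.isRealForm_c.eq_zero_of_I_smul_mem D.isClosed_GC
  T_le _ hX := lieAlg_mono D.T_le_Gc hX

theorem lie_T_eq_zero {X Y : Mat n} (hX : X ∈ lieAlg D.T) (hY : Y ∈ lieAlg D.T) :
    X * Y - Y * X = 0 := by
  have h1 : ∀ s : ℝ, Ad (expGL (s • X)) Y = Y := by
    intro s
    refine eq_of_expGL_smul_eq fun t => ?_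
    rw [← Ad_rsmul, expGL_Ad, mul_inv_eq_iff_eq_mul]
    exact D.maximalTorus.isTorus.comm _ ((mem_lieAlg_iff D.isClosed_T).mp hX s) _
      ((mem_lieAlg_iff D.isClosed_T).mp hY t)
  have h2 := hasDerivAt_Ad X Y
  simp only [h1] at h2
  exact h2.unique (hasDerivAt_const (0 : ℝ) Y)

/-- A Cartan subalgebra is its own normaliser, so it contains its centraliser. -/
theorem mem_T_of_centralizes {X : Mat n} (hX : X ∈ lieAlg D.G)
    (h : ∀ Z ∈ lieAlg D.T, Z * X - X * Z = 0) : X ∈ lieAlg D.T := by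
  have h1 := D.cartan.self_normalizing
  have h2 : (⟨X, hX⟩ : lieAlg D.G) ∈
      ((lieAlg D.T).comap (lieAlg D.G).incl).normalizer := by
    rw [LieSubalgebra.mem_normalizer_iff]
    intro Z hZ
    have h3 : ⁅X, (Z : Mat n)⁆ = 0 := by
      rw [LieRing.of_associative_ring_bracket, ← neg_sub, h (Z : Mat n) hZ, neg_zero]
    change ⁅X, (Z : Mat n)⁆ ∈ lieAlg D.T
    rw [h3]
    exact (lieAlg D.T).zero_mem
  have h3 : (⟨X, hX⟩ : lieAlg D.G) ∈ (lieAlg D.T).comap (lieAlg D.G).incl := h1 ▸ h2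
  exact h3

end InnerFormData

end ShelstadGeometry

namespace ShelstadGeometry
namespace InnerFormData
open Filter

variable {n : ℕ} {D : InnerFormData n}

/-! ### The root space decomposition -/

/-- The bracket with `H`, as a complex linear map. -/
noncomputable def adC (H : Mat n) : Module.End ℂ (Mat n) :=
  LinearMap.mulLeft ℂ H - LinearMap.mulRight ℂ H

theorem adC_apply (H X : Mat n) : adC H X = H * X - X * H := rfl

theorem lie_mem_gC {H X : Mat n} (hH : H ∈ D.gC) (hX : X ∈ D.gC) : H * X - X * H ∈ D.gC := by
  rw [D.mem_gC_iff] at *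
  exact lie_mem_lieAlg hH hX

theorem T_le_gC {H : Mat n} (hH : H ∈ lieAlg D.T) : H ∈ D.gC :=
  D.isRealSubalgebra_G.le _ (D.isRealSubalgebra_G.T_le _ hH)

theorem IsRealSubalgebra.ext {L : LieSubalgebra ℝ (Mat n)} (hL : D.IsRealSubalgebra L)
    {A B A' B' : Mat n} (hA : A ∈ L) (hB : B ∈ L) (hA' : A' ∈ L) (hB' : B' ∈ L)
    (h : A + Complex.I • B = A' + Complex.I • B') : A = A' ∧ B = B' := by
  have h1 : B - B' = 0 := by
    refine hL.eq_zero _ (L.sub_mem hB hB') ?_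
    have : Complex.I • (B - B') = A' - A := by
      rw [smul_sub, sub_eq_sub_iff_add_eq_add, add_comm, h, add_comm]
    rw [this]
    exact L.sub_mem hA' hA
  have h2 := sub_eq_zero.mp h1
  rw [h2] at h
  exact ⟨add_right_cancel h, h2⟩

theorem Ad_mem_of_mem_T {H : Subgroup (GLn n)} (hH : IsClosed (H : Set (GLn n))) (hT : D.T ≤ H)
    {t : GLn n} (ht : t ∈ D.T) {X : Mat n} (hX : X ∈ lieAlg H) : Ad t X ∈ lieAlg H :=
  Ad_mem_lieAlg hH (fun _ hh => H.mul_mem (H.mul_mem (hT ht) hh) (H.inv_mem (hT ht))) hX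

section Skew
variable {H : Subgroup (GLn n)} {B : Mat n →ₗ[ℝ] Mat n →ₗ[ℝ] ℝ}

/-- This is the derivative at s = 0 of the invariance of `B` under Ad(exp(sZ)). -/
theorem skew (hH : IsClosed (H : Set (GLn n))) (hT : D.T ≤ H)
    (hB : IsInvariantInner D.T (lieAlg H) B) {Z X Y : Mat n} (hZ : Z ∈ lieAlg D.T)
    (hX : X ∈ lieAlg H) (hY : Y ∈ lieAlg H) : B (adC Z X) Y = -B X (adC Z Y) := by
  have hZT : ∀ s : ℝ, expGL (s • Z) ∈ D.T := (mem_lieAlg_iff D.isClosed_T).mp hZ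
  have h1 : HasDerivAt (fun s : ℝ => B (Ad (expGL (s • Z)) X) Y) (B (adC Z X) Y) 0 :=
    (LinearMap.toContinuousLinearMap (B.flip Y)).hasFDerivAt.comp_hasDerivAt (0 : ℝ)
      (hasDerivAt_Ad Z X)
  have h2 : HasDerivAt (fun s : ℝ => B X (Ad (expGL (s • -Z)) Y))
      (B X (-Z * Y - Y * -Z)) 0 :=
    (LinearMap.toContinuousLinearMap (B X)).hasFDerivAt.comp_hasDerivAt (0 : ℝ)
      (hasDerivAt_Ad (-Z) Y)
  have h3 : (fun s : ℝ => B (Ad (expGL (s • Z)) X) Y) =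
      fun s : ℝ => B X (Ad (expGL (s • -Z)) Y) := by
    funext s
    have h4 := hB.invariant _ (hZT s) X hX (Ad (expGL (s • -Z)) Y) (by
      refine Ad_mem_of_mem_T hH hT ?_ hY
      rw [smul_neg, ← neg_smul]
      exact hZT _)
    rw [← h4, ← Ad_mul, smul_neg, expGL_neg, mul_inv_cancel, Ad_one]
  rw [h3] at h1
  rw [h1.unique h2, ← map_neg, adC_apply]
  congr 1
  noncomm_ring

theorem skew_self (hH : IsClosed (H : Set (GLn n))) (hT : D.T ≤ H)
    (hB : IsInvariantInner D.T (lieAlg H) B) {Z X : Mat n} (hZ : Z ∈ lieAlg D.T)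
    (hX : X ∈ lieAlg H) : B (adC Z X) X = 0 := by
  have h1 := skew hH hT hB hZ hX hX
  have h2 := hB.symm _ (lie_mem_lieAlg (lieAlg_mono hT hZ) hX) X hX
  rw [← adC_apply] at h2
  linarith

theorem B_nonneg (hB : IsInvariantInner D.T (lieAlg H) B) {X : Mat n} (hX : X ∈ lieAlg H) :
    0 ≤ B X X := by
  rcases eq_or_ne X 0 with rfl | h
  · simp
  · exact (hB.pos X hX h).le

theorem eq_zero_of_B_add (hB : IsInvariantInner D.T (lieAlg H) B) {X Y : Mat n}
    (hX : X ∈ lieAlg H) (hY : Y ∈ lieAlg H) (h : B X X + B Y Y = 0) : X = 0 ∧ Y = 0 := by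
  have h1 := B_nonneg hB hX
  have h2 := B_nonneg hB hY
  constructor
  · by_contra hne
    have := hB.pos X hX hne
    linarith
  · by_contra hne
    have := hB.pos Y hY hne
    linarith

theorem smul_add_I_smul (μ : ℂ) (A B : Mat n) : μ • (A + Complex.I • B) =
    (μ.re • A - μ.im • B) + Complex.I • (μ.im • A + μ.re • B) := by
  ext i j
  simp only [Matrix.smul_apply, Matrix.add_apply, Matrix.sub_apply, smul_eq_mul,
    Complex.real_smul]
  nth_rewrite 1 [← Complex.re_add_im μ]
  linear_combination (μ.im * B i j : ℂ) * Complex.I_mul_I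

/-- Eigenvalues of the bracket with an element of the Lie algebra of `T` are imaginary. -/
theorem re_eq_zero (hH : IsClosed (H : Set (GLn n))) (hT : D.T ≤ H)
    (hL : D.IsRealSubalgebra (lieAlg H)) (hB : IsInvariantInner D.T (lieAlg H) B) {Z W : Mat n}
    (hZ : Z ∈ lieAlg D.T) (hW : W ∈ D.gC) {μ : ℂ} (h : adC Z W = μ • W) (h0 : W ≠ 0) :
    μ.re = 0 := by
  obtain ⟨X, hX, Y, hY, rfl⟩ := hL.exists_add W hW
  have hZ' := lieAlg_mono hT hZ
  rw [map_add, map_smul, smul_add_I_smul] at h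
  obtain ⟨h1, h2⟩ := hL.ext (lie_mem_lieAlg hZ' hX) (lie_mem_lieAlg hZ' hY)
    ((lieAlg H).sub_mem ((lieAlg H).smul_mem _ hX) ((lieAlg H).smul_mem _ hY))
    ((lieAlg H).add_mem ((lieAlg H).smul_mem _ hX) ((lieAlg H).smul_mem _ hY)) h
  -- Skewness gives B([Z,X],X) = B([Z,Y],Y) = 0. In the sum of these the terms with Im μ cancel,
  -- leaving Re μ (B(X,X) + B(Y,Y)) = 0.
  have h3 := skew_self hH hT hB hZ hX
  have h4 := skew_self hH hT hB hZ hY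
  rw [adC_apply, h1] at h3
  rw [adC_apply, h2] at h4
  simp only [map_sub, map_add, map_smul, LinearMap.sub_apply, LinearMap.add_apply,
    LinearMap.smul_apply, smul_eq_mul] at h3 h4
  have h5 := hB.symm X hX Y hY
  by_contra hne
  have h6 : B X X + B Y Y = 0 := by
    have : μ.re * (B X X + B Y Y) = 0 := by rw [h5] at h4; linarith
    exact (mul_eq_zero.mp this).resolve_left hne
  obtain ⟨rfl, rfl⟩ := eq_zero_of_B_add hB hX hY h6
  simp at h0

/-- The bracket with an element of the Lie algebra of `T` is semisimple. -/
theorem eigen_of_generalized (hH : IsClosed (H : Set (GLn n))) (hT : D.T ≤ H)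
    (hL : D.IsRealSubalgebra (lieAlg H)) (hB : IsInvariantInner D.T (lieAlg H) B) {Z V W : Mat n}
    (hZ : Z ∈ lieAlg D.T) (hV : V ∈ D.gC) {μ : ℂ} (hW : adC Z V = μ • V + W)
    (h : adC Z W = μ • W) : W = 0 := by
  by_contra h0
  have hWg : W ∈ D.gC := by
    rw [← sub_eq_iff_eq_add'.mpr hW]
    exact D.gC.sub_mem (lie_mem_gC (T_le_gC hZ) hV) (D.gC.smul_mem _ hV)
  have hre := re_eq_zero hH hT hL hB hZ hWg h h0
  obtain ⟨X, hX, Y, hY, rfl⟩ := hL.exists_add V hV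
  obtain ⟨X', hX', Y', hY', rfl⟩ := hL.exists_add W hWg
  have hZ' := lieAlg_mono hT hZ
  rw [map_add, map_smul, smul_add_I_smul, hre] at h hW
  simp only [zero_smul, zero_sub, add_zero] at h hW
  obtain ⟨h1, h2⟩ := hL.ext (lie_mem_lieAlg hZ' hX') (lie_mem_lieAlg hZ' hY')
    ((lieAlg H).neg_mem ((lieAlg H).smul_mem _ hY')) ((lieAlg H).smul_mem _ hX') h
  have hW' : adC Z X + Complex.I • adC Z Y =
      (-(μ.im • Y) + X') + Complex.I • (μ.im • X + Y') := by
    rw [hW, smul_add]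
    abel
  obtain ⟨h3, h4⟩ := hL.ext (lie_mem_lieAlg hZ' hX) (lie_mem_lieAlg hZ' hY)
    ((lieAlg H).add_mem ((lieAlg H).neg_mem ((lieAlg H).smul_mem _ hY)) hX')
    ((lieAlg H).add_mem ((lieAlg H).smul_mem _ hX) hY') hW'
  -- Pairing [Z,X] with X' and [Z,Y] with Y' and adding, the terms containing Im μ cancel, which
  -- leaves B(X',X') + B(Y',Y') = 0.
  have e1 := skew hH hT hB hZ hX hX'
  have e2 := skew hH hT hB hZ hY hY'
  rw [adC_apply, adC_apply, h3, h1] at e1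
  rw [adC_apply, adC_apply, h4, h2] at e2
  simp only [map_neg, map_add, map_smul, LinearMap.neg_apply, LinearMap.add_apply,
    LinearMap.smul_apply, smul_eq_mul] at e1 e2
  obtain ⟨rfl, rfl⟩ := eq_zero_of_B_add hB hX' hY' (by linarith)
  simp at h0

end Skew

section Decomposition
variable {B : Mat n →ₗ[ℝ] Mat n →ₗ[ℝ] ℝ}

theorem mem_rootSpace_iff {α : Functional D.T} {X : Mat n} :
    X ∈ D.rootSpace α ↔ X ∈ D.gC ∧ ∀ H : lieAlg D.T, adC (H : Mat n) X = α H • X := Iff.rfl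

theorem adC_commute {X Y : Mat n} (h : X * Y - Y * X = 0) : Commute (adC X) (adC Y) := by
  ext1 Z
  simp only [Module.End.mul_apply, adC_apply]
  have h' := sub_eq_zero.mp h
  have : X * (Y * Z - Z * Y) - (Y * Z - Z * Y) * X - (Y * (X * Z - Z * X) - (X * Z - Z * X) * Y) =
    (X * Y - Y * X) * Z - Z * (X * Y - Y * X) := by noncomm_ring
  rw [← sub_eq_zero, this, h]
  simp

/-- Root spaces lie in simultaneous generalised eigenspaces of a commuting family, and those are
independent. -/
theorem iSupIndep_rootSpace : iSupIndep D.rootSpace := by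
  have h := Module.End.independent_iInf_maxGenEigenspace_of_forall_mapsTo
    (fun H : lieAlg D.T => adC (H : Mat n))
    (fun i j φ => Module.End.mapsTo_maxGenEigenspace_of_comm
      (adC_commute (D.lie_T_eq_zero j.2 i.2)) φ)
  have h2 := h.comp (f := fun α : Functional D.T => (α : lieAlg D.T → ℂ))
    DFunLike.coe_injective
  refine h2.mono fun α X hX => ?_
  simp only [Function.comp, Submodule.mem_iInf]
  intro H
  rw [Module.End.mem_maxGenEigenspace]
  refine ⟨1, ?_⟩
  simp [hX.2 H, adC_apply]

/-- A closed subgroup containing `T` whose Lie algebra is a real form of the complexified Lie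
algebra, with an invariant inner product. -/
structure IsFormWithInner (D : InnerFormData n) (H : Subgroup (GLn n))
    (B : Mat n →ₗ[ℝ] Mat n →ₗ[ℝ] ℝ) : Prop where
  isClosed : IsClosed (H : Set (GLn n))
  T_le : D.T ≤ H
  isReal : D.IsRealSubalgebra (lieAlg H)
  inner : IsInvariantInner D.T (lieAlg H) B

theorem isFormWithInner_G (hB : IsInvariantInner D.T (lieAlg D.G) B) : D.IsFormWithInner D.G B :=
  ⟨D.isClosed_G, D.T_le_G, D.isRealSubalgebra_G, hB⟩

theorem isFormWithInner_Gc (hB : IsInvariantInner D.T (lieAlg D.Gc) B) :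
    D.IsFormWithInner D.Gc B :=
  ⟨D.isClosed_Gc, D.T_le_Gc, D.isRealSubalgebra_Gc, hB⟩

/-- Over ℂ the simultaneous generalised eigenspaces of the commuting brackets span. Skewness for the
inner product rules out nilpotent parts, so these are eigenspaces. -/
theorem IsFormWithInner.iSup_rootSpace {H : Subgroup (GLn n)} (hF : D.IsFormWithInner H B) :
    ⨆ α, D.rootSpace α = D.gC := by
  refine le_antisymm (iSup_le fun α X hX => hX.1) ?_
  let f : lieAlg D.T → Module.End ℂ D.gC := fun H =>
    (adC (H : Mat n)).restrict (p := D.gC) (q := D.gC) fun X hX => lie_mem_gC (T_le_gC H.2) hX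
  have hf : ∀ (H : lieAlg D.T) (X : D.gC), (f H X : Mat n) = adC (H : Mat n) X := fun _ _ => rfl
  have htop := Module.End.iSup_iInf_maxGenEigenspace_eq_top_of_iSup_maxGenEigenspace_eq_top_of_commute
    f (fun H H' _ => by
      ext1 X
      exact Subtype.ext (congrArg (fun g : Module.End ℂ (Mat n) => g X)
        (adC_commute (D.lie_T_eq_zero H.2 H'.2)).eq))
    (fun H => Module.End.iSup_maxGenEigenspace_eq_top (f H))
  -- Induction on the exponent: W = (ad H - μ)X is an eigenvector for μ by the induction hypothesis,
  -- hence zero by `eigen_of_generalized`.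
  have hpow : ∀ (H : lieAlg D.T) (μ : ℂ) (k : ℕ) (X : D.gC),
      ((f H - μ • (1 : Module.End ℂ D.gC)) ^ k) X = 0 → adC (H : Mat n) X = μ • (X : Mat n) := by
    intro H μ k
    induction k with
    | zero =>
      intro X hX
      have : X = 0 := by simpa using hX
      simp [this]
    | succ k ih =>
      intro X hX
      rw [pow_succ, Module.End.mul_apply] at hX
      have h1 := ih _ hX
      set W := (f H - μ • (1 : Module.End ℂ D.gC)) X with hW
      have h2 : adC (H : Mat n) X = μ • (X : Mat n) + (W : Mat n) := by
        rw [hW]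
        simp [hf]
      have h3 := eigen_of_generalized hF.isClosed hF.T_le hF.isReal hF.inner H.2 X.2 h2 h1
      rw [h2, h3, add_zero]
  intro X hX
  have hmem : (⟨X, hX⟩ : D.gC) ∈ ⨆ χ : lieAlg D.T → ℂ, ⨅ H, (f H).maxGenEigenspace (χ H) := by
    rw [htop]
    trivial
  suffices h : ∀ V : D.gC, V ∈ ⨆ χ : lieAlg D.T → ℂ, ⨅ H, (f H).maxGenEigenspace (χ H) →
      (V : Mat n) ∈ ⨆ α, D.rootSpace α from h _ hmem
  intro V hV
  refine Submodule.iSup_induction _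
    (motive := fun V : D.gC => (V : Mat n) ∈ ⨆ α, D.rootSpace α) hV ?_
    (Submodule.zero_mem _) (fun x y hx hy => Submodule.add_mem _ hx hy)
  · intro χ V hV
    simp only [Submodule.mem_iInf, Module.End.mem_maxGenEigenspace] at hV
    have hV' : ∀ H : lieAlg D.T, adC (H : Mat n) V = χ H • (V : Mat n) := fun H =>
      let ⟨k, hk⟩ := hV H
      hpow H _ k V hk
    rcases eq_or_ne (V : Mat n) 0 with h0 | h0
    · rw [h0]
      exact Submodule.zero_mem _
    -- A nonzero common eigenvector forces its eigenvalue to be linear in `H`.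
    let α : Functional D.T :=
      { toFun := χ
        map_add' := fun H H' => by
          have h1 := hV' (H + H')
          have h2 : adC ((H + H' : lieAlg D.T) : Mat n) V =
              adC (H : Mat n) V + adC (H' : Mat n) V := by
            change ((H : Mat n) + (H' : Mat n)) * V - V * ((H : Mat n) + (H' : Mat n)) = _
            simp only [adC_apply]
            noncomm_ring
          rw [h2, hV', hV', ← add_smul] at h1
          exact (smul_left_injective ℂ h0 h1).symm
        map_smul' := fun c H => by
          have h1 := hV' (c • H)
          have h2 : adC ((c • H : lieAlg D.T) : Mat n) V = c • adC (H : Mat n) V := by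
            change (c • (H : Mat n)) * V - V * (c • (H : Mat n)) = _
            simp only [adC_apply, smul_sub, smul_mul_assoc, mul_smul_comm]
          rw [h2, hV', ← smul_assoc] at h1
          exact (smul_left_injective ℂ h0 h1).symm }
    exact Submodule.mem_iSup_of_mem α ⟨V.2, hV'⟩

/-- The complexified Lie algebra of `T`. -/
def tC (D : InnerFormData n) : Submodule ℂ (Mat n) :=
  Submodule.span ℂ (lieAlg D.T : Set (Mat n))

theorem mem_tC_iff {X : Mat n} :
    X ∈ D.tC ↔ ∃ A ∈ lieAlg D.T, ∃ C ∈ lieAlg D.T, X = A + Complex.I • C := by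
  constructor
  · intro h
    induction h using Submodule.span_induction with
    | mem X hX => exact ⟨X, hX, 0, (lieAlg D.T).zero_mem, by simp⟩
    | zero => exact ⟨0, (lieAlg D.T).zero_mem, 0, (lieAlg D.T).zero_mem, by simp⟩
    | add X Y _ _ hX hY =>
      obtain ⟨A, hA, C, hC, rfl⟩ := hX
      obtain ⟨A', hA', C', hC', rfl⟩ := hY
      refine ⟨A + A', (lieAlg D.T).add_mem hA hA', C + C', (lieAlg D.T).add_mem hC hC', ?_⟩
      rw [smul_add]
      abel
    | smul c X _ hX =>
      obtain ⟨A, hA, C, hC, rfl⟩ := hX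
      exact ⟨_, (lieAlg D.T).sub_mem ((lieAlg D.T).smul_mem _ hA) ((lieAlg D.T).smul_mem _ hC), _,
        (lieAlg D.T).add_mem ((lieAlg D.T).smul_mem _ hA) ((lieAlg D.T).smul_mem _ hC),
        smul_add_I_smul c A C⟩
  · rintro ⟨A, hA, C, hC, rfl⟩
    exact Submodule.add_mem _ (Submodule.subset_span hA)
      (Submodule.smul_mem _ _ (Submodule.subset_span hC))

theorem mem_tC_of_centralizes {X : Mat n} (hX : X ∈ D.gC)
    (h : ∀ Z ∈ lieAlg D.T, Z * X - X * Z = 0) : X ∈ D.tC := by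
  obtain ⟨A, hA, C, hC, rfl⟩ := D.isRealSubalgebra_G.exists_add X hX
  have h1 : ∀ Z ∈ lieAlg D.T, Z * A - A * Z = 0 ∧ Z * C - C * Z = 0 := by
    intro Z hZ
    have hZ' := D.isRealSubalgebra_G.T_le Z hZ
    refine D.isRealSubalgebra_G.ext (lie_mem_lieAlg hZ' hA) (lie_mem_lieAlg hZ' hC)
      (lieAlg D.G).zero_mem (lieAlg D.G).zero_mem ?_
    rw [smul_zero, add_zero, ← h Z hZ, mul_add, add_mul, mul_smul_comm, smul_mul_assoc, smul_sub]
    abel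
  exact mem_tC_iff.mpr ⟨A, D.mem_T_of_centralizes hA fun Z hZ => (h1 Z hZ).1, C,
    D.mem_T_of_centralizes hC fun Z hZ => (h1 Z hZ).2, rfl⟩

/-- The Cartan hypothesis enters the root decomposition here: without it, the zero weight space
could exceed the complexification of 𝔱. -/
theorem rootSpace_zero : D.rootSpace 0 = D.tC := by
  refine le_antisymm (fun X hX => mem_tC_of_centralizes hX.1 fun Z hZ => ?_) ?_
  · simpa using hX.2 ⟨Z, hZ⟩
  · refine Submodule.span_le.mpr fun Z hZ => ⟨T_le_gC hZ, fun H => ?_⟩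
    simp [D.lie_T_eq_zero H.2 hZ]

/-- A real subalgebra containing the Lie algebra of `T` meets its complexification in it. -/
theorem mem_T_of_mem_tC {L : LieSubalgebra ℝ (Mat n)} (hL : D.IsRealSubalgebra L) {X : Mat n}
    (hX : X ∈ L) (h : X ∈ D.tC) : X ∈ lieAlg D.T := by
  obtain ⟨A, hA, C, hC, rfl⟩ := mem_tC_iff.mp h
  have := (hL.ext (A' := A + Complex.I • C) (B' := 0) (hL.T_le _ hA) (hL.T_le _ hC) hX
    L.zero_mem (by simp)).1
  rwa [← this]

/-- Passing through the common complexification transfers self-centralisation of 𝔱 from the Lie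
algebra of `G` to that of `Gc`. -/
theorem mem_T_of_centralizes' {L : LieSubalgebra ℝ (Mat n)} (hL : D.IsRealSubalgebra L)
    {X : Mat n} (hX : X ∈ L) (h : ∀ Z ∈ lieAlg D.T, Z * X - X * Z = 0) : X ∈ lieAlg D.T :=
  mem_T_of_mem_tC hL hX (mem_tC_of_centralizes (hL.le _ hX) h)

end Decomposition

end InnerFormData
end ShelstadGeometry

namespace ShelstadGeometry
namespace InnerFormData
open Filter

variable {n : ℕ} {D : InnerFormData n}

/-! ### Projections attached to positive systems -/

/-- The part of the definition of a positive system that concerns signs. -/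
def IsPos (D : InnerFormData n) (S : Set (Functional D.T)) : Prop :=
  S ⊆ D.roots ∧ ∀ α ∈ D.roots, Xor (α ∈ S) (-α ∈ S)

theorem IsPositiveSystem.isPos {P : Set (Functional D.T)} (hP : D.IsPositiveSystem P) :
    D.IsPos P := ⟨hP.subset, hP.pos_or_neg⟩

theorem rootSum_induction {S : Set (Functional D.T)} {p : Mat n → Prop} {Z : Mat n}
    (hZ : Z ∈ D.rootSum S) (mem : ∀ α ∈ S, ∀ Z ∈ D.rootSpace α, p Z) (zero : p 0)
    (add : ∀ X Y, p X → p Y → p (X + Y)) : p Z := by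
  refine Submodule.iSup_induction (fun α => ⨆ _ : α ∈ S, D.rootSpace α) (motive := p) hZ ?_ zero add
  intro α X hX
  by_cases hα : α ∈ S
  · rw [iSup_pos hα] at hX
    exact mem α hα X hX
  · rw [iSup_neg hα, Submodule.mem_bot] at hX
    rwa [hX]

theorem rootSpace_le_rootSum {S : Set (Functional D.T)} {α : Functional D.T} (h : α ∈ S) :
    D.rootSpace α ≤ D.rootSum S := le_iSup₂_of_le α h le_rfl

theorem tC_sup_rootSum (S : Set (Functional D.T)) :
    D.tC ⊔ D.rootSum S = D.rootSum ({0} ∪ S) := by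
  unfold rootSum
  rw [iSup_union, iSup_singleton, rootSpace_zero]

section Proj
variable {S : Set (Functional D.T)}

theorem IsPos.disjoint (hS : D.IsPos S) :
    Disjoint (D.rootSum S) (D.tC ⊔ D.rootSum {α | -α ∈ S}) := by
  rw [tC_sup_rootSum]
  refine iSupIndep_rootSpace.disjoint_biSup_biSup ?_
  rw [Set.disjoint_left]
  rintro α hα (h0 | h0)
  · exact (hS.1 hα).1 h0
  · rcases hS.2 α (hS.1 hα) with h | h
    · exact h.2 h0
    · exact h.2 hα

/-- By disjointness the choice made in `proj` is the only possible one; all properties of `proj` are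
derived from this uniqueness. -/
theorem IsPos.proj_eq (hS : D.IsPos S) {X Z : Mat n} (hZ : Z ∈ D.rootSum S)
    (h : X - Z ∈ D.tC ⊔ D.rootSum {α | -α ∈ S}) : D.proj S X = Z := by
  have hex : ∃ Z ∈ D.rootSum S, X - Z ∈
      Submodule.span ℂ (lieAlg D.T : Set (Mat n)) ⊔ D.rootSum {α | -α ∈ S} := ⟨Z, hZ, h⟩
  have h1 := hex.choose_spec
  unfold proj
  rw [dif_pos hex, ← sub_eq_zero]
  refine Submodule.disjoint_def.mp hS.disjoint _ (Submodule.sub_mem _ h1.1 hZ) ?_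
  have h2 := Submodule.sub_mem _ h h1.2
  rwa [sub_sub_sub_cancel_left] at h2

variable {H : Subgroup (GLn n)} {B : Mat n →ₗ[ℝ] Mat n →ₗ[ℝ] ℝ}

theorem IsPos.exists_proj (hS : D.IsPos S) (hF : D.IsFormWithInner H B) {X : Mat n}
    (hX : X ∈ D.gC) :
    ∃ Z ∈ D.rootSum S, X - Z ∈ D.tC ⊔ D.rootSum {α | -α ∈ S} := by
  rw [← hF.iSup_rootSpace] at hX
  refine Submodule.iSup_induction D.rootSpace (motive := fun X =>
    ∃ Z ∈ D.rootSum S, X - Z ∈ D.tC ⊔ D.rootSum {α | -α ∈ S}) hX ?_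
    ⟨0, Submodule.zero_mem _, by simp⟩ ?_
  · intro α X hX
    by_cases hα : α ∈ D.roots
    · rcases hS.2 α hα with h | h
      · exact ⟨X, rootSpace_le_rootSum h.1 hX, by simp⟩
      · refine ⟨0, Submodule.zero_mem _, ?_⟩
        rw [sub_zero]
        exact Submodule.mem_sup_right (rootSpace_le_rootSum (S := {α | -α ∈ S}) h.1 hX)
    · refine ⟨0, Submodule.zero_mem _, ?_⟩
      rw [sub_zero]
      rcases eq_or_ne α 0 with rfl | h0
      · rw [rootSpace_zero] at hX
        exact Submodule.mem_sup_left hX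
      · have : D.rootSpace α = ⊥ := by
          by_contra h
          exact hα ⟨h0, h⟩
        rw [this, Submodule.mem_bot] at hX
        rw [hX]
        exact Submodule.zero_mem _
  · rintro X Y ⟨Z, hZ, h⟩ ⟨Z', hZ', h'⟩
    refine ⟨Z + Z', Submodule.add_mem _ hZ hZ', ?_⟩
    rw [add_sub_add_comm]
    exact Submodule.add_mem _ h h'

theorem IsPos.proj_mem (hS : D.IsPos S) (hF : D.IsFormWithInner H B) {X : Mat n}
    (hX : X ∈ D.gC) : D.proj S X ∈ D.rootSum S := by
  obtain ⟨Z, hZ, h⟩ := hS.exists_proj hF hX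
  rwa [hS.proj_eq hZ h]

theorem IsPos.sub_proj_mem (hS : D.IsPos S) (hF : D.IsFormWithInner H B) {X : Mat n}
    (hX : X ∈ D.gC) : X - D.proj S X ∈ D.tC ⊔ D.rootSum {α | -α ∈ S} := by
  obtain ⟨Z, hZ, h⟩ := hS.exists_proj hF hX
  rwa [hS.proj_eq hZ h]

theorem IsPos.proj_add (hS : D.IsPos S) (hF : D.IsFormWithInner H B) {X Y : Mat n}
    (hX : X ∈ D.gC) (hY : Y ∈ D.gC) : D.proj S (X + Y) = D.proj S X + D.proj S Y := by
  refine hS.proj_eq (Submodule.add_mem _ (hS.proj_mem hF hX) (hS.proj_mem hF hY)) ?_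
  rw [add_sub_add_comm]
  exact Submodule.add_mem _ (hS.sub_proj_mem hF hX) (hS.sub_proj_mem hF hY)

theorem IsPos.proj_smul (hS : D.IsPos S) (hF : D.IsFormWithInner H B) (c : ℂ) {X : Mat n}
    (hX : X ∈ D.gC) : D.proj S (c • X) = c • D.proj S X := by
  refine hS.proj_eq (Submodule.smul_mem _ _ (hS.proj_mem hF hX)) ?_
  rw [← smul_sub]
  exact Submodule.smul_mem _ _ (hS.sub_proj_mem hF hX)

theorem IsPos.proj_rsmul (hS : D.IsPos S) (hF : D.IsFormWithInner H B) (c : ℝ) {X : Mat n}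
    (hX : X ∈ D.gC) : D.proj S (c • X) = c • D.proj S X := by
  rw [← Complex.coe_smul, hS.proj_smul hF _ hX, Complex.coe_smul]

theorem IsPos.proj_sub (hS : D.IsPos S) (hF : D.IsFormWithInner H B) {X Y : Mat n}
    (hX : X ∈ D.gC) (hY : Y ∈ D.gC) : D.proj S (X - Y) = D.proj S X - D.proj S Y := by
  have h : X - Y = X + (-1 : ℂ) • Y := by simp [sub_eq_add_neg]
  rw [h, hS.proj_add hF hX (D.gC.smul_mem _ hY), hS.proj_smul hF _ hY]
  simp [sub_eq_add_neg]

end Proj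

/-! ### Conjugation -/

/-- `Z'` is conjugate to `Z` with respect to `L`. -/
def IsConj (L : LieSubalgebra ℝ (Mat n)) (Z Z' : Mat n) : Prop :=
  ∃ A ∈ L, ∃ C ∈ L, Z = A + Complex.I • C ∧ Z' = A - Complex.I • C

section Conj
variable {S : Set (Functional D.T)} {H : Subgroup (GLn n)} {B : Mat n →ₗ[ℝ] Mat n →ₗ[ℝ] ℝ}

theorem IsConj.add {L : LieSubalgebra ℝ (Mat n)} {X Y X' Y' : Mat n} (h : IsConj L X X')
    (h' : IsConj L Y Y') : IsConj L (X + Y) (X' + Y') := by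
  obtain ⟨A, hA, C, hC, rfl, rfl⟩ := h
  obtain ⟨A', hA', C', hC', rfl, rfl⟩ := h'
  refine ⟨A + A', L.add_mem hA hA', C + C', L.add_mem hC hC', ?_, ?_⟩ <;> rw [smul_add] <;> abel

theorem isConj_zero (L : LieSubalgebra ℝ (Mat n)) : IsConj L 0 0 :=
  ⟨0, L.zero_mem, 0, L.zero_mem, by simp, by simp⟩

theorem IsConj.unique {L : LieSubalgebra ℝ (Mat n)} (hL : D.IsRealSubalgebra L) {Z Z' Z'' : Mat n}
    (h : IsConj L Z Z') (h' : IsConj L Z Z'') : Z' = Z'' := by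
  obtain ⟨A, hA, C, hC, rfl, rfl⟩ := h
  obtain ⟨A', hA', C', hC', h1, rfl⟩ := h'
  obtain ⟨rfl, rfl⟩ := hL.ext hA hC hA' hC' h1
  rfl

theorem isConj_self {L : LieSubalgebra ℝ (Mat n)} {X : Mat n} (hX : X ∈ L) : IsConj L X X :=
  ⟨X, hX, 0, L.zero_mem, by simp, by simp⟩

/-- The action of the Lie algebra of `T` on the real and imaginary parts of root vectors. -/
theorem IsFormWithInner.adC_parts (hF : D.IsFormWithInner H B) {α : Functional D.T} {A C : Mat n}
    (hA : A ∈ lieAlg H) (hC : C ∈ lieAlg H) (h : A + Complex.I • C ∈ D.rootSpace α)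
    (Z : lieAlg D.T) :
    adC (Z : Mat n) A = -((α Z).im • C) ∧ adC (Z : Mat n) C = (α Z).im • A := by
  have hZ := lieAlg_mono hF.T_le Z.2
  rcases eq_or_ne (A + Complex.I • C) 0 with h0 | h0
  · obtain ⟨rfl, rfl⟩ := hF.isReal.ext hA hC (lieAlg H).zero_mem (lieAlg H).zero_mem
      (by rw [h0]; simp)
    simp
  have h1 := (mem_rootSpace_iff.mp h).2 Z
  have hre := re_eq_zero hF.isClosed hF.T_le hF.isReal hF.inner Z.2 h.1 h1 h0
  rw [map_add, map_smul, smul_add_I_smul, hre] at h1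
  simp only [zero_smul, zero_sub, add_zero] at h1
  exact hF.isReal.ext (lie_mem_lieAlg hZ hA) (lie_mem_lieAlg hZ hC)
    ((lieAlg H).neg_mem ((lieAlg H).smul_mem _ hC)) ((lieAlg H).smul_mem _ hA) h1

/-- Roots take imaginary values on 𝔱, so conjugation with respect to the real form turns α into -α.
-/
theorem IsFormWithInner.exists_conj_rootSpace (hF : D.IsFormWithInner H B) {α : Functional D.T}
    {Z : Mat n} (hZ : Z ∈ D.rootSpace α) : ∃ Z' ∈ D.rootSpace (-α), IsConj (lieAlg H) Z Z' := by
  obtain ⟨A, hA, C, hC, rfl⟩ := hF.isReal.exists_add Z hZ.1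
  refine ⟨A - Complex.I • C, mem_rootSpace_iff.mpr ⟨?_, fun W => ?_⟩, A, hA, C, hC, rfl, rfl⟩
  · exact D.gC.sub_mem (hF.isReal.le _ hA) (D.gC.smul_mem _ (hF.isReal.le _ hC))
  · obtain ⟨h1, h2⟩ := hF.adC_parts hA hC hZ W
    rcases eq_or_ne (A + Complex.I • C) 0 with h0 | h0
    · obtain ⟨rfl, rfl⟩ := hF.isReal.ext hA hC (lieAlg H).zero_mem (lieAlg H).zero_mem
        (by rw [h0]; simp)
      simp
    have hre := re_eq_zero hF.isClosed hF.T_le hF.isReal hF.inner W.2 hZ.1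
      ((mem_rootSpace_iff.mp hZ).2 W) h0
    rw [map_sub, map_smul, h1, h2]
    have h3 : A - Complex.I • C = A + Complex.I • (-C) := by simp [sub_eq_add_neg]
    rw [h3, smul_add_I_smul]
    simp [hre, sub_eq_add_neg]

theorem IsFormWithInner.exists_conj (hF : D.IsFormWithInner H B) {S' : Set (Functional D.T)}
    (hSS' : ∀ α ∈ S, -α ∈ S') {Z : Mat n} (hZ : Z ∈ D.rootSum S) :
    ∃ Z' ∈ D.rootSum S', IsConj (lieAlg H) Z Z' := by
  refine rootSum_induction (p := fun Z => ∃ Z' ∈ D.rootSum S', IsConj (lieAlg H) Z Z') hZ ?_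
    ⟨0, Submodule.zero_mem _, isConj_zero _⟩ ?_
  · intro α hα X hX
    obtain ⟨X', hX', h⟩ := hF.exists_conj_rootSpace hX
    exact ⟨X', rootSpace_le_rootSum (hSS' α hα) hX', h⟩
  · rintro X Y ⟨X', hX', h⟩ ⟨Y', hY', h'⟩
    exact ⟨X' + Y', Submodule.add_mem _ hX' hY', h.add h'⟩

/-- The span of the brackets with elements of the Lie algebra of `T`. -/
noncomputable def brackets (D : InnerFormData n) (H : Subgroup (GLn n)) : Submodule ℝ (Mat n) :=
  Submodule.span ℝ {Y | ∃ Z ∈ lieAlg D.T, ∃ W ∈ lieAlg H, Y = adC Z W}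

theorem IsFormWithInner.brackets_le (hF : D.IsFormWithInner H B) :
    D.brackets H ≤ perp H D.T B := by
  refine Submodule.span_le.mpr ?_
  rintro _ ⟨Z, hZ, W, hW, rfl⟩
  have hZ' := lieAlg_mono hF.T_le hZ
  refine ⟨lie_mem_lieAlg hZ' hW, fun Z' hZ1 => ?_⟩
  rw [skew hF.isClosed hF.T_le hF.inner hZ hW (lieAlg_mono hF.T_le hZ1), adC_apply,
    D.lie_T_eq_zero hZ hZ1]
  simp

/-- For a root vector A + iC, the sum with its conjugate is 2A, and A is a real multiple of [W, C]
for any W in 𝔱 with α(W) ≠ 0. So real vectors with prescribed component in S can be found among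
brackets. -/
theorem IsFormWithInner.exists_brackets (hF : D.IsFormWithInner H B) (hS : S ⊆ D.roots)
    {Z : Mat n} (hZ : Z ∈ D.rootSum S) :
    ∃ Z' ∈ D.rootSum {α | -α ∈ S}, Z + Z' ∈ D.brackets H := by
  refine rootSum_induction
    (p := fun Z => ∃ Z' ∈ D.rootSum {α | -α ∈ S}, Z + Z' ∈ D.brackets H) hZ ?_
    ⟨0, Submodule.zero_mem _, by simp⟩ ?_
  · intro α hα X hX
    obtain ⟨X', hX', A, hA, C, hC, rfl, rfl⟩ := hF.exists_conj_rootSpace hX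
    refine ⟨_, rootSpace_le_rootSum (S := {α | -α ∈ S}) (α := -α) (by simpa using hα) hX', ?_⟩
    rcases eq_or_ne (A + Complex.I • C) 0 with h0 | h0
    · obtain ⟨rfl, rfl⟩ := hF.isReal.ext hA hC (lieAlg H).zero_mem (lieAlg H).zero_mem
        (by rw [h0]; simp)
      simp
    obtain ⟨W, hW⟩ : ∃ W, α W ≠ 0 := by
      by_contra hcon
      push Not at hcon
      exact (hS hα).1 (LinearMap.ext hcon)
    have hre := re_eq_zero hF.isClosed hF.T_le hF.isReal hF.inner W.2 hX.1
      ((mem_rootSpace_iff.mp hX).2 W) h0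
    have him : (α W).im ≠ 0 := fun h => hW (Complex.ext hre h)
    have h2 := (hF.adC_parts hA hC hX W).2
    have h3 : A + Complex.I • C + (A - Complex.I • C) = (2 * (α W).im⁻¹) • adC (W : Mat n) C := by
      rw [h2, smul_smul, mul_assoc, inv_mul_cancel₀ him, mul_one, two_smul]
      abel
    rw [h3]
    exact Submodule.smul_mem _ _ (Submodule.subset_span ⟨W, W.2, C, hC, rfl⟩)
  · rintro X Y ⟨X', hX', h⟩ ⟨Y', hY', h'⟩
    refine ⟨X' + Y', Submodule.add_mem _ hX' hY', ?_⟩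
    rw [add_add_add_comm]
    exact Submodule.add_mem _ h h'

/-- A real X without component in S equals its conjugate. Conjugation carries the component in -S to
S, so that component vanishes too and only the part in the complexification of 𝔱 remains. -/
theorem IsFormWithInner.mem_T_of_proj_eq_zero (hF : D.IsFormWithInner H B) (hS : D.IsPos S)
    {X : Mat n} (hX : X ∈ lieAlg H) (h : D.proj S X = 0) : X ∈ lieAlg D.T := by
  have h1 := hS.sub_proj_mem hF (hF.isReal.le _ hX)
  rw [h, sub_zero] at h1
  obtain ⟨A, hA, Z, hZ, rfl⟩ := Submodule.mem_sup.mp h1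
  obtain ⟨Z', hZ', hc⟩ := hF.exists_conj (S' := S) (fun α hα => hα) hZ
  obtain ⟨A1, hA1, A2, hA2, rfl⟩ := mem_tC_iff.mp hA
  have hcA : IsConj (lieAlg H) (A1 + Complex.I • A2) (A1 - Complex.I • A2) :=
    ⟨A1, hF.isReal.T_le _ hA1, A2, hF.isReal.T_le _ hA2, rfl, rfl⟩
  have h2 := (hcA.add hc).unique hF.isReal (isConj_self hX)
  have h3 : Z' = 0 := by
    refine Submodule.disjoint_def.mp hS.disjoint _ hZ' ?_
    rw [← sub_eq_iff_eq_add'.mpr h2.symm]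
    refine Submodule.sub_mem _ (Submodule.add_mem _ (Submodule.mem_sup_left hA)
      (Submodule.mem_sup_right hZ)) (Submodule.mem_sup_left ?_)
    refine Submodule.sub_mem _ (Submodule.subset_span hA1)
      (Submodule.smul_mem _ _ (Submodule.subset_span hA2))
  rw [h3, add_zero] at h2
  refine mem_T_of_mem_tC hF.isReal hX ?_
  rw [← h2]
  exact Submodule.sub_mem _ (Submodule.subset_span hA1)
      (Submodule.smul_mem _ _ (Submodule.subset_span hA2))

theorem IsFormWithInner.eq_zero_of_mem_perp (hF : D.IsFormWithInner H B) {X : Mat n}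
    (hX : X ∈ perp H D.T B) (h : X ∈ lieAlg D.T) : X = 0 := by
  by_contra h0
  have h1 := hF.inner.pos X hX.1 h0
  rw [hX.2 X h] at h1
  exact lt_irrefl _ h1

theorem IsFormWithInner.perp_injective (hF : D.IsFormWithInner H B) (hS : D.IsPos S) {X Y : Mat n}
    (hX : X ∈ perp H D.T B) (hY : Y ∈ perp H D.T B) (h : D.proj S X = D.proj S Y) : X = Y := by
  have hXY := (perp H D.T B).sub_mem hX hY
  have h1 : D.proj S (X - Y) = 0 := by
    rw [hS.proj_sub hF (hF.isReal.le _ hX.1) (hF.isReal.le _ hY.1), h, sub_self]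
  exact sub_eq_zero.mp (hF.eq_zero_of_mem_perp hXY (hF.mem_T_of_proj_eq_zero hS hXY.1 h1))

theorem IsFormWithInner.exists_mem_brackets (hF : D.IsFormWithInner H B) (hS : D.IsPos S)
    {Z : Mat n} (hZ : Z ∈ D.rootSum S) : ∃ X ∈ D.brackets H, D.proj S X = Z := by
  obtain ⟨Z', hZ', h⟩ := hF.exists_brackets hS.1 hZ
  refine ⟨Z + Z', h, hS.proj_eq hZ ?_⟩
  rw [add_sub_cancel_left]
  exact Submodule.mem_sup_right hZ'

/-- Both spaces project onto the same sum of root spaces, and p_S is injective on the larger one.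
The description by brackets does not involve the inner product; so the complement is stable under
the whole normaliser of `T` in `H`, although `B` is invariant only under `T`. -/
theorem IsFormWithInner.perp_eq_brackets (hF : D.IsFormWithInner H B) (hS : D.IsPos S) :
    perp H D.T B = D.brackets H := by
  refine le_antisymm (fun X hX => ?_) hF.brackets_le
  obtain ⟨Y, hY, h⟩ := hF.exists_mem_brackets hS (hS.proj_mem hF (hF.isReal.le _ hX.1))
  rwa [← hF.perp_injective hS (hF.brackets_le hY) hX h]

theorem IsFormWithInner.exists_perp (hF : D.IsFormWithInner H B) (hS : D.IsPos S)
    {X : Mat n} (hX : X ∈ lieAlg H) : ∃ Y ∈ perp H D.T B, X - Y ∈ lieAlg D.T := by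
  obtain ⟨Y, hY, h⟩ := hF.exists_mem_brackets hS (hS.proj_mem hF (hF.isReal.le _ hX))
  have hY' := hF.brackets_le hY
  refine ⟨Y, hY', hF.mem_T_of_proj_eq_zero hS ((lieAlg H).sub_mem hX hY'.1) ?_⟩
  rw [hS.proj_sub hF (hF.isReal.le _ hX) (hF.isReal.le _ hY'.1), h, sub_self]

theorem IsFormWithInner.Ad_mem_perp (hF : D.IsFormWithInner H B) (hS : D.IsPos S) {g : GLn n}
    (hg : g ∈ H) (hgT : g ∈ Subgroup.normalizer (D.T : Set (GLn n))) {X : Mat n}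
    (hX : X ∈ perp H D.T B) : Ad g X ∈ perp H D.T B := by
  rw [hF.perp_eq_brackets hS] at hX ⊢
  have h : D.brackets H ≤ (D.brackets H).comap ((adEquiv g).toLinearMap.restrictScalars ℝ) := by
    refine Submodule.span_le.mpr ?_
    rintro _ ⟨Z, hZ, W, hW, rfl⟩
    refine Submodule.subset_span ⟨Ad g Z, ?_, Ad g W, ?_, Ad_lie g Z W⟩
    · exact Ad_mem_lieAlg D.isClosed_T
        (fun t ht => (Subgroup.mem_normalizer_iff.mp hgT t).mp ht) hZ
    · exact Ad_mem_lieAlg hF.isClosed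
        (fun t ht => H.mul_mem (H.mul_mem hg ht) (H.inv_mem hg)) hW
  exact h hX

end Conj

end InnerFormData
end ShelstadGeometry

namespace ShelstadGeometry
namespace InnerFormData
open Filter
variable {n : ℕ} {D : InnerFormData n}

/-! ### The action of the normaliser of `T` on roots -/

theorem Ad_mem_T {w : GLn n} (hw : w ∈ Subgroup.normalizer (D.T : Set (GLn n))) {X : Mat n}
    (hX : X ∈ lieAlg D.T) : Ad w X ∈ lieAlg D.T :=
  Ad_mem_lieAlg D.isClosed_T (fun t ht => (Subgroup.mem_normalizer_iff.mp hw t).mp ht) hX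

theorem Ad_mem_gC {w : GLn n} (hw : w ∈ D.GC) {X : Mat n} (hX : X ∈ D.gC) : Ad w X ∈ D.gC := by
  rw [D.mem_gC_iff] at hX ⊢
  exact Ad_mem_lieAlg D.isClosed_GC (fun t ht => D.GC.mul_mem (D.GC.mul_mem hw ht)
    (D.GC.inv_mem hw)) hX

/-- The functional `β ∘ Ad(w)`. -/
noncomputable def pull {w : GLn n} (hw : w ∈ Subgroup.normalizer (D.T : Set (GLn n)))
    (β : Functional D.T) : Functional D.T :=
  β ∘ₗ (((adEquiv w).toLinearMap.restrictScalars ℝ).restrict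
    (p := (lieAlg D.T).toSubmodule) (q := (lieAlg D.T).toSubmodule) (fun _ hX => Ad_mem_T hw hX))

theorem pull_apply {w : GLn n} (hw : w ∈ Subgroup.normalizer (D.T : Set (GLn n)))
    (β : Functional D.T) (H : lieAlg D.T) : pull hw β H = β ⟨Ad w H, Ad_mem_T hw H.2⟩ := rfl

theorem pull_neg {w : GLn n} (hw : w ∈ Subgroup.normalizer (D.T : Set (GLn n)))
    (β : Functional D.T) : pull hw (-β) = -pull hw β := rfl

theorem pull_inv_pull {w : GLn n} (hw : w ∈ Subgroup.normalizer (D.T : Set (GLn n)))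
    (β : Functional D.T) : pull (inv_mem hw) (pull hw β) = β := by
  ext H
  simp only [pull_apply, Ad_Ad_inv]

theorem mem_twistRoots {w : GLn n} (hw : w ∈ Subgroup.normalizer (D.T : Set (GLn n)))
    {P : Set (Functional D.T)} {β : Functional D.T} :
    β ∈ D.twistRoots w P ↔ pull hw β ∈ P := by
  constructor
  · rintro ⟨α, hα, h⟩
    have : pull hw β = α := by
      ext H
      rw [pull_apply]
      exact h _ H (by rw [Ad_inv_Ad])
    rwa [this]
  · intro h
    refine ⟨_, h, fun H H' hH => ?_⟩
    rw [pull_apply]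
    congr 1
    ext1
    change (H : Mat n) = Ad w (H' : Mat n)
    rw [hH, Ad_Ad_inv]

theorem Ad_inv_mem_rootSpace {w : GLn n} (hwC : w ∈ D.GC)
    (hw : w ∈ Subgroup.normalizer (D.T : Set (GLn n))) {β : Functional D.T} {X : Mat n}
    (hX : X ∈ D.rootSpace β) : Ad w⁻¹ X ∈ D.rootSpace (pull hw β) := by
  refine ⟨Ad_mem_gC (inv_mem hwC) hX.1, fun H => ?_⟩
  have h := hX.2 ⟨Ad w H, Ad_mem_T hw H.2⟩
  rw [pull_apply, ← Ad_smul, ← h, Ad_lie, Ad_inv_Ad]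

theorem pull_mem_roots {w : GLn n} (hwC : w ∈ D.GC)
    (hw : w ∈ Subgroup.normalizer (D.T : Set (GLn n))) {β : Functional D.T}
    (hβ : β ∈ D.roots) : pull hw β ∈ D.roots := by
  refine ⟨fun h => hβ.1 ?_, ?_⟩
  · rw [← pull_inv_pull hw β, h]
    rfl
  · obtain ⟨X, hX, h0⟩ := Submodule.exists_mem_ne_zero_of_ne_bot hβ.2
    refine (Submodule.ne_bot_iff _).mpr ⟨_, Ad_inv_mem_rootSpace hwC hw hX, fun h => h0 ?_⟩
    rw [← Ad_Ad_inv w X, h, Ad_zero]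

/-- The projections need only a choice of one root from each pair ±α; Ad(w) permutes the roots and
respects negation, so it transports such a choice. -/
theorem IsPos.twistRoots {w : GLn n} (hwC : w ∈ D.GC)
    (hw : w ∈ Subgroup.normalizer (D.T : Set (GLn n))) {P : Set (Functional D.T)}
    (hP : D.IsPos P) : D.IsPos (D.twistRoots w P) := by
  refine ⟨fun β hβ => ?_, fun β hβ => ?_⟩
  · rw [mem_twistRoots hw] at hβ
    have h := pull_mem_roots (inv_mem hwC) (inv_mem hw) (hP.1 hβ)
    rwa [pull_inv_pull] at h
  · rw [mem_twistRoots hw, mem_twistRoots hw, pull_neg]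
    exact hP.2 _ (pull_mem_roots hwC hw hβ)

theorem Ad_inv_mem_rootSum {w : GLn n} (hwC : w ∈ D.GC)
    (hw : w ∈ Subgroup.normalizer (D.T : Set (GLn n))) {S S' : Set (Functional D.T)}
    (h : ∀ β ∈ S, pull hw β ∈ S') {X : Mat n} (hX : X ∈ D.rootSum S) :
    Ad w⁻¹ X ∈ D.rootSum S' := by
  refine rootSum_induction (p := fun X => Ad w⁻¹ X ∈ D.rootSum S') hX ?_ ?_ ?_
  · exact fun β hβ X hX => rootSpace_le_rootSum (h β hβ) (Ad_inv_mem_rootSpace hwC hw hX)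
  · rw [Ad_zero]
    exact Submodule.zero_mem _
  · intro X Y hX hY
    rw [Ad_add]
    exact Submodule.add_mem _ hX hY

theorem Ad_mem_rootSum {w : GLn n} (hwC : w ∈ D.GC)
    (hw : w ∈ Subgroup.normalizer (D.T : Set (GLn n))) {P : Set (Functional D.T)}
    {X : Mat n} (hX : X ∈ D.rootSum P) : Ad w X ∈ D.rootSum (D.twistRoots w P) := by
  have h := Ad_inv_mem_rootSum (S' := D.twistRoots w P) (inv_mem hwC) (inv_mem hw)
    (fun β hβ => ?_) hX
  · rwa [inv_inv] at h
  · rw [mem_twistRoots hw]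
    have h1 := pull_inv_pull (inv_mem hw) β
    simp only [inv_inv] at h1
    rwa [h1]

theorem Ad_mem_tC {w : GLn n} (hw : w ∈ Subgroup.normalizer (D.T : Set (GLn n))) {X : Mat n}
    (hX : X ∈ D.tC) : Ad w X ∈ D.tC := by
  obtain ⟨A, hA, C, hC, rfl⟩ := mem_tC_iff.mp hX
  exact mem_tC_iff.mpr ⟨_, Ad_mem_T hw hA, _, Ad_mem_T hw hC, by rw [Ad_add, Ad_smul]⟩

section
variable {H : Subgroup (GLn n)} {B : Mat n →ₗ[ℝ] Mat n →ₗ[ℝ] ℝ}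

/-- Ad(w⁻¹) carries the decomposition defined by the twisted system to the one defined by `P`. With
this, the defining equation of ψ_w reads p_P(ψ_w X) = p_P(Ad(w⁻¹)X), with a single projection. -/
theorem IsPos.proj_Ad_inv {w : GLn n} (hwC : w ∈ D.GC)
    (hw : w ∈ Subgroup.normalizer (D.T : Set (GLn n))) {P : Set (Functional D.T)}
    (hP : D.IsPos P) (hF : D.IsFormWithInner H B) {X : Mat n} (hX : X ∈ D.gC) :
    D.proj P (Ad w⁻¹ X) = Ad w⁻¹ (D.proj (D.twistRoots w P) X) := by
  have hS := hP.twistRoots hwC hw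
  refine hP.proj_eq (Ad_inv_mem_rootSum hwC hw (fun β hβ => (mem_twistRoots hw).mp hβ)
    (hS.proj_mem hF hX)) ?_
  rw [← Ad_sub]
  obtain ⟨A, hA, Z, hZ, h⟩ := Submodule.mem_sup.mp (hS.sub_proj_mem hF hX)
  rw [← h, Ad_add]
  refine Submodule.add_mem_sup (Ad_mem_tC (inv_mem hw) hA) (Ad_inv_mem_rootSum hwC hw ?_ hZ)
  intro β hβ
  have h1 := (mem_twistRoots hw).mp hβ
  rwa [pull_neg] at h1

theorem Ad_eq_self_of_mem_T {t : GLn n} (ht : t ∈ D.T) {X : Mat n} (hX : X ∈ lieAlg D.T) :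
    Ad t X = X := by
  have h : ∀ s : ℝ, expGL (s • Ad t X) = expGL (s • X) := fun s => by
    rw [← Ad_rsmul, expGL_Ad, D.maximalTorus.isTorus.comm t ht _
      ((mem_lieAlg_iff D.isClosed_T).mp hX s), mul_inv_cancel_right]
  exact eq_of_expGL_smul_eq h

theorem mem_normalizer_of_mem_T {t : GLn n} (ht : t ∈ D.T) :
    t ∈ Subgroup.normalizer (D.T : Set (GLn n)) := Subgroup.le_normalizer ht

theorem twistRoots_of_mem_T {t : GLn n} (ht : t ∈ D.T) (P : Set (Functional D.T)) :
    D.twistRoots t P = P := by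
  ext β
  rw [mem_twistRoots (mem_normalizer_of_mem_T ht)]
  have : pull (mem_normalizer_of_mem_T ht) β = β := by
    ext H
    rw [pull_apply]
    congr 1
    ext1
    exact Ad_eq_self_of_mem_T ht H.2
  rw [this]

theorem T_le_GC : D.T ≤ D.GC := D.T_le_G.trans D.G_le_GC

theorem IsPos.proj_Ad_of_mem_T {t : GLn n} (ht : t ∈ D.T) {P : Set (Functional D.T)}
    (hP : D.IsPos P) (hF : D.IsFormWithInner H B) {X : Mat n} (hX : X ∈ D.gC) :
    D.proj P (Ad t X) = Ad t (D.proj P X) := by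
  have h := hP.proj_Ad_inv (T_le_GC (inv_mem ht)) (mem_normalizer_of_mem_T (inv_mem ht)) hF hX
  rwa [twistRoots_of_mem_T (inv_mem ht), inv_inv] at h

/-- The projection `p_S` on the complement of the Lie algebra of `T`. -/
noncomputable def projMap {S : Set (Functional D.T)} (hS : D.IsPos S)
    (hF : D.IsFormWithInner H B) : perp H D.T B →ₗ[ℝ] D.rootSum S where
  toFun X := ⟨D.proj S X, hS.proj_mem hF (hF.isReal.le _ X.2.1)⟩
  map_add' X Y := Subtype.ext
    (hS.proj_add hF (hF.isReal.le _ X.2.1) (hF.isReal.le _ Y.2.1))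
  map_smul' c X := Subtype.ext (hS.proj_rsmul hF c (hF.isReal.le _ X.2.1))

/-- The projection `p_S`, as an isomorphism from the complement of the Lie algebra of `T` onto the
sum of the root spaces for the roots in `S`. -/
noncomputable def projEquiv {S : Set (Functional D.T)} (hS : D.IsPos S)
    (hF : D.IsFormWithInner H B) : perp H D.T B ≃ₗ[ℝ] D.rootSum S :=
  LinearEquiv.ofBijective (projMap hS hF)
    ⟨fun X Y h => Subtype.ext (hF.perp_injective hS X.2 Y.2 (congrArg Subtype.val h)), by
      rintro ⟨Z, hZ⟩
      obtain ⟨X, hX, h⟩ := hF.exists_mem_brackets hS hZ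
      exact ⟨⟨X, hF.brackets_le hX⟩, Subtype.ext h⟩⟩

/-- The complex structure on the complement of the Lie algebra of `T` for which `p_S` is complex
linear. -/
noncomputable def cpxStr {S : Set (Functional D.T)} (hS : D.IsPos S)
    (hF : D.IsFormWithInner H B) : Module.End ℝ (perp H D.T B) :=
  (projEquiv hS hF).symm.toLinearMap ∘ₗ
    ((Complex.I • (LinearMap.id : D.rootSum S →ₗ[ℂ] D.rootSum S)).restrictScalars ℝ) ∘ₗ
    (projEquiv hS hF).toLinearMap

theorem projEquiv_cpxStr {S : Set (Functional D.T)} (hS : D.IsPos S)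
    (hF : D.IsFormWithInner H B) (X : perp H D.T B) :
    projEquiv hS hF (cpxStr hS hF X) = Complex.I • projEquiv hS hF X :=
  (projEquiv hS hF).apply_symm_apply _

theorem proj_cpxStr {S : Set (Functional D.T)} (hS : D.IsPos S)
    (hF : D.IsFormWithInner H B) (X : perp H D.T B) :
    D.proj S (cpxStr hS hF X : Mat n) = Complex.I • D.proj S (X : Mat n) :=
  congrArg Subtype.val (projEquiv_cpxStr hS hF X)

theorem cpxStr_cpxStr {S : Set (Functional D.T)} (hS : D.IsPos S)
    (hF : D.IsFormWithInner H B) (X : perp H D.T B) :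
    cpxStr hS hF (cpxStr hS hF X) = -X := by
  apply (projEquiv hS hF).injective
  rw [projEquiv_cpxStr, projEquiv_cpxStr, smul_smul, Complex.I_mul_I, map_neg, neg_one_smul]

/-- The adjoint action of an element of the normaliser of `T` on the complement. -/
noncomputable def AdPerp {S : Set (Functional D.T)} (hS : D.IsPos S) (hF : D.IsFormWithInner H B)
    {g : GLn n} (hg : g ∈ H) (hgT : g ∈ Subgroup.normalizer (D.T : Set (GLn n))) :
    Module.End ℝ (perp H D.T B) :=
  ((adEquiv g).toLinearMap.restrictScalars ℝ).restrict (fun _ hX => hF.Ad_mem_perp hS hg hgT hX)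

theorem coe_AdPerp {S : Set (Functional D.T)} (hS : D.IsPos S) (hF : D.IsFormWithInner H B)
    {g : GLn n} (hg : g ∈ H) (hgT : g ∈ Subgroup.normalizer (D.T : Set (GLn n)))
    (X : perp H D.T B) : (AdPerp hS hF hg hgT X : Mat n) = Ad g (X : Mat n) := rfl

theorem coe_cpxStr_Ad {S : Set (Functional D.T)} (hS : D.IsPos S) (hF : D.IsFormWithInner H B)
    {t : GLn n} (ht : t ∈ D.T) {X X' : perp H D.T B} (h : (X' : Mat n) = Ad t (X : Mat n)) :
    (cpxStr hS hF X' : Mat n) = Ad t (cpxStr hS hF X : Mat n) := by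
  refine hF.perp_injective hS (cpxStr hS hF X').2 (hF.Ad_mem_perp hS (hF.T_le ht)
    (mem_normalizer_of_mem_T ht) (cpxStr hS hF X).2) ?_
  rw [proj_cpxStr, h, hS.proj_Ad_of_mem_T ht hF (hF.isReal.le _ X.2.1),
    hS.proj_Ad_of_mem_T ht hF (hF.isReal.le _ (cpxStr hS hF X).2.1), proj_cpxStr, Ad_smul]

end

/-! ### The maps `ψ_w` -/

section psi
variable {P : Set (Functional D.T)} {B Bc : Mat n →ₗ[ℝ] Mat n →ₗ[ℝ] ℝ}

theorem mem_gC_of_tPerp (X : D.tPerp B) : (X : Mat n) ∈ D.gC := D.isRealSubalgebra_G.le _ X.2.1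

theorem mem_gC_of_tPerpC (X : D.tPerpC Bc) : (X : Mat n) ∈ D.gC :=
  D.isRealSubalgebra_Gc.le _ X.2.1

theorem mem_GC_of_mem_NGc {w : GLn n} (hw : w ∈ D.NGc) : w ∈ D.GC := D.Gc_le_GC hw.1

theorem NK_le_NGc : D.NK ≤ D.NGc := inf_le_inf_right _ D.K_le_Gc

theorem T_le_NGc : D.T ≤ D.NGc := le_inf D.T_le_Gc Subgroup.le_normalizer

theorem T_le_NK : D.T ≤ D.NK := le_inf D.maximalTorus.le Subgroup.le_normalizer

theorem NK_le_G : D.NK ≤ D.G := inf_le_left.trans D.K_le_G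

theorem NGc_le_Gc : D.NGc ≤ D.Gc := inf_le_left

variable (hP : D.IsPos P) (hF : D.IsFormWithInner D.G B) (hFc : D.IsFormWithInner D.Gc Bc)
include hP hF hFc

/-- The right-hand side is attained by p_P on the complement in the Lie algebra of `Gc`, so
`Function.invFun` returns a genuine preimage. -/
theorem proj_psi {w : GLn n} (hw : w ∈ D.NGc) (X : D.tPerp B) :
    D.proj P (D.psi B Bc P w X : Mat n) = D.proj P (Ad w⁻¹ (X : Mat n)) := by
  have hwC := mem_GC_of_mem_NGc hw
  rw [hP.proj_Ad_inv hwC hw.2 hF (mem_gC_of_tPerp X)]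
  refine Function.invFun_eq (f := fun Y : D.tPerpC Bc => D.proj P (Y : Mat n)) ?_
  rw [← hP.proj_Ad_inv hwC hw.2 hF (mem_gC_of_tPerp X)]
  obtain ⟨Y, hY, h⟩ := hFc.exists_mem_brackets hP
    (hP.proj_mem hF (Ad_mem_gC (inv_mem hwC) (mem_gC_of_tPerp X)))
  exact ⟨⟨Y, hFc.brackets_le hY⟩, h⟩

theorem psi_eq_iff {w : GLn n} (hw : w ∈ D.NGc) {X : D.tPerp B} {Y : D.tPerpC Bc} :
    D.psi B Bc P w X = Y ↔ D.proj P (Y : Mat n) = D.proj P (Ad w⁻¹ (X : Mat n)) := by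
  constructor
  · rintro rfl
    exact proj_psi hP hF hFc hw X
  · intro h
    refine Subtype.ext (hFc.perp_injective hP (D.psi B Bc P w X).2 Y.2 ?_)
    rw [h, proj_psi hP hF hFc hw X]

theorem psi_add {w : GLn n} (hw : w ∈ D.NGc) (X X' : D.tPerp B) :
    D.psi B Bc P w (X + X') = D.psi B Bc P w X + D.psi B Bc P w X' := by
  have hwC := inv_mem (mem_GC_of_mem_NGc hw)
  rw [psi_eq_iff hP hF hFc hw, Submodule.coe_add, Submodule.coe_add, Ad_add,
    hP.proj_add hF (mem_gC_of_tPerpC _) (mem_gC_of_tPerpC _),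
    hP.proj_add hF (Ad_mem_gC hwC (mem_gC_of_tPerp X)) (Ad_mem_gC hwC (mem_gC_of_tPerp X')),
    proj_psi hP hF hFc hw, proj_psi hP hF hFc hw]

theorem psi_smul {w : GLn n} (hw : w ∈ D.NGc) (c : ℝ) (X : D.tPerp B) :
    D.psi B Bc P w (c • X) = c • D.psi B Bc P w X := by
  have hwC := inv_mem (mem_GC_of_mem_NGc hw)
  rw [psi_eq_iff hP hF hFc hw, Submodule.coe_smul, Submodule.coe_smul, Ad_rsmul,
    hP.proj_rsmul hF c (mem_gC_of_tPerpC _),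
    hP.proj_rsmul hF c (Ad_mem_gC hwC (mem_gC_of_tPerp X)), proj_psi hP hF hFc hw]

theorem psi_bijective {w : GLn n} (hw : w ∈ D.NGc) : Function.Bijective (D.psi B Bc P w) := by
  have hwC := mem_GC_of_mem_NGc hw
  have hS := hP.twistRoots hwC hw.2
  constructor
  · intro X X' h
    have h1 := (psi_eq_iff hP hF hFc hw).mp h
    rw [proj_psi hP hF hFc hw, hP.proj_Ad_inv hwC hw.2 hF (mem_gC_of_tPerp X),
      hP.proj_Ad_inv hwC hw.2 hF (mem_gC_of_tPerp X')] at h1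
    have h2 := congrArg (Ad w) h1
    rw [Ad_Ad_inv, Ad_Ad_inv] at h2
    exact Subtype.ext (hF.perp_injective hS X.2 X'.2 h2.symm)
  · intro Y
    obtain ⟨X, hX, h⟩ := hF.exists_mem_brackets hS
      (Ad_mem_rootSum hwC hw.2 (hP.proj_mem hFc (mem_gC_of_tPerpC Y)))
    refine ⟨⟨X, hF.brackets_le hX⟩, (psi_eq_iff hP hF hFc hw).mpr ?_⟩
    rw [hP.proj_Ad_inv hwC hw.2 hF (mem_gC_of_tPerp _), h, Ad_inv_Ad]

/-- `ψ_w` as a linear isomorphism. -/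
noncomputable def psiEquiv {w : GLn n} (hw : w ∈ D.NGc) : D.tPerp B ≃ₗ[ℝ] D.tPerpC Bc :=
  LinearEquiv.ofBijective
    { toFun := D.psi B Bc P w
      map_add' := psi_add hP hF hFc hw
      map_smul' := psi_smul hP hF hFc hw } (psi_bijective hP hF hFc hw)

/-- Equivariance of ψ_w holds up to conjugation by w: Ad(w⁻¹)Ad(t) = Ad(w⁻¹tw)Ad(w⁻¹), and p_P
commutes with Ad(T). -/
theorem psi_Ad {w : GLn n} (hw : w ∈ D.NGc) {t : GLn n} (ht : t ∈ D.T) {X X' : D.tPerp B}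
    (h : (X' : Mat n) = Ad t (X : Mat n)) :
    (D.psi B Bc P w X' : Mat n) = Ad (w⁻¹ * t * w) (D.psi B Bc P w X : Mat n) := by
  have hwC := inv_mem (mem_GC_of_mem_NGc hw)
  have ht' : w⁻¹ * t * w ∈ D.T := (Subgroup.mem_normalizer_iff''.mp hw.2 t).mp ht
  have hmem := hFc.Ad_mem_perp hP (D.T_le_Gc ht') (mem_normalizer_of_mem_T ht')
    (D.psi B Bc P w X).2
  have h1 : D.psi B Bc P w X' = ⟨_, hmem⟩ := by
    rw [psi_eq_iff hP hF hFc hw, h]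
    change D.proj P (Ad (w⁻¹ * t * w) (D.psi B Bc P w X : Mat n)) = _
    rw [hP.proj_Ad_of_mem_T ht' hFc (mem_gC_of_tPerpC _), proj_psi hP hF hFc hw,
      ← hP.proj_Ad_of_mem_T ht' hF (Ad_mem_gC hwC (mem_gC_of_tPerp X)), ← Ad_mul, ← Ad_mul]
    simp [mul_assoc]
  rw [h1]

/-- Replacing w by k w is compensated by Ad(k) on the source; this compares ψ for different
representatives of one class in W_K\W_G. -/
theorem psi_mul_NK {w : GLn n} (hw : w ∈ D.NGc) {k : GLn n} (hk : k ∈ D.NK) {X X' : D.tPerp B}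
    (h : (X : Mat n) = Ad k (X' : Mat n)) :
    D.psi B Bc P (k * w) X = D.psi B Bc P w X' := by
  rw [psi_eq_iff hP hF hFc (mul_mem (NK_le_NGc hk) hw), proj_psi hP hF hFc hw, h, mul_inv_rev,
    Ad_mul, Ad_inv_Ad]

theorem psi_mul_T {w : GLn n} (hw : w ∈ D.NGc) {t : GLn n} (ht : t ∈ D.T) (X : D.tPerp B) :
    (D.psi B Bc P (w * t) X : Mat n) = Ad t⁻¹ (D.psi B Bc P w X : Mat n) := by
  have hwC := inv_mem (mem_GC_of_mem_NGc hw)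
  have hmem := hFc.Ad_mem_perp hP (D.T_le_Gc (inv_mem ht)) (mem_normalizer_of_mem_T (inv_mem ht))
    (D.psi B Bc P w X).2
  have h1 : D.psi B Bc P (w * t) X = ⟨_, hmem⟩ := by
    rw [psi_eq_iff hP hF hFc (mul_mem hw (T_le_NGc ht))]
    change D.proj P (Ad t⁻¹ (D.psi B Bc P w X : Mat n)) = _
    rw [hP.proj_Ad_of_mem_T (inv_mem ht) hFc (mem_gC_of_tPerpC _), proj_psi hP hF hFc hw,
      ← hP.proj_Ad_of_mem_T (inv_mem ht) hF (Ad_mem_gC hwC (mem_gC_of_tPerp X)), ← Ad_mul,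
      mul_inv_rev]
  rw [h1]

/-- This is the reason for putting the structure of the twisted system on the component of w: ψ_w
becomes complex linear. -/
theorem psi_cpxStr {w : GLn n} (hw : w ∈ D.NGc) (hS : D.IsPos (D.twistRoots w P))
    (X : D.tPerp B) :
    D.psi B Bc P w (cpxStr hS hF X) = cpxStr hP hFc (D.psi B Bc P w X) := by
  have hwC := mem_GC_of_mem_NGc hw
  rw [psi_eq_iff hP hF hFc hw, proj_cpxStr, proj_psi hP hF hFc hw,
    hP.proj_Ad_inv hwC hw.2 hF (mem_gC_of_tPerp _), hP.proj_Ad_inv hwC hw.2 hF (mem_gC_of_tPerp _),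
    proj_cpxStr, Ad_smul]

end psi

end InnerFormData
end ShelstadGeometry

namespace ShelstadGeometry
open Filter MeasureTheory
variable {n : ℕ}

/-! ### Unitarization of compact groups -/

-- Averaging over Haar measure gives an invariant Hermitian form. It is positive definite since the
-- integrand at a nonzero vector is continuous, nonnegative and positive at 1.
open scoped ComplexOrder in
theorem exists_invariant_posDef {C : Type*} [Group C] [TopologicalSpace C] [IsTopologicalGroup C]
    [CompactSpace C] (ρ : C →* GLn n) (hρ : Continuous ρ) :
    ∃ S : Mat n, S.PosDef ∧ ∀ g, (ρ g : Mat n).conjTranspose * S * (ρ g : Mat n) = S := by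
  let _ : MeasurableSpace C := borel C
  have : BorelSpace C := ⟨rfl⟩
  let μ : Measure C := Measure.haar
  have hc : Continuous fun g => (ρ g⁻¹ : Mat n) := continuous_coe.comp (hρ.comp continuous_inv)
  -- With the inverse, ρ(h)* f(hg) ρ(h) = f(g), so left invariance of the measure is what is needed.
  let f : C → Mat n := fun g => (ρ g⁻¹ : Mat n).conjTranspose * (ρ g⁻¹ : Mat n)
  have hf : Continuous f := (hc.matrix_conjTranspose).matrix_mul hc
  let f' : C → Fin n → Fin n → ℂ := f
  have hfi : Integrable f' μ :=
    Continuous.integrable_of_hasCompactSupport hf (HasCompactSupport.of_compactSpace f')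
  have hherm : ∀ g, (f g).conjTranspose = f g := fun g =>
    Matrix.isHermitian_conjTranspose_mul_self _
  let entry : Fin n → Fin n → Mat n →ₗ[ℝ] ℂ := fun i j =>
    { toFun := fun M => M i j
      map_add' := fun M N => rfl
      map_smul' := fun c M => rfl }
  let S : Mat n := ∫ g, f' g ∂μ
  have hL : ∀ L : Mat n →ₗ[ℝ] ℂ, L S = ∫ g, L (f g) ∂μ := fun L => by
    let L' : (Fin n → Fin n → ℂ) →ₗ[ℝ] ℂ := L
    exact ((⟨L', LinearMap.continuous_of_finiteDimensional L'⟩ :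
      (Fin n → Fin n → ℂ) →L[ℝ] ℂ).integral_comp_comm hfi).symm
  refine ⟨S, Matrix.PosDef.of_dotProduct_mulVec_pos ?_ fun x hx => ?_, fun h => ?_⟩
  · change S.conjTranspose = S
    ext i j
    let L : Mat n →ₗ[ℝ] ℂ :=
      { toFun := fun M => M.conjTranspose i j
        map_add' := fun M N => by simp
        map_smul' := fun c M => by simp }
    refine (hL L).trans (Eq.trans ?_ (hL (entry i j)).symm)
    exact integral_congr_ae (Eventually.of_forall fun g => congrFun (congrFun (hherm g) i) j)
  · let L : Mat n →ₗ[ℝ] ℂ :=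
      { toFun := fun M => star x ⬝ᵥ M.mulVec x
        map_add' := fun M N => by simp [Matrix.add_mulVec]
        map_smul' := fun c M => by simp [Matrix.smul_mulVec] }
    have h2 : ∀ g, L (f g) = ((∑ i, ‖(ρ g⁻¹ : Mat n).mulVec x i‖ ^ 2 : ℝ) : ℂ) := fun g => by
      simp only [f, L, LinearMap.coe_mk, AddHom.coe_mk]
      rw [← Matrix.mulVec_mulVec, Matrix.dotProduct_mulVec, ← Matrix.star_mulVec]
      simp [dotProduct, Complex.conj_mul']
    change 0 < L S
    rw [hL L]
    simp_rw [h2]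
    rw [integral_complex_ofReal, Complex.zero_lt_real]
    have hc2 : Continuous fun g => ∑ i, ‖(ρ g⁻¹ : Mat n).mulVec x i‖ ^ 2 := by
      refine continuous_finsetSum _ fun i _ => ?_
      exact ((continuous_apply i).comp (hc.matrix_mulVec continuous_const)).norm.pow 2
    have hne : ∑ i, ‖(ρ (1 : C)⁻¹ : Mat n).mulVec x i‖ ^ 2 ≠ 0 := by
      intro h0
      apply hx
      ext i
      have h3 := (Finset.sum_eq_zero_iff_of_nonneg fun i _ => sq_nonneg _).mp h0 i (Finset.mem_univ i)
      simpa using h3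
    exact hc2.integral_pos_of_hasCompactSupport_nonneg_nonzero
      (HasCompactSupport.of_compactSpace _)
      (fun g => Finset.sum_nonneg fun i _ => sq_nonneg _) hne
  · ext i j
    let L : Mat n →ₗ[ℝ] ℂ :=
      { toFun := fun M => ((ρ h : Mat n).conjTranspose * M * (ρ h : Mat n)) i j
        map_add' := fun M N => by simp [mul_add, add_mul]
        map_smul' := fun c M => by simp }
    refine (hL L).trans (Eq.trans ?_ (hL (entry i j)).symm)
    rw [← integral_mul_left_eq_self (fun g => L (f g)) h]
    refine integral_congr_ae (Eventually.of_forall fun g => ?_)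
    change ((ρ h : Mat n).conjTranspose * f (h * g) * (ρ h : Mat n)) i j = f g i j
    have h1 : (ρ (h * g)⁻¹ : Mat n) * (ρ h : Mat n) = (ρ g⁻¹ : Mat n) := by
      rw [← Units.val_mul, ← map_mul]
      simp
    simp only [f]
    rw [← mul_assoc, ← Matrix.conjTranspose_mul, mul_assoc, h1]

-- Writing the invariant form as S = R*R, invariance under g says that R g R⁻¹ is unitary.
open scoped ComplexOrder MatrixOrder in
theorem exists_unitarization {C : Subgroup (GLn n)} (hC : IsCompact (C : Set (GLn n))) :
    ∃ R : GLn n, ∀ g ∈ C, star (R * g * R⁻¹) * (R * g * R⁻¹) = 1 := by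
  have : CompactSpace C := isCompact_iff_compactSpace.mp hC
  obtain ⟨S, hS, h⟩ := exists_invariant_posDef C.subtype continuous_subtype_val
  obtain ⟨R, hRS⟩ := CStarAlgebra.nonneg_iff_eq_star_mul_self.mp hS.posSemidef.nonneg
  have hR : IsUnit R := by
    have h1 := hS.isUnit
    rw [hRS] at h1
    rw [Matrix.isUnit_iff_isUnit_det] at h1 ⊢
    rw [Matrix.det_mul] at h1
    exact isUnit_of_mul_isUnit_right h1
  have hSR : ((star hR.unit * hR.unit : GLn n) : Mat n) = S := hRS.symm
  refine ⟨hR.unit, fun g hg => ?_⟩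
  have h1 : (star g : GLn n) * (star hR.unit * hR.unit) * g = star hR.unit * hR.unit := by
    ext1
    rw [Units.val_mul, Units.val_mul, hSR]
    exact h ⟨g, hg⟩
  generalize hR.unit = R at h1
  rw [star_mul, star_mul, ← mul_one (star R⁻¹ * (star g * star R) * (R * g * R⁻¹))]
  have h2 : star R⁻¹ * (star g * star R) * (R * g * R⁻¹) =
      star R⁻¹ * (star g * (star R * R) * g) * R⁻¹ := by simp only [mul_assoc]
  rw [h2, h1, mul_one, mul_assoc, mul_assoc, mul_inv_cancel, mul_one, ← star_mul, mul_inv_cancel,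
    star_one]

/-! ### Hermitian matrices and the exponential -/

theorem isSelfAdjoint_toOp {X : Mat n} (h : X.IsHermitian) : IsSelfAdjoint (toOp n X) := by
  unfold toOp
  change star (Matrix.toEuclideanCLM (𝕜 := ℂ) X) = Matrix.toEuclideanCLM (𝕜 := ℂ) X
  rw [← map_star]
  exact congrArg _ h

/-- On self-adjoint operators the exponential is inverted by the logarithm of the continuous
functional calculus. -/
theorem eq_of_exp_eq {X Y : Mat n} (hX : X.IsHermitian) (hY : Y.IsHermitian)
    (h : expGL X = expGL Y) : X = Y := by
  have h1 : NormedSpace.exp X = NormedSpace.exp Y := by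
    rw [← coe_expGL, h, coe_expGL]
  have h2 := congrArg (fun Z => CFC.log (toOpL n Z)) h1
  simp only [toOpL_exp] at h2
  simp only [toOpL_apply] at h2
  rw [CFC.log_exp _ (isSelfAdjoint_toOp hX), CFC.log_exp _ (isSelfAdjoint_toOp hY)] at h2
  exact (toOp n).injective h2

theorem coe_expGL_Ad_diagonal (Q : GLn n) (d : Fin n → ℂ) :
    (expGL (Ad Q (Matrix.diagonal d)) : Mat n) =
      Q * Matrix.diagonal (fun i => Complex.exp (d i)) * ((Q⁻¹ : GLn n) : Mat n) := by
  rw [expGL_Ad, Units.val_mul, Units.val_mul, coe_expGL, Matrix.exp_diagonal]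
  congr 3
  ext i
  rw [Pi.coe_exp, Complex.exp_eq_exp_ℂ]

/-- The real powers of a positive diagonalizable element of an algebraic group lie in it. -/
theorem IsAlgebraicGroup.expGL_smul_mem {H : Subgroup (GLn n)} (hH : IsAlgebraicGroup H)
    (Q : GLn n) (μ : Fin n → ℝ)
    (h : expGL (Ad Q (Matrix.diagonal fun i => (μ i : ℂ))) ∈ H) (s : ℝ) :
    expGL (s • Ad Q (Matrix.diagonal fun i => (μ i : ℂ))) ∈ H := by
  obtain ⟨S, hS⟩ := hH
  have hsm : ∀ s : ℝ, s • Ad Q (Matrix.diagonal fun i => (μ i : ℂ)) =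
      Ad Q (Matrix.diagonal fun i => ((s * μ i : ℝ) : ℂ)) := fun s => by
    rw [← Ad_rsmul]
    congr 1
    ext i j
    by_cases hij : i = j <;> simp [hij, Matrix.diagonal]
  rw [hS]
  intro f hf
  let g : MvPolynomial (Fin n) ℂ := MvPolynomial.bind₁ (fun p : Fin n × Fin n =>
    ∑ k, MvPolynomial.C ((Q : Mat n) p.1 k) * MvPolynomial.X k *
      MvPolynomial.C (((Q⁻¹ : GLn n) : Mat n) k p.2)) f
  have hg : ∀ d : Fin n → ℂ, MvPolynomial.eval (fun p : Fin n × Fin n =>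
      ((Q : Mat n) * Matrix.diagonal d * ((Q⁻¹ : GLn n) : Mat n)) p.1 p.2) f =
      MvPolynomial.eval d g := fun d => by
    simp only [g]
    rw [← MvPolynomial.coe_aeval_eq_eval, ← MvPolynomial.coe_aeval_eq_eval]
    simp only [RingHom.coe_coe, MvPolynomial.aeval_bind₁]
    congr 2
    ext p
    rw [Matrix.mul_apply]
    simp only [Matrix.mul_diagonal]
    simp
  let ν : (Fin n →₀ ℕ) → ℝ := fun m => ∑ i, m i * μ i
  -- Along the one-parameter group an equation of `H` becomes an exponential sum Σ c_m e^{sν(m)}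
  -- with real exponents, known to vanish at natural s.
  have hν : ∀ s : ℝ, MvPolynomial.eval (fun p : Fin n × Fin n =>
      (expGL (s • Ad Q (Matrix.diagonal fun i => (μ i : ℂ))) : Mat n) p.1 p.2) f =
      ∑ m ∈ g.support, g.coeff m * Complex.exp ((s * ν m : ℝ) : ℂ) := fun s => by
    rw [hsm, coe_expGL_Ad_diagonal, hg, MvPolynomial.eval_eq']
    refine Finset.sum_congr rfl fun m _ => ?_
    congr 1
    simp only [ν, Finset.mul_sum, Complex.ofReal_sum, Complex.exp_sum]
    refine Finset.prod_congr rfl fun i _ => ?_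
    rw [← Complex.exp_nat_mul]
    congr 1
    push_cast
    ring
  have hk : ∀ k : ℕ, ∑ m ∈ g.support, g.coeff m * (Complex.exp ((ν m : ℝ) : ℂ)) ^ k = 0 :=
    fun k => by
      have h1 : expGL ((k : ℝ) • Ad Q (Matrix.diagonal fun i => (μ i : ℂ))) ∈ H := by
        rw [Nat.cast_smul_eq_nsmul, expGL_nsmul]
        exact H.pow_mem h k
      rw [← (hS _).mp h1 f hf, hν]
      refine Finset.sum_congr rfl fun m _ => ?_
      rw [← Complex.exp_nat_mul]
      push_cast
      rfl
  classical
  -- The numbers e^{ν(m)} determine the exponents, so some polynomial sends each e^{ν(m)} to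
  -- e^{sν(m)}. This makes the sum at real s a linear combination of the vanishing sums at natural
  -- numbers.
  let p : Polynomial ℂ := Lagrange.interpolate (g.support.image ν)
    (fun x : ℝ => Complex.exp (x : ℂ)) (fun x : ℝ => Complex.exp ((s * x : ℝ) : ℂ))
  have hinj : Set.InjOn (fun x : ℝ => Complex.exp (x : ℂ)) (g.support.image ν : Finset ℝ) := by
    intro x _ y _ hxy
    simp only [← Complex.ofReal_exp, Complex.ofReal_inj] at hxy
    exact Real.exp_injective hxy
  have hp : ∀ m ∈ g.support, p.eval (Complex.exp ((ν m : ℝ) : ℂ)) =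
      Complex.exp ((s * ν m : ℝ) : ℂ) := fun m hm =>
    Lagrange.eval_interpolate_at_node (v := fun x : ℝ => Complex.exp (x : ℂ))
      (fun x : ℝ => Complex.exp ((s * x : ℝ) : ℂ)) hinj (Finset.mem_image_of_mem ν hm)
  rw [hν, ← Finset.sum_congr rfl fun m hm => congrArg (g.coeff m * ·) (hp m hm)]
  simp only [Polynomial.eval_eq_sum_range, Finset.mul_sum]
  rw [Finset.sum_comm]
  refine Finset.sum_eq_zero fun k _ => ?_
  have h2 : ∀ m, g.coeff m * (p.coeff k * Complex.exp ((ν m : ℝ) : ℂ) ^ k) =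
      p.coeff k * (g.coeff m * Complex.exp ((ν m : ℝ) : ℂ) ^ k) := fun m => by ring
  simp only [h2, ← Finset.mul_sum, hk, mul_zero]

open scoped ComplexOrder in
/-- Logarithms of positive definite matrices. -/
theorem exists_log_of_posDef {A : Mat n} (hA : A.PosDef) :
    ∃ (U : GLn n) (μ : Fin n → ℝ),
      (expGL (Ad U (Matrix.diagonal fun i => (μ i : ℂ))) : Mat n) = A ∧
      (Ad U (Matrix.diagonal fun i => (μ i : ℂ))).IsHermitian := by
  let U := hA.1.eigenvectorUnitary
  have hstar : (((Unitary.toUnits U)⁻¹ : GLn n) : Mat n) = star (U : Mat n) := rfl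
  refine ⟨Unitary.toUnits U, fun i => Real.log (hA.1.eigenvalues i), ?_, ?_⟩
  · rw [coe_expGL_Ad_diagonal, hstar]
    conv_rhs => rw [hA.1.spectral_theorem, Unitary.conjStarAlgAut_apply]
    congr 3
    ext i
    rw [← Complex.ofReal_exp, Real.exp_log (hA.eigenvalues_pos i)]
    rfl
  · unfold Ad
    rw [hstar]
    change (_ * _ * star (U : Mat n)).conjTranspose = _
    rw [Matrix.star_eq_conjTranspose, Matrix.conjTranspose_mul, Matrix.conjTranspose_mul,
      Matrix.conjTranspose_conjTranspose, Matrix.diagonal_conjTranspose, mul_assoc]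
    congr 3
    ext i
    simp

end ShelstadGeometry

namespace ShelstadGeometry
namespace InnerFormData
open Filter
variable {n : ℕ} {D : InnerFormData n}

/-! ### The polar decomposition -/

section polar
variable {R : GLn n}

theorem star_expGL (X : Mat n) : star (expGL X) = expGL X.conjTranspose := by
  ext1
  rw [coe_expGL, Matrix.exp_conjTranspose, ← coe_expGL]
  rfl

theorem conjTranspose_Ad (hR : ∀ g ∈ D.Gc, star (R * g * R⁻¹) * (R * g * R⁻¹) = 1) {X : Mat n}
    (hX : X ∈ lieAlg D.Gc) : (Ad R X).conjTranspose = -Ad R X := by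
  refine eq_of_expGL_smul_eq fun t => ?_
  have h1 := hR _ ((mem_lieAlg_iff D.isClosed_Gc).mp hX t)
  rw [← expGL_Ad, Ad_rsmul, star_expGL, Matrix.conjTranspose_smul, star_trivial] at h1
  rw [smul_neg, expGL_neg]
  exact eq_inv_of_mul_eq_one_left h1

theorem isHermitian_I_smul (hR : ∀ g ∈ D.Gc, star (R * g * R⁻¹) * (R * g * R⁻¹) = 1) {X : Mat n}
    (hX : X ∈ lieAlg D.Gc) : (Ad R (Complex.I • X)).IsHermitian := by
  change (Ad R (Complex.I • X)).conjTranspose = _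
  rw [Ad_smul, Matrix.conjTranspose_smul, conjTranspose_Ad hR hX]
  simp

theorem isTangent_σc {X : Mat n} (hX : X ∈ lieAlg D.Gc) :
    IsTangent D.σc (Complex.I • X) (-(Complex.I • X)) :=
  D.isRealForm_c.I_smul
    ((mem_lieAlg_realPoints_iff D.isClosed_GC D.isRealForm_c.continuous).mp hX)

/-- In coordinates where `Gc` is unitary, σc is g ↦ (g*)⁻¹. The relation defines a subgroup; it
holds for exp(A + iC) with A and C in the Lie algebra of `Gc`, since A becomes skew-Hermitian and iC
Hermitian, and `GC` is connected. -/
theorem star_conj_mul (hR : ∀ g ∈ D.Gc, star (R * g * R⁻¹) * (R * g * R⁻¹) = 1) {g : GLn n}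
    (hg : g ∈ D.GC) : star (R * g * R⁻¹) * (R * D.σc ⟨g, hg⟩ * R⁻¹) = 1 := by
  let H' : Subgroup (GLn n) :=
    { carrier := {g | ∃ hg : g ∈ D.GC, star (R * g * R⁻¹) * (R * D.σc ⟨g, hg⟩ * R⁻¹) = 1}
      one_mem' := ⟨D.GC.one_mem, by
        have h : (D.σc ⟨1, D.GC.one_mem⟩ : GLn n) = 1 := congrArg Subtype.val (map_one D.σc)
        rw [h]
        simp⟩
      mul_mem' := by
        rintro a b ⟨ha, ha'⟩ ⟨hb, hb'⟩
        refine ⟨D.GC.mul_mem ha hb, ?_⟩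
        have h : (D.σc ⟨a * b, D.GC.mul_mem ha hb⟩ : GLn n) = D.σc ⟨a, ha⟩ * D.σc ⟨b, hb⟩ :=
          congrArg Subtype.val (map_mul D.σc ⟨a, ha⟩ ⟨b, hb⟩)
        have e : ∀ x y : GLn n, R * (x * y) * R⁻¹ = R * x * R⁻¹ * (R * y * R⁻¹) := fun x y => by
          group
        rw [h, e, e, star_mul, mul_assoc, ← mul_assoc (star (R * a * R⁻¹)), ha', one_mul, hb']
      inv_mem' := by
        rintro a ⟨ha, ha'⟩
        refine ⟨D.GC.inv_mem ha, ?_⟩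
        have h : (D.σc ⟨a⁻¹, D.GC.inv_mem ha⟩ : GLn n) = (D.σc ⟨a, ha⟩ : GLn n)⁻¹ :=
          congrArg Subtype.val (map_inv D.σc ⟨a, ha⟩)
        have e : ∀ x : GLn n, R * x⁻¹ * R⁻¹ = (R * x * R⁻¹)⁻¹ := fun x => by group
        rw [h, e, e, star_inv, ← mul_inv_rev, inv_eq_one]
        exact mul_eq_one_comm.mp ha' }
  have hle : D.GC ≤ H' := by
    refine le_of_expGL_mem D.isClosed_GC D.connected fun X hX => ?_
    obtain ⟨A, hA, C, hC, rfl⟩ :=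
      D.isRealForm_c.exists_add_I_smul D.isClosed_GC hX
    have h1 := ((mem_lieAlg_realPoints_iff D.isClosed_GC D.isRealForm_c.continuous).mp hA).add
      D.isClosed_GC D.isRealForm_c.continuous (isTangent_σc hC)
    have h2 := h1 1
    simp only [one_smul] at h2
    obtain ⟨h2, h4⟩ := h2
    refine ⟨h2, ?_⟩
    rw [h4, ← expGL_Ad, ← expGL_Ad, star_expGL, mul_eq_one_iff_eq_inv, ← expGL_neg]
    congr 1
    rw [Ad_add, Ad_add, Matrix.conjTranspose_add, conjTranspose_Ad hR hA,
      isHermitian_I_smul hR hC, neg_add]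
    congr 1
    exact (neg_eq_iff_eq_neg.mpr (map_neg (adEquiv R) _)).symm
  obtain ⟨_, h⟩ := hle hg
  exact h

theorem eq_of_expGL_I_smul_eq {X Y : Mat n} (hX : X ∈ lieAlg D.Gc) (hY : Y ∈ lieAlg D.Gc)
    (h : expGL (Complex.I • X) = expGL (Complex.I • Y)) : X = Y := by
  obtain ⟨R, hR⟩ := exists_unitarization (C := D.Gc) D.compact_c
  have h1 : Ad R (Complex.I • X) = Ad R (Complex.I • Y) := by
    refine eq_of_exp_eq (isHermitian_I_smul hR hX) (isHermitian_I_smul hR hY) ?_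
    rw [expGL_Ad, expGL_Ad, h]
  have h2 := congrArg (fun Z => -Complex.I • Ad R⁻¹ Z) h1
  simpa [smul_smul] using h2

-- In unitary coordinates σc(g)⁻¹g is the positive definite matrix g*g. It remains to see that its
-- Hermitian logarithm comes from i times the Lie algebra of `Gc`.
open scoped ComplexOrder in
theorem exists_polar {g : GLn n} (hg : g ∈ D.GC) :
    ∃ X ∈ lieAlg D.Gc, (D.σc ⟨g, hg⟩ : GLn n)⁻¹ * g = expGL (Complex.I • X) := by
  obtain ⟨R, hR⟩ := exists_unitarization (C := D.Gc) D.compact_c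
  have h1 := star_conj_mul hR hg
  have h2 : R * ((D.σc ⟨g, hg⟩ : GLn n)⁻¹ * g) * R⁻¹ = star (R * g * R⁻¹) * (R * g * R⁻¹) := by
    rw [eq_inv_of_mul_eq_one_left h1]
    group
  have hpos : ((star (R * g * R⁻¹) * (R * g * R⁻¹) : GLn n) : Mat n).PosDef :=
    Matrix.PosDef.conjTranspose_mul_self _
      (Matrix.mulVec_injective_iff_isUnit.mpr (R * g * R⁻¹).isUnit)
  obtain ⟨U, μ, h3, h4⟩ := exists_log_of_posDef hpos
  set L := Ad U (Matrix.diagonal fun i => (μ i : ℂ)) with hL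
  have h5 : expGL L = R * ((D.σc ⟨g, hg⟩ : GLn n)⁻¹ * g) * R⁻¹ := by
    rw [h2]
    exact Units.ext h3
  have h6 : expGL (Ad R⁻¹ L) = (D.σc ⟨g, hg⟩ : GLn n)⁻¹ * g := by
    rw [expGL_Ad, h5]
    group
  -- Algebraicity is needed here: `GC` contains all real powers of this positive element, hence its
  -- Lie algebra contains the logarithm.
  have h7 : Ad R⁻¹ L ∈ lieAlg D.GC := by
    rw [mem_lieAlg_iff D.isClosed_GC]
    rw [hL, ← Ad_mul]
    refine fun s => D.algebraic.expGL_smul_mem _ _ ?_ s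
    rw [Ad_mul, ← hL, h6]
    exact D.GC.mul_mem (D.GC.inv_mem (D.σc ⟨g, hg⟩).2) hg
  obtain ⟨A, hA, C, hC, h8⟩ := D.isRealForm_c.exists_add_I_smul D.isClosed_GC h7
  have h9 : L = Ad R A + Ad R (Complex.I • C) := by
    rw [← Ad_add, ← h8, Ad_Ad_inv]
  -- The component from the Lie algebra of `Gc` is skew-Hermitian, while `L` and the other component
  -- are Hermitian.
  have h10 : Ad R A = 0 := by
    have h11 : L.conjTranspose = L := h4
    rw [h9, Matrix.conjTranspose_add, conjTranspose_Ad hR hA, isHermitian_I_smul hR hC,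
      add_left_inj] at h11
    have h12 : (2 : ℝ) • Ad R A = 0 := by
      rw [two_smul]
      nth_rewrite 1 [← h11]
      simp
    simpa using h12
  have h11 : A = 0 := by rw [← Ad_inv_Ad R A, h10, Ad_zero]
  refine ⟨C, hC, ?_⟩
  rw [← h6, h8, h11, zero_add]

end polar

/-! ### The normaliser of `T` in `G` -/

theorem mem_Gc_iff {g : GLn n} (hg : g ∈ D.GC) :
    g ∈ D.Gc ↔ (D.σc ⟨g, hg⟩ : GLn n) = g :=
  ⟨fun ⟨_, h⟩ => h, fun h => ⟨hg, h⟩⟩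

theorem coe_σc_mul {a b : GLn n} (ha : a ∈ D.GC) (hb : b ∈ D.GC) :
    (D.σc ⟨a * b, mul_mem ha hb⟩ : GLn n) = D.σc ⟨a, ha⟩ * D.σc ⟨b, hb⟩ :=
  congrArg Subtype.val (map_mul D.σc ⟨a, ha⟩ ⟨b, hb⟩)

theorem Ad_eq_of_commute_expGL {g : GLn n} (hg : g ∈ D.Gc) {X : Mat n} (hX : X ∈ lieAlg D.Gc)
    (h : g * expGL (Complex.I • X) = expGL (Complex.I • X) * g) : Ad g X = X := by
  refine eq_of_expGL_I_smul_eq (Ad_mem_lieAlg D.isClosed_Gc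
    (fun t ht => D.Gc.mul_mem (D.Gc.mul_mem hg ht) (D.Gc.inv_mem hg)) hX) hX ?_
  rw [← Ad_smul, expGL_Ad, h, mul_inv_cancel_right]

theorem mem_T_of_commute_expGL {X : Mat n} (hX : X ∈ lieAlg D.Gc)
    (h : ∀ t ∈ D.T, t * expGL (Complex.I • X) = expGL (Complex.I • X) * t) : X ∈ lieAlg D.T := by
  refine mem_T_of_centralizes' D.isRealSubalgebra_Gc hX fun Z hZ => ?_
  have h1 : ∀ s : ℝ, Ad (expGL (s • Z)) X = X := fun s =>
    have hs := (mem_lieAlg_iff D.isClosed_T).mp hZ s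
    Ad_eq_of_commute_expGL (D.T_le_Gc hs) hX (h _ hs)
  have h2 := hasDerivAt_Ad Z X
  simp only [h1] at h2
  exact h2.unique (hasDerivAt_const _ _)

theorem mul_comm_expGL_of_Ad {g : GLn n} {X : Mat n} (h : Ad g X = X) :
    g * expGL X = expGL X * g := by
  nth_rewrite 2 [← h]
  rw [expGL_Ad, inv_mul_cancel_right]

theorem Ad_eq_of_commute_T {g : GLn n} (h : ∀ t ∈ D.T, g * t = t * g) {X : Mat n}
    (hX : X ∈ lieAlg D.T) : Ad g X = X := by
  refine eq_of_expGL_smul_eq fun s => ?_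
  rw [← Ad_rsmul, expGL_Ad, h _ ((mem_lieAlg_iff D.isClosed_T).mp hX s), mul_inv_cancel_right]

/-- On `G` the involution σc is conjugation by some x commuting with `K`. Suppose first that x lies
in `Gc`. Since g and σc(g) act alike on `T`, the element σc(g)⁻¹g = exp(iY) commutes with `T`, so Y
is in 𝔱. Conjugation by x fixes this element but also inverts it, so Y = 0 and g is in `Gc`. In
general x is corrected by half of its polar part and g is conjugated accordingly; maximality of `K`
then finishes the argument. -/
theorem normalizer_le_K {g : GLn n} (hg : g ∈ D.G)
    (hgT : g ∈ Subgroup.normalizer (D.T : Set (GLn n))) : g ∈ D.K := by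
  obtain ⟨⟨x, hxC⟩, hx⟩ := D.inner
  have hxG : ∀ y (hy : y ∈ D.G), (D.σc ⟨y, D.G_le_GC hy⟩ : GLn n) = x * y * x⁻¹ := fun y hy => by
    have h1 := congrArg Subtype.val (hx ⟨y, D.G_le_GC hy⟩)
    obtain ⟨_, h2⟩ := identityComponent_le _ hy
    simp only [Subgroup.coe_mul, Subgroup.coe_inv, h2] at h1
    exact h1
  have hσK : ∀ k (hk : k ∈ D.K), (D.σc ⟨k, D.G_le_GC (D.K_le_G hk)⟩ : GLn n) = k := fun k hk =>
    (mem_Gc_iff _).mp (D.K_le_Gc hk)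
  have hxK : ∀ k ∈ D.K, x * k = k * x := fun k hk => by
    have h1 := hxG k (D.K_le_G hk)
    rw [hσK k hk] at h1
    exact (mul_inv_eq_iff_eq_mul.mp h1.symm)
  have hT_K : D.T ≤ D.K := D.maximalTorus.le
  set sx : GLn n := ((D.σc ⟨x, hxC⟩ : D.GC) : GLn n) with hsx
  have hsxK : ∀ k ∈ D.K, sx * k = k * sx := fun k hk => by
    have hkC := D.G_le_GC (D.K_le_G hk)
    have h1 := coe_σc_mul hxC hkC
    have h2 := coe_σc_mul hkC hxC
    rw [hσK k hk] at h1 h2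
    rw [← h1, ← h2]
    congr 3
    exact hxK k hk
  obtain ⟨X, hX, hq⟩ := exists_polar hxC
  rw [← hsx] at hq
  have hqK : ∀ k ∈ D.K, k * expGL (Complex.I • X) = expGL (Complex.I • X) * k := fun k hk => by
    rw [← hq, mul_assoc, hxK k hk, ← mul_assoc, ← mul_assoc, eq_inv_mul_iff_mul_eq.mpr
      (show sx * (k * sx⁻¹) = k by rw [← mul_assoc, hsxK k hk, mul_inv_cancel_right])]
  have hXK : ∀ k ∈ D.K, Ad k X = X := fun k hk =>
    Ad_eq_of_commute_expGL (D.K_le_Gc hk) hX (hqK k hk)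
  have hXT : X ∈ lieAlg D.T := mem_T_of_commute_expGL hX fun t ht => hqK t (hT_K ht)
  let e : ℝ → GLn n := fun s => expGL (s • (Complex.I • X))
  have he_add : ∀ s r, e s * e r = e (s + r) := fun s r => (expGL_add_smul _ s r).symm
  have he_zero : e 0 = 1 := by simp only [e, zero_smul, expGL_zero]
  have he_inv : ∀ s, (e s)⁻¹ = e (-s) := fun s => by
    rw [inv_eq_iff_mul_eq_one, he_add, add_neg_cancel, he_zero]
  have he_one : sx * e 1 = x := by
    simp only [e, one_smul, ← hq, mul_inv_cancel_left]
  have he_comm : ∀ y, Ad y X = X → ∀ s, y * e s = e s * y := fun y hy s =>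
    mul_comm_expGL_of_Ad (by rw [Ad_rsmul, Ad_smul, hy])
  have hxe := he_comm x (Ad_eq_of_commute_T (fun t ht => hxK t (hT_K ht)) hXT)
  have he_mem : ∀ s, e s ∈ D.GC := fun s => (isTangent_σc hX s).1
  have hσe : ∀ s, (D.σc ⟨e s, he_mem s⟩ : GLn n) = e (-s) := fun s => by
    obtain ⟨_, h⟩ := isTangent_σc hX s
    rw [smul_neg, ← neg_smul] at h
    exact h
  -- As σc(x) e(1) = x and σc sends e(s) to e(-s), removing half of the polar part makes v fixed by
  -- σc.
  let v : GLn n := x * e (-(1 / 2))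
  have hvC : v ∈ D.GC := mul_mem hxC (he_mem _)
  have hσv : (D.σc ⟨v, hvC⟩ : GLn n) = v := by
    refine (coe_σc_mul hxC (he_mem _)).trans ?_
    rw [hσe, ← hsx]
    simp only [v]
    rw [← he_one, mul_assoc, he_add]
    norm_num
  have hvT : ∀ t ∈ D.T, v * t = t * v := fun t ht => by
    simp only [v]
    rw [mul_assoc, ← he_comm t (hXK t (hT_K ht)), ← mul_assoc, hxK t (hT_K ht), mul_assoc]
  have hgC := D.G_le_GC hg
  -- The exponent 1/4 is chosen so that σc(g1) = v g1 v⁻¹: σc reverses both outer factors, and the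
  -- discrepancy e(1/2) on each side turns x into v.
  let g1 : GLn n := e (1 / 4) * g * e (-(1 / 4))
  have hg1C : g1 ∈ D.GC := mul_mem (mul_mem (he_mem _) hgC) (he_mem _)
  have hσg1 : (D.σc ⟨g1, hg1C⟩ : GLn n) = v * g1 * v⁻¹ := by
    have h1 : (D.σc ⟨g1, hg1C⟩ : GLn n) = e (-(1 / 4)) * (x * g * x⁻¹) * e (1 / 4) := by
      refine (coe_σc_mul (mul_mem (he_mem _) hgC) (he_mem _)).trans ?_
      rw [coe_σc_mul (he_mem _) hgC, hσe, hσe, hxG g hg, neg_neg]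
    rw [h1]
    have h2 : e (-(1 / 4)) = e (-(1 / 2)) * e (1 / 4) := by rw [he_add]; norm_num
    have h3 : e (1 / 4) = e (-(1 / 4)) * e (1 / 2) := by rw [he_add]; norm_num
    have h4 : e (1 / 2) * x⁻¹ = x⁻¹ * e (1 / 2) := by
      rw [mul_inv_eq_iff_eq_mul, mul_assoc, ← hxe, inv_mul_cancel_left]
    have h5 : x⁻¹ * e (1 / 4) = e (1 / 4) * x⁻¹ := by
      rw [eq_mul_inv_iff_mul_eq, mul_assoc, ← hxe, inv_mul_cancel_left]
    have h6 : v⁻¹ = e (1 / 2) * x⁻¹ := by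
      simp only [v]
      rw [mul_inv_rev, he_inv, neg_neg]
    calc e (-(1 / 4)) * (x * g * x⁻¹) * e (1 / 4)
        = e (-(1 / 4)) * x * g * (x⁻¹ * e (1 / 4)) := by simp only [mul_assoc]
      _ = x * e (-(1 / 4)) * g * (e (1 / 4) * x⁻¹) := by rw [h5, hxe]
      _ = x * (e (-(1 / 2)) * e (1 / 4)) * g * (e (-(1 / 4)) * e (1 / 2) * x⁻¹) := by
          rw [← h2, ← h3]
      _ = v * g1 * v⁻¹ := by rw [h6]; simp only [v, g1, mul_assoc]
  set s1 : GLn n := ((D.σc ⟨g1, hg1C⟩ : D.GC) : GLn n) with hs1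
  have hs1' : g1 = v * s1 * v⁻¹ := by
    have h1 := D.isRealForm_c.involutive ⟨g1, hg1C⟩
    have h2 : (D.σc ⟨g1, hg1C⟩) = ⟨v, hvC⟩ * ⟨g1, hg1C⟩ * (⟨v, hvC⟩ : D.GC)⁻¹ :=
      Subtype.ext hσg1
    rw [h2, map_mul, map_mul, map_inv] at h1
    have h3 := congrArg Subtype.val h1
    simp only [Subgroup.coe_mul, Subgroup.coe_inv, hσv, ← hs1] at h3
    exact h3.symm
  obtain ⟨Y, hY, hp⟩ := exists_polar hg1C
  rw [← hs1] at hp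
  have hg1T : ∀ t ∈ D.T, g1 * t * g1⁻¹ ∈ D.T := fun t ht => by
    have h1 := (Subgroup.mem_normalizer_iff.mp hgT t).mp ht
    have h2 : g1 * t * g1⁻¹ = g * t * g⁻¹ := by
      have h3 := he_comm t (hXK t (hT_K ht)) (1 / 4)
      have h4 := he_comm _ (hXK _ (hT_K h1)) (1 / 4)
      simp only [g1]
      rw [mul_inv_rev, mul_inv_rev, he_inv, he_inv, neg_neg]
      calc e (1 / 4) * g * e (-(1 / 4)) * t * (e (1 / 4) * (g⁻¹ * e (-(1 / 4))))
          = e (1 / 4) * g * e (-(1 / 4)) * (t * e (1 / 4)) * g⁻¹ * e (-(1 / 4)) := by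
            simp only [mul_assoc]
        _ = e (1 / 4) * g * (e (-(1 / 4)) * e (1 / 4)) * t * g⁻¹ * e (-(1 / 4)) := by
            rw [h3]
            simp only [mul_assoc]
        _ = e (1 / 4) * (g * t * g⁻¹) * e (-(1 / 4)) := by
            rw [he_add, neg_add_cancel, he_zero]
            simp only [mul_assoc, one_mul]
        _ = _ := by rw [← h4, mul_assoc, he_add, add_neg_cancel, he_zero, mul_one]
    rwa [h2]
  have hpT : ∀ t ∈ D.T, t * expGL (Complex.I • Y) = expGL (Complex.I • Y) * t := fun t ht => by
    have h1 : s1 * t * s1⁻¹ = g1 * t * g1⁻¹ := by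
      have h2 := hvT _ (hg1T t ht)
      have h3 := hvT t ht
      have h4 : v⁻¹ * t * v = t := by rw [mul_assoc, ← h3, inv_mul_cancel_left]
      calc s1 * t * s1⁻¹ = v * (g1 * (v⁻¹ * t * v) * g1⁻¹) * v⁻¹ := by
            rw [hσg1]
            group
        _ = g1 * t * g1⁻¹ := by rw [h4, h2, mul_inv_cancel_right]
    rw [← hp]
    calc t * (s1⁻¹ * g1) = s1⁻¹ * (s1 * t * s1⁻¹) * g1 := by group
      _ = s1⁻¹ * g1 * t := by rw [h1]; group
  have hYT := mem_T_of_commute_expGL hY hpT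
  have hvp : v * expGL (Complex.I • Y) = expGL (Complex.I • Y) * v :=
    mul_comm_expGL_of_Ad (by rw [Ad_smul, Ad_eq_of_commute_T hvT hYT])
  -- Conjugation by v exchanges g1 and σc(g1), so it inverts σc(g1)⁻¹g1; but v also commutes with
  -- this element.
  have hpinv : expGL (Complex.I • Y) = (expGL (Complex.I • Y))⁻¹ := by
    rw [← mul_inv_eq_iff_eq_mul] at hvp
    nth_rewrite 1 [← hvp]
    rw [← hp]
    calc v * (s1⁻¹ * g1) * v⁻¹ = (v * s1 * v⁻¹)⁻¹ * (v * g1 * v⁻¹) := by group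
      _ = (s1⁻¹ * g1)⁻¹ := by rw [← hs1', ← hσg1]; group
  have hY0 : Y = 0 := by
    have h1 : Y = -Y := by
      refine eq_of_expGL_I_smul_eq hY ((lieAlg D.Gc).neg_mem hY) ?_
      rw [smul_neg, expGL_neg, ← hpinv]
    have h2 : (2 : ℝ) • Y = 0 := by
      rw [two_smul]
      nth_rewrite 1 [h1]
      exact neg_add_cancel Y
    exact (smul_eq_zero_iff_right two_ne_zero).mp h2
  rw [hY0, smul_zero, expGL_zero, inv_mul_eq_one] at hp
  have hg1 : g1 ∈ D.Gc := (mem_Gc_iff hg1C).mpr (hs1.symm.trans hp)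
  let b : GLn n := e (-(1 / 4))
  -- This is a compact subgroup of `G`, and it contains `K` because b commutes with `K`; maximality
  -- gives equality.
  let K' : Subgroup (GLn n) := D.G ⊓ D.Gc.map (MulAut.conj b).toMonoidHom
  have hK' : IsCompact (K' : Set (GLn n)) := by
    refine IsCompact.inter_left ?_ D.isClosed_G
    have hc : Continuous (MulAut.conj b) := by
      change Continuous fun y => b * y * b⁻¹
      fun_prop
    exact IsCompact.image (f := MulAut.conj b) D.compact_c hc
  have hKK' : D.K ≤ K' := by
    refine le_inf D.K_le_G fun k hk => ⟨k, D.K_le_Gc hk, ?_⟩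
    change b * k * b⁻¹ = k
    rw [← he_comm k (hXK k hk), mul_inv_cancel_right]
  have hEq := D.maximalCompact.maximal K' inf_le_left hK' hKK'
  rw [← hEq]
  refine ⟨hg, g1, hg1, ?_⟩
  change b * g1 * b⁻¹ = g
  simp only [b, g1]
  rw [he_inv, neg_neg, ← mul_assoc, ← mul_assoc, he_add, neg_add_cancel, he_zero, one_mul,
    mul_assoc, he_add, neg_add_cancel, he_zero, mul_one]

end InnerFormData
end ShelstadGeometry

namespace ShelstadGeometry
namespace InnerFormData
open Filter
variable {n : ℕ} {D : InnerFormData n}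

/-! ### The Weyl group -/

theorem isClosed_normalizer_T :
    IsClosed ((Subgroup.normalizer (D.T : Set (GLn n)) : Subgroup (GLn n)) : Set (GLn n)) := by
  have h : ((Subgroup.normalizer (D.T : Set (GLn n)) : Subgroup (GLn n)) : Set (GLn n)) =
      {g | ∀ t ∈ D.T, g * t * g⁻¹ ∈ D.T} ∩ {g | ∀ t ∈ D.T, g⁻¹ * t * g ∈ D.T} := by
    ext g
    constructor
    · exact fun hg => ⟨fun t ht => (Subgroup.mem_normalizer_iff.mp hg t).mp ht,
        fun t ht => (Subgroup.mem_normalizer_iff''.mp hg t).mp ht⟩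
    · rintro ⟨h1, h2⟩
      refine Subgroup.mem_normalizer_iff.mpr fun t => ⟨h1 t, fun ht => ?_⟩
      have h3 := h2 _ ht
      have h4 : g⁻¹ * (g * t * g⁻¹) * g = t := by group
      rwa [h4] at h3
  rw [h]
  simp only [Set.ofPred_forall]
  exact (isClosed_iInter fun t => isClosed_iInter fun _ => D.isClosed_T.preimage (by fun_prop)).inter
    (isClosed_iInter fun t => isClosed_iInter fun _ => D.isClosed_T.preimage (by fun_prop))

theorem isClosed_NGc : IsClosed (D.NGc : Set (GLn n)) := D.isClosed_Gc.inter isClosed_normalizer_T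

theorem isCompact_NGc : IsCompact (D.NGc : Set (GLn n)) :=
  IsCompact.inter_right D.compact_c isClosed_normalizer_T

section
variable {Bc : Mat n →ₗ[ℝ] Mat n →ₗ[ℝ] ℝ} (hFc : D.IsFormWithInner D.Gc Bc)
include hFc

/-- For X normalising 𝔱 and Z in 𝔱, the bracket [Z,X] is in 𝔱, so B([Z,X],[Z,X]) = -B(X,[Z,[Z,X]]) =
0 because 𝔱 is abelian. Thus X centralises 𝔱. -/
theorem lieAlg_NGc_le {X : Mat n} (hX : X ∈ lieAlg D.NGc) : X ∈ lieAlg D.T := by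
  have hXc := lieAlg_mono NGc_le_Gc hX
  refine mem_T_of_centralizes' D.isRealSubalgebra_Gc hXc fun Z hZ => ?_
  have hZc := lieAlg_mono D.T_le_Gc hZ
  have h1 : X * Z - Z * X ∈ lieAlg D.T :=
    hasDerivAt_mem (lieAlg D.T).toSubmodule (hasDerivAt_Ad X Z) (Eventually.of_forall fun s =>
      Ad_mem_T ((mem_lieAlg_iff isClosed_NGc).mp hX s).2 hZ)
  have h2 : adC Z X ∈ lieAlg D.T := by
    have h3 := (lieAlg D.T).neg_mem h1
    rwa [neg_sub] at h3
  by_contra h0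
  have h3 := hFc.inner.pos _ (lieAlg_mono D.T_le_Gc h2) h0
  rw [skew hFc.isClosed hFc.T_le hFc.inner hZ hXc (lieAlg_mono D.T_le_Gc h2), adC_apply,
    D.lie_T_eq_zero hZ h2] at h3
  simp at h3

theorem eventually_mem_T : ∀ᶠ g : GLn n in 𝓝 1, g ∈ D.NGc → g ∈ D.T := by
  obtain ⟨z, -, -, hz⟩ := eventually_eq_expGL (isClosed_NGc (D := D))
  filter_upwards [hz] with g hg hgN
  rw [hg hgN]
  exact expGL_mem D.isClosed_T (lieAlg_NGc_le hFc (z g).2)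

theorem isOpen_subgroupOf_T : IsOpen ((D.T.subgroupOf D.NGc : Subgroup D.NGc) : Set D.NGc) := by
  refine Subgroup.isOpen_of_mem_nhds _ (g := 1) ?_
  have h1 : ∀ᶠ g : D.NGc in 𝓝 1, (g : GLn n) ∈ D.NGc → (g : GLn n) ∈ D.T :=
    ((continuous_subtype_val (p := (· ∈ D.NGc))).tendsto' 1 1 rfl).eventually (eventually_mem_T hFc)
  filter_upwards [h1] with g hg
  exact hg g.2

/-- `T` is open in the compact group N_{Gc}(T), because the two have the same Lie algebra. -/
theorem finite_WG : Finite D.WG := by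
  have : CompactSpace D.NGc := isCompact_iff_compactSpace.mp isCompact_NGc
  exact Subgroup.quotient_finite_of_isOpen _ (isOpen_subgroupOf_T hFc)

/-- There are finitely many representatives for the Weyl group. -/
theorem exists_finite_reps : ∃ F : Set (GLn n), F.Finite ∧ F ⊆ D.NGc ∧
    ∀ w ∈ D.NGc, ∃ f ∈ F, ∃ t ∈ D.T, w = f * t := by
  have := finite_WG hFc
  refine ⟨Set.range fun x : D.WG => (x.out : GLn n), Set.finite_range _, ?_, fun w hw => ?_⟩
  · rintro _ ⟨x, rfl⟩
    exact x.out.2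
  · refine ⟨_, ⟨(⟨w, hw⟩ : D.NGc), rfl⟩, (((⟨w, hw⟩ : D.NGc) : D.WG).out : GLn n)⁻¹ * w, ?_,
      by simp⟩
    have h1 : (((⟨w, hw⟩ : D.NGc) : D.WG).out : D.WG) = ((⟨w, hw⟩ : D.NGc) : D.WG) :=
      Quotient.out_eq' _
    exact (QuotientGroup.eq (s := D.T.subgroupOf D.NGc)).mp h1

theorem isOpen_compl_NGc_diff : IsOpen ((D.NGc : Set (GLn n)) \ D.T)ᶜ := by
  rw [isOpen_compl_iff]
  have h1 : ((D.NGc : Set (GLn n)) \ D.T) =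
      Subtype.val '' ((D.T.subgroupOf D.NGc : Subgroup D.NGc) : Set D.NGc)ᶜ := by
    ext g
    simp only [Set.mem_sdiff, SetLike.mem_coe, Set.mem_image, Set.mem_compl_iff, Subtype.exists,
      Subgroup.mem_subgroupOf]
    constructor
    · exact fun h => ⟨g, h.1, h.2, rfl⟩
    · rintro ⟨_, h, h', rfl⟩
      exact ⟨h, h'⟩
  rw [h1]
  exact isClosed_NGc.isClosedMap_subtype_val _ (isOpen_subgroupOf_T hFc).isClosed_compl

/-- Elements of the normaliser which move a small neighbourhood of the base point of `Gc/T` to a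
set meeting this neighbourhood are in `T`. -/
theorem eventually_mem_T_of_mul : ∀ᶠ p : Mat n × Mat n in 𝓝 (0, 0), ∀ t ∈ D.T,
    expGL p.1 * t * (expGL p.2)⁻¹ ∈ D.NGc → expGL p.1 * t * (expGL p.2)⁻¹ ∈ D.T := by
  have hc : Continuous fun z : (Mat n × Mat n) × GLn n =>
      expGL z.1.1 * z.2 * (expGL z.1.2)⁻¹ := by
    have h1 : Continuous fun z : (Mat n × Mat n) × GLn n => expGL z.1.1 :=
      continuous_expGL.comp (continuous_fst.comp continuous_fst)
    have h2 : Continuous fun z : (Mat n × Mat n) × GLn n => expGL z.1.2 :=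
      continuous_expGL.comp (continuous_snd.comp continuous_fst)
    exact (h1.mul continuous_snd).mul h2.inv
  -- At p = (0, 0) the product is t itself, which avoids the closed set of normalising elements
  -- outside `T`; compactness of `T` makes the neighbourhood uniform in t.
  have h := D.maximalTorus.isTorus.isCompact.eventually_forall_of_forall_eventually
    (x₀ := ((0 : Mat n), (0 : Mat n)))
    (P := fun p t => expGL p.1 * t * (expGL p.2)⁻¹ ∈ ((D.NGc : Set (GLn n)) \ D.T)ᶜ) fun t ht => by
      refine hc.continuousAt.eventually ((isOpen_compl_NGc_diff hFc).mem_nhds ?_)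
      simpa using fun _ => ht
  filter_upwards [h] with p hp t ht h1
  have := hp t ht
  rw [Set.mem_compl_iff, Set.mem_sdiff, not_and, not_not] at this
  exact this h1

end

/-! ### Fixed points -/

/-- One inclusion suffices: Ad(g⁻¹) maps 𝔱 injectively, hence bijectively, to itself, and the
connected group `T` is controlled by its exponentials. -/
theorem mem_normalizer_of_conj_mem {g : GLn n} (h : ∀ t ∈ D.T, g⁻¹ * t * g ∈ D.T) :
    g ∈ Subgroup.normalizer (D.T : Set (GLn n)) := by
  let L : lieSub D.T →ₗ[ℝ] lieSub D.T :=
    ((adEquiv g⁻¹).toLinearMap.restrictScalars ℝ).restrict fun X hX =>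
      Ad_mem_lieAlg D.isClosed_T (fun t ht => by simpa using h t ht) hX
  have hL : Function.Injective L := fun X Y hXY =>
    Subtype.ext ((adEquiv g⁻¹).injective (congrArg Subtype.val hXY))
  have hsurj := LinearMap.injective_iff_surjective.mp hL
  have hle : D.T ≤ D.T.comap (MulAut.conj g).toMonoidHom := by
    refine le_of_expGL_mem D.isClosed_T D.maximalTorus.isTorus.isConnected fun X hX => ?_
    obtain ⟨Y, hY⟩ := hsurj ⟨X, hX⟩
    have hY' : Ad g⁻¹ (Y : Mat n) = X := congrArg Subtype.val hY
    change g * expGL X * g⁻¹ ∈ D.T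
    rw [← expGL_Ad, ← hY', Ad_Ad_inv]
    exact expGL_mem D.isClosed_T Y.2
  refine Subgroup.mem_normalizer_iff.mpr fun t => ⟨fun ht => hle ht, fun ht => ?_⟩
  have h3 := h _ ht
  have h4 : g⁻¹ * (g * t * g⁻¹) * g = t := by group
  rwa [h4] at h3

theorem mem_normalizer_of_fixed {g : GLn n}
    (h : ∀ t ∈ D.T, t • (g : GLn n ⧸ D.T) = (g : GLn n ⧸ D.T)) :
    g ∈ Subgroup.normalizer (D.T : Set (GLn n)) := by
  refine mem_normalizer_of_conj_mem fun t ht => ?_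
  have h1 := QuotientGroup.eq.mp (h t ht).symm
  change g⁻¹ * (t * g) ∈ D.T at h1
  rwa [← mul_assoc] at h1

/-! ### Invariant neighbourhoods -/

theorem _root_.ShelstadGeometry.continuous_Ad_comp {E : Type*} [TopologicalSpace E] {g : E → GLn n}
    {f : E → Mat n} (hg : Continuous g) (hf : Continuous f) :
    Continuous fun z => Ad (g z) (f z) := by
  unfold Ad
  exact ((continuous_coe.comp hg).matrix_mul hf).matrix_mul (continuous_coe.comp hg.inv)

/-- Every neighbourhood of `0` contains an open neighbourhood invariant under the torus. -/
theorem exists_adInvariant_nhd {m : Submodule ℝ (Mat n)}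
    {p : m → Prop} (hp : ∀ᶠ X : m in 𝓝 0, p X) :
    ∃ O : Set m, IsOpen O ∧ 0 ∈ O ∧ AdInvariant D.T O ∧ ∀ X ∈ O, p X := by
  obtain ⟨N, hN, hNo, hN0⟩ := eventually_nhds_iff.mp hp
  obtain ⟨N', hN'o, hN'⟩ := isOpen_induced_iff.mp hNo
  -- These are the points whose whole orbit stays in the given neighbourhood; the set is open
  -- because `T` is compact.
  refine ⟨{X | ∀ t ∈ D.T, Ad t (X : Mat n) ∈ N'}, ?_, ?_, ?_, ?_⟩
  · refine isOpen_iff_eventually.mpr fun X hX => ?_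
    have hc : Continuous fun z : m × GLn n => Ad z.2 (z.1 : Mat n) :=
      continuous_Ad_comp continuous_snd (continuous_subtype_val.comp continuous_fst)
    have hN'' : IsOpen N' := hN'o
    have h0 : IsOpen {z : m × GLn n | Ad z.2 (z.1 : Mat n) ∈ N'} := hN''.preimage hc
    have h1 : ∀ t ∈ (D.T : Set (GLn n)), ∀ᶠ z : m × GLn n in 𝓝 (X, t),
        Ad z.2 (z.1 : Mat n) ∈ N' := fun t ht => h0.mem_nhds (hX t ht)
    exact D.maximalTorus.isTorus.isCompact.eventually_forall_of_forall_eventually h1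
  · intro t _
    rw [Submodule.coe_zero, Ad_zero]
    rw [← hN'] at hN0
    exact hN0
  · intro a ha X Y hY hX t ht
    rw [hY, ← Ad_mul]
    exact hX _ (mul_mem ht ha)
  · intro X hX
    refine hN X ?_
    have h1 := hX 1 D.T.one_mem
    rw [Ad_one] at h1
    rw [← hN']
    exact h1

end InnerFormData
end ShelstadGeometry

namespace ShelstadGeometry
open Filter
variable {n : ℕ}

/-! ### Charts of coset spaces -/

theorem smul_eta (T : Subgroup (GLn n)) (k : GLn n) (X : Mat n) :
    k • eta T X = ((k * expGL X : GLn n) : GLn n ⧸ T) := rfl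

theorem smul_eta_eq_iff {T : Subgroup (GLn n)} {k g : GLn n} {X : Mat n} :
    (g : GLn n ⧸ T) = k • eta T X ↔ ∃ t ∈ T, g = k * expGL X * t := by
  rw [smul_eta, eq_comm, QuotientGroup.eq]
  constructor
  · exact fun h => ⟨_, h, by group⟩
  · rintro ⟨t, ht, rfl⟩
    have h1 : (k * expGL X)⁻¹ * (k * expGL X * t) = t := by group
    rwa [h1]

/-- The slice chart is transported by left translation by k and right translation by t. This gives
smooth coordinates near any k exp(X) t, and they underlie all later smoothness statements. -/
theorem SliceChart.local_decomp {H T : Subgroup (GLn n)} {m : Submodule ℝ (Mat n)}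
    (c : SliceChart H T m) (hT : T ≤ H) {U : Set m} (hU : IsOpen U) (hUO : U ⊆ c.O) {k : GLn n}
    (hk : k ∈ H) {X : m} (hX : X ∈ U) {t : GLn n} (ht : t ∈ T) :
    ∃ (N : Set (Mat n)) (x : Mat n → m) (ζ : Mat n → lieSub T), IsOpen N ∧
      ((k * expGL (X : Mat n) * t : GLn n) : Mat n) ∈ N ∧ ContDiffOn ℝ ∞ x N ∧
      ContDiffOn ℝ ∞ ζ N ∧ (∀ a ∈ N, x a ∈ U) ∧
      (∀ g ∈ H, (g : Mat n) ∈ N → g = k * expGL (x g : Mat n) * (expGL (ζ g : Mat n) * t)) := by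
  let L : Mat n → Mat n := fun a => ((k⁻¹ : GLn n) : Mat n) * a * ((t⁻¹ : GLn n) : Mat n)
  have hL : ContDiff ℝ ∞ L := by
    rw [← contDiffOn_univ]
    exact contDiffOn_matrix_mul (contDiffOn_matrix_mul contDiffOn_const contDiffOn_id)
      contDiffOn_const
  have hLg : ∀ g : GLn n, L g = ((k⁻¹ * g * t⁻¹ : GLn n) : Mat n) := fun g => by simp [L]
  have hN1 : IsOpen (L ⁻¹' c.N) := c.isOpen_N.preimage hL.continuous
  have hx : ContDiffOn ℝ ∞ (fun a => c.f (L a)) (L ⁻¹' c.N) :=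
    c.contDiffOn_f.comp hL.contDiffOn fun _ h => h
  have hz : ContDiffOn ℝ ∞ (fun a => c.z (L a)) (L ⁻¹' c.N) :=
    c.contDiffOn_z.comp hL.contDiffOn fun _ h => h
  refine ⟨L ⁻¹' c.N ∩ (fun a => c.f (L a)) ⁻¹' U, fun a => c.f (L a), fun a => c.z (L a),
    hx.continuousOn.isOpen_inter_preimage hN1 hU, ?_, hx.mono Set.inter_subset_left,
    hz.mono Set.inter_subset_left, fun a ha => ha.2, fun g hg hgN => ?_⟩
  · have h1 : L ((k * expGL (X : Mat n) * t : GLn n) : Mat n) = NormedSpace.exp (X : Mat n) := by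
      rw [hLg, ← coe_expGL]
      congr 1
      group
    constructor
    · change L _ ∈ c.N
      rw [h1]
      exact c.exp_mem X (hUO hX)
    · change c.f (L _) ∈ U
      rw [h1, c.f_exp X (hUO hX)]
      exact hX
  · have h1 : L g ∈ c.N := hgN.1
    have h2 := c.eq_mul (k⁻¹ * g * t⁻¹)
      (H.mul_mem (H.mul_mem (H.inv_mem hk) hg) (H.inv_mem (hT ht))) (by rwa [← hLg])
    rw [← hLg] at h2
    calc g = k * (k⁻¹ * g * t⁻¹) * t := by group
      _ = _ := by
        rw [h2]
        simp only [mul_assoc]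

theorem SliceChart.isOpen_smul_eta_image {H T : Subgroup (GLn n)} (hTc : IsClosed (T : Set (GLn n)))
    {m : Submodule ℝ (Mat n)} (hm : m ≤ lieSub H) (hH : IsClosed (H : Set (GLn n)))
    (c : SliceChart H T m) (hT : T ≤ H) {U : Set m} (hU : IsOpen U) (hUO : U ⊆ c.O) {k : GLn n}
    (hk : k ∈ H) : IsOpenInCosetSpace H {x : GLn n ⧸ T | ∃ X ∈ U, x = k • eta T (X : Mat n)} := by
  refine ⟨?_, ?_⟩
  · rintro _ ⟨X, -, rfl⟩
    exact ⟨k * expGL (X : Mat n), H.mul_mem hk (expGL_mem hH (hm X.2)), rfl⟩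
  · have hloc : ∀ g : preimageIn H {x : GLn n ⧸ T | ∃ X ∈ U, x = k • eta T (X : Mat n)},
        ∃ N : Set (GLn n), IsOpen N ∧ (g : GLn n) ∈ N ∧ ∀ h ∈ H, h ∈ N →
          (h : GLn n ⧸ T) ∈ {x : GLn n ⧸ T | ∃ X ∈ U, x = k • eta T (X : Mat n)} := by
      rintro ⟨g, hg, X, hX, h⟩
      obtain ⟨t, ht, rfl⟩ := smul_eta_eq_iff.mp h
      obtain ⟨N, x, ζ, hN, hgN, -, -, hxU, hdec⟩ := c.local_decomp hT hU hUO hk hX ht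
      refine ⟨{g | (g : Mat n) ∈ N}, hN.preimage continuous_coe, hgN, fun h hh hhN => ?_⟩
      exact ⟨x h, hxU _ hhN, smul_eta_eq_iff.mpr
        ⟨_, T.mul_mem (expGL_mem hTc (ζ h).2) ht, hdec h hh hhN⟩⟩
    choose N hN hgN hsub using hloc
    refine ⟨⋃ g, N g, isOpen_iUnion hN, ?_⟩
    ext g
    constructor
    · exact fun hg => ⟨Set.mem_iUnion.mpr ⟨⟨g, hg⟩, hgN ⟨g, hg⟩⟩, hg.1⟩
    · rintro ⟨hg, hgH⟩
      obtain ⟨i, hi⟩ := Set.mem_iUnion.mp hg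
      exact ⟨hgH, hsub i g hgH hi⟩

theorem IsOpenInCosetSpace.iUnion {ι : Sort*} {H T : Subgroup (GLn n)} {Ω : ι → Set (GLn n ⧸ T)}
    (h : ∀ i, IsOpenInCosetSpace H (Ω i)) : IsOpenInCosetSpace H (⋃ i, Ω i) := by
  refine ⟨Set.iUnion_subset fun i => (h i).1, ?_⟩
  choose O hO hO' using fun i => (h i).2
  refine ⟨⋃ i, O i, isOpen_iUnion hO, ?_⟩
  have h1 : preimageIn H (⋃ i, Ω i) = ⋃ i, preimageIn H (Ω i) := by
    ext g
    simp [preimageIn]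
  rw [h1, Set.iUnion_inter]
  exact Set.iUnion_congr hO'

/-! ### Characters of tori -/

namespace InnerFormData
variable {D : InnerFormData n}

theorem continuous_twistChar {χ : D.T →* Circle} (hχ : Continuous χ) {w : GLn n}
    (hw : w ∈ Subgroup.normalizer (D.T : Set (GLn n))) : Continuous (twistChar χ w hw) := by
  refine hχ.comp (Continuous.subtype_mk ?_ _)
  exact (continuous_const.mul continuous_subtype_val).mul continuous_const

/-- The character `χ ∘ exp` of the Lie algebra of `T`. -/
noncomputable def charExp (χ : D.T →* Circle) : Multiplicative (lieSub D.T) →* ℂ where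
  toFun Z := χ ⟨expGL (Z.toAdd : Mat n), expGL_mem D.isClosed_T Z.toAdd.2⟩
  map_one' := by
    rw [← Circle.coe_one, ← map_one χ]
    congr 2
    ext1
    exact expGL_zero
  map_mul' Z W := by
    rw [← Circle.coe_mul, ← map_mul]
    congr 2
    ext1
    exact expGL_add (sub_eq_zero.mp (D.lie_T_eq_zero Z.toAdd.2 W.toAdd.2))

/-- Characters of a torus are smooth in exponential coordinates. -/
theorem contDiff_char_expGL {χ : D.T →* Circle} (hχ : Continuous χ) :
    ContDiff ℝ ∞ fun Z : lieSub D.T =>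
      (χ ⟨expGL (Z : Mat n), expGL_mem D.isClosed_T Z.2⟩ : ℂ) := by
  let b := Module.finBasis ℝ (lieSub D.T)
  -- Along each basis line the character is a continuous one-parameter group in ℂ, hence
  -- exponential; multiplicativity then gives a finite product.
  have h1 : ∀ i, ∃ Y : ℂ, ∀ s : ℝ, charExp χ (Multiplicative.ofAdd (s • b i)) =
      NormedSpace.exp (s • Y) := fun i => by
    refine exists_exp_of_continuous_hom
      (fun s : ℝ => charExp χ (Multiplicative.ofAdd (s • b i))) ?_ ?_ fun s t => ?_
    · refine (show Continuous ((↑) : Circle → ℂ) by fun_prop).comp (hχ.comp (Continuous.subtype_mk ?_ _))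
      exact continuous_expGL.comp (continuous_id.smul continuous_const)
    · simp only [zero_smul, ofAdd_zero, map_one]
    · rw [add_smul, ofAdd_add, map_mul]
  choose Y hY using h1
  have h2 : ∀ Z : lieSub D.T, (χ ⟨expGL (Z : Mat n), expGL_mem D.isClosed_T Z.2⟩ : ℂ) =
      ∏ i, Complex.exp (b.repr Z i • Y i) := fun Z => by
    have h3 : (χ ⟨expGL (Z : Mat n), expGL_mem D.isClosed_T Z.2⟩ : ℂ) =
      charExp χ (Multiplicative.ofAdd Z) := rfl
    rw [h3]
    nth_rewrite 1 [← b.sum_repr Z]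
    rw [ofAdd_sum, map_prod]
    refine Finset.prod_congr rfl fun i _ => ?_
    rw [hY, Complex.exp_eq_exp_ℂ]
  simp only [h2]
  refine contDiff_prod fun i _ => Complex.contDiff_exp.comp ?_
  refine ContDiff.fun_smul ?_ contDiff_const
  have h4 : ContDiff ℝ ∞ (LinearMap.toContinuousLinearMap (b.coord i)) :=
    ContinuousLinearMap.contDiff _
  exact h4

end InnerFormData
end ShelstadGeometry

namespace ShelstadGeometry
namespace InnerFormData
open Filter
variable {n : ℕ} {D : InnerFormData n}

/-! ### Classes in the Weyl group -/

theorem exists_of_weylClass_eq {a b : D.NGc} (h : D.weylClass a = D.weylClass b) :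
    ∃ k ∈ D.NK, ∃ t ∈ D.T, (b : GLn n) = k * a * t := by
  have h1 := QuotientGroup.rightRel_apply.mp (Quotient.exact h)
  obtain ⟨k, hk, h2⟩ := h1
  have h3 : ((k * a : D.NGc) : D.WG) = (b : D.WG) := by
    rw [QuotientGroup.mk_mul, ← mul_inv_eq_iff_eq_mul.mp h2.symm |>.symm]
    rfl
  have h4 := (QuotientGroup.eq (s := D.T.subgroupOf D.NGc)).mp h3
  exact ⟨k, hk, _, h4, by simp [mul_assoc]⟩

theorem weylClass_eq {a b : D.NGc} {k t : GLn n} (hk : k ∈ D.NK) (ht : t ∈ D.T)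
    (h : (b : GLn n) = k * a * t) : D.weylClass a = D.weylClass b := by
  refine Quotient.sound (QuotientGroup.rightRel_apply.mpr ⟨⟨k, NK_le_NGc hk⟩, hk, ?_⟩)
  rw [eq_mul_inv_iff_mul_eq]
  change ((⟨k, NK_le_NGc hk⟩ * a : D.NGc) : D.WG) = (b : D.WG)
  refine (QuotientGroup.eq (s := D.T.subgroupOf D.NGc)).mpr ?_
  change ((k * a)⁻¹ * b : GLn n) ∈ D.T
  rw [h]
  simpa [mul_assoc] using ht

/-! ### Charts -/

theorem IsFormWithInner.nonempty_sliceChart {S : Set (Functional D.T)} {H : Subgroup (GLn n)}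
    {B : Mat n →ₗ[ℝ] Mat n →ₗ[ℝ] ℝ} (hS : D.IsPos S) (hF : D.IsFormWithInner H B) :
    Nonempty (SliceChart H D.T (perp H D.T B)) :=
  ShelstadGeometry.nonempty_sliceChart hF.isClosed D.isClosed_T hF.T_le _ (fun _ hX => hX.1)
    (fun _ hX h => hF.eq_zero_of_mem_perp hX h) fun _ hX => hF.exists_perp hS hX

theorem _root_.ShelstadGeometry.SliceChart.eq_of_smul_eta_eq {H T : Subgroup (GLn n)}
    {m : Submodule ℝ (Mat n)} (c : SliceChart H T m) {X X' : m} (hX : X ∈ c.O) (hX' : X' ∈ c.O)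
    {k : GLn n} (h : k • eta T (X : Mat n) = k • eta T (X' : Mat n)) : X = X' := by
  rw [smul_eta, smul_eta_eq_iff] at h
  obtain ⟨t, ht, h⟩ := h
  rw [mul_assoc] at h
  exact c.inj X hX X' hX' t ht (mul_left_cancel h)

theorem mul_smul_eta {k t : GLn n} (ht : t ∈ D.T) (X : Mat n) :
    (k * t) • eta D.T X = k • eta D.T (Ad t X) := by
  rw [smul_eta, smul_eta_eq_iff]
  refine ⟨t, ht, ?_⟩
  rw [expGL_Ad]
  group

section fine
variable {P : Set (Functional D.T)} {B Bc : Mat n →ₗ[ℝ] Mat n →ₗ[ℝ] ℝ}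

/-- The conditions on `Ũ` under which the map `φ` is well-defined and a diffeomorphism. -/
structure IsFine (cG : SliceChart D.G D.T (D.tPerp B)) (cC : SliceChart D.Gc D.T (D.tPerpC Bc))
    (P : Set (Functional D.T)) (U : Set (D.tPerp B)) : Prop where
  isOpen : IsOpen U
  invariant : AdInvariant D.T U
  subset : U ⊆ cG.O
  psi_mem : ∀ w ∈ D.NGc, ∀ X ∈ U, D.psi B Bc P w X ∈ cC.O
  disjoint : ∀ k ∈ D.NGc, ∀ k' ∈ D.NGc, ∀ X ∈ U, ∀ X' ∈ U,
    k • eta D.T (X : Mat n) = k' • eta D.T (X' : Mat n) → k⁻¹ * k' ∈ D.T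
  -- The translating element v is independent of the index w of ψ_w, since φ uses translation by k w
  -- together with ψ_w.
  disjoint_c : ∀ v ∈ D.NGc, ∀ v' ∈ D.NGc, ∀ w ∈ D.NGc, ∀ w' ∈ D.NGc, ∀ X ∈ U, ∀ X' ∈ U,
    v • eta D.T (D.psi B Bc P w X : Mat n) = v' • eta D.T (D.psi B Bc P w' X' : Mat n) →
      v⁻¹ * v' ∈ D.T

/-- Equality of the two cosets means k⁻¹k' = exp(X) t exp(X')⁻¹ for some t in `T`, an element of the
normaliser close to `T`. -/
theorem mem_T_of_smul_eta_eq {N : Set (Mat n × Mat n)}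
    (hN : ∀ p ∈ N, ∀ t ∈ D.T,
      expGL p.1 * t * (expGL p.2)⁻¹ ∈ D.NGc → expGL p.1 * t * (expGL p.2)⁻¹ ∈ D.T)
    {k k' : GLn n} (hk : k ∈ D.NGc) (hk' : k' ∈ D.NGc) {X X' : Mat n} (h : (X, X') ∈ N)
    (he : k • eta D.T X = k' • eta D.T X') : k⁻¹ * k' ∈ D.T := by
  rw [smul_eta D.T k', eq_comm, smul_eta_eq_iff] at he
  obtain ⟨t, ht, he⟩ := he
  have h1 : k⁻¹ * k' = expGL X * t * (expGL X')⁻¹ := by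
    rw [eq_mul_inv_iff_mul_eq, mul_assoc, he]
    group
  rw [h1]
  refine hN _ h t ht ?_
  rw [← h1]
  exact mul_mem (inv_mem hk) hk'

theorem continuous_psi (hP : D.IsPos P) (hF : D.IsFormWithInner D.G B)
    (hFc : D.IsFormWithInner D.Gc Bc) {w : GLn n} (hw : w ∈ D.NGc) :
    Continuous (D.psi B Bc P w) :=
  (psiEquiv hP hF hFc hw).toLinearMap.continuous_of_finiteDimensional

theorem psi_zero (hP : D.IsPos P) (hF : D.IsFormWithInner D.G B)
    (hFc : D.IsFormWithInner D.Gc Bc) {w : GLn n} (hw : w ∈ D.NGc) :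
    D.psi B Bc P w 0 = 0 := map_zero (psiEquiv hP hF hFc hw)

theorem exists_isFine (hP : D.IsPos P) (hF : D.IsFormWithInner D.G B)
    (hFc : D.IsFormWithInner D.Gc Bc) (cG : SliceChart D.G D.T (D.tPerp B))
    (cC : SliceChart D.Gc D.T (D.tPerpC Bc)) {p : D.tPerp B → Prop}
    (hp : ∀ᶠ X : D.tPerp B in 𝓝 0, p X) :
    ∃ O : Set (D.tPerp B), IsOpen O ∧ 0 ∈ O ∧ AdInvariant D.T O ∧
      ∀ U : Set (D.tPerp B), U ⊆ O → IsOpen U → AdInvariant D.T U →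
        IsFine cG cC P U ∧ ∀ X ∈ U, p X := by
  have h1 := eventually_mem_T_of_mul hFc
  rw [nhds_prod_eq, eventually_prod_iff] at h1
  obtain ⟨pa, hpa, pb, hpb, h1⟩ := h1
  have h2 : ∀ᶠ X : Mat n in 𝓝 0, pa X ∧ pb X := hpa.and hpb
  have h3 : ∀ᶠ Y : D.tPerpC Bc in 𝓝 0, (pa (Y : Mat n) ∧ pb (Y : Mat n)) ∧ Y ∈ cC.O :=
    ((continuous_subtype_val (p := (· ∈ D.tPerpC Bc))).tendsto' 0 0 rfl |>.eventually h2).and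
      (cC.isOpen_O.mem_nhds cC.zero_mem)
  obtain ⟨Oc, hOc, h0c, hinvc, hOc'⟩ := exists_adInvariant_nhd h3
  -- Finitely many maps ψ_f control all of them: ψ_{ft} = Ad(t⁻¹)ψ_f, and `Oc` is invariant under
  -- Ad(T).
  obtain ⟨F, hFin, hFsub, hFrep⟩ := exists_finite_reps hFc
  have h4 : ∀ᶠ X : D.tPerp B in 𝓝 0, ∀ f ∈ F, D.psi B Bc P f X ∈ Oc := by
    refine (eventually_all_finite hFin).mpr fun f hf => ?_
    refine (continuous_psi hP hF hFc (hFsub hf)).tendsto' 0 0 (psi_zero hP hF hFc (hFsub hf))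
      |>.eventually (hOc.mem_nhds h0c)
  have h5 : ∀ᶠ X : D.tPerp B in 𝓝 0, ((pa (X : Mat n) ∧ pb (X : Mat n)) ∧ X ∈ cG.O) ∧
      (∀ f ∈ F, D.psi B Bc P f X ∈ Oc) ∧ p X :=
    (((continuous_subtype_val (p := (· ∈ D.tPerp B))).tendsto' 0 0 rfl |>.eventually h2).and
      (cG.isOpen_O.mem_nhds cG.zero_mem)).and (h4.and hp)
  obtain ⟨O, hO, h0, hinv, hO'⟩ := exists_adInvariant_nhd h5
  have hpsi : ∀ w ∈ D.NGc, ∀ X ∈ O, D.psi B Bc P w X ∈ Oc := by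
    intro w hw X hX
    obtain ⟨f, hf, t, ht, rfl⟩ := hFrep w hw
    exact hinvc t⁻¹ (inv_mem ht) _ _ (psi_mul_T hP hF hFc (hFsub hf) ht X) ((hO' X hX).2.1 f hf)
  refine ⟨O, hO, h0, hinv, fun U hUO hU hUinv => ⟨⟨hU, hUinv, fun X hX => (hO' X (hUO hX)).1.2,
    fun w hw X hX => (hOc' _ (hpsi w hw X (hUO hX))).2, ?_, ?_⟩, fun X hX => (hO' X (hUO hX)).2.2⟩⟩
  · intro k hk k' hk' X hX X' hX' he
    exact mem_T_of_smul_eta_eq (N := {p | pa p.1 ∧ pb p.2}) (fun p hp => h1 hp.1 hp.2) hk hk'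
      ⟨(hO' X (hUO hX)).1.1.1, (hO' X' (hUO hX')).1.1.2⟩ he
  · intro k hk k' hk' w hw w' hw' X hX X' hX' he
    exact mem_T_of_smul_eta_eq (N := {p | pa p.1 ∧ pb p.2}) (fun p hp => h1 hp.1 hp.2) hk hk'
      ⟨(hOc' _ (hpsi w hw X (hUO hX))).1.1, (hOc' _ (hpsi w' hw' X' (hUO hX'))).1.2⟩ he

end fine

end InnerFormData
end ShelstadGeometry

/-! ### The map φ: well-definedness, equivariance and image -/

namespace ShelstadGeometry
namespace InnerFormData
open Filter
variable {n : ℕ} {D : InnerFormData n}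
variable {P : Set (Functional D.T)} {B Bc : Mat n →ₗ[ℝ] Mat n →ₗ[ℝ] ℝ}

theorem perp_le_lieSub {H T : Subgroup (GLn n)} : perp H T B ≤ lieSub H := fun _ hX => hX.1

open Classical in
/-- The restriction of the map `φ` to the component with representative `w`. -/
noncomputable def phiAt (Bc : Mat n →ₗ[ℝ] Mat n →ₗ[ℝ] ℝ) (P : Set (Functional D.T))
    (U : Set (D.tPerp B)) (w : GLn n) (x : GLn n ⧸ D.T) : GLn n ⧸ D.T :=
  if h : ∃ k ∈ D.NK, ∃ X ∈ U, x = k • eta D.T (X : Mat n) then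
    (h.choose * w) • eta D.T (D.psi B Bc P w h.choose_spec.2.choose : Mat n)
  -- Outside V the value is irrelevant.
  else x

theorem mem_V_iff {U : Set (D.tPerp B)} {g : GLn n} :
    (g : GLn n ⧸ D.T) ∈ D.V U ↔
      ∃ k ∈ D.NK, ∃ X ∈ U, ∃ t ∈ D.T, g = k * expGL (X : Mat n) * t := by
  simp only [V, Set.mem_ofPred_eq, smul_eta_eq_iff]

theorem V_eq_iUnion (U : Set (D.tPerp B)) :
    D.V U = ⋃ k : D.NK, {x | ∃ X ∈ U, x = (k : GLn n) • eta D.T (X : Mat n)} := by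
  ext x
  simp [V]

section
variable (hP : D.IsPos P) (hF : D.IsFormWithInner D.G B) (hFc : D.IsFormWithInner D.Gc Bc)
  {cG : SliceChart D.G D.T (D.tPerp B)} {cC : SliceChart D.Gc D.T (D.tPerpC Bc)}
  {U : Set (D.tPerp B)} (hU : IsFine cG cC P U)
include hP hF hFc hU

-- Smallness makes k unique up to `T`; absorbing the element of `T` into X leaves equal translates
-- of one chart, which is injective.
omit hFc in
theorem IsFine.exists_eq {k k' : GLn n} (hk : k ∈ D.NK) (hk' : k' ∈ D.NK) {X X' : D.tPerp B}
    (hX : X ∈ U) (hX' : X' ∈ U) (h : k • eta D.T (X : Mat n) = k' • eta D.T (X' : Mat n)) :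
    ∃ t ∈ D.T, k' = k * t ∧ (X : Mat n) = Ad t (X' : Mat n) := by
  have ht := hU.disjoint k (NK_le_NGc hk) k' (NK_le_NGc hk') X hX X' hX' h
  have hk'' : k' = k * (k⁻¹ * k') := by group
  refine ⟨_, ht, hk'', ?_⟩
  rw [hk'', mul_smul_eta ht] at h
  have hmem := hF.Ad_mem_perp hP (D.T_le_G ht) (mem_normalizer_of_mem_T ht) X'.2
  have h1 := cG.eq_of_smul_eta_eq (X' := ⟨_, hmem⟩) (hU.subset hX)
    (hU.subset (hU.invariant _ ht X' ⟨_, hmem⟩ rfl hX')) h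
  exact congrArg Subtype.val h1

/-- The ambiguity (k, X) ~ (kt, Ad(t⁻¹)X) does not change the value: by `psi_Ad` it becomes the same
ambiguity for k w and w⁻¹tw. -/
theorem IsFine.phiAt_eq {w : GLn n} (hw : w ∈ D.NGc) {k : GLn n} (hk : k ∈ D.NK)
    {X : D.tPerp B} (hX : X ∈ U) :
    phiAt Bc P U w (k • eta D.T (X : Mat n)) =
      (k * w) • eta D.T (D.psi B Bc P w X : Mat n) := by
  have h : ∃ k' ∈ D.NK, ∃ X' ∈ U, k • eta D.T (X : Mat n) = k' • eta D.T (X' : Mat n) :=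
    ⟨k, hk, X, hX, rfl⟩
  rw [phiAt, dif_pos h]
  obtain ⟨hX', hX''⟩ := h.choose_spec.2.choose_spec
  obtain ⟨t, ht, hk', hXX'⟩ := hU.exists_eq hP hF hk h.choose_spec.1 hX hX' hX''
  rw [psi_Ad hP hF hFc hw ht hXX', ← mul_smul_eta ((Subgroup.mem_normalizer_iff''.mp hw.2 t).mp ht)]
  congr 1
  rw [hk']
  group

theorem IsFine.phiAt_smul {w : GLn n} (hw : w ∈ D.NGc) {h : GLn n} (hh : h ∈ D.T)
    {x : GLn n ⧸ D.T} (hx : x ∈ D.V U) : phiAt Bc P U w (h • x) = h • phiAt Bc P U w x := by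
  obtain ⟨k, hk, X, hX, rfl⟩ := hx
  rw [hU.phiAt_eq hP hF hFc hw hk hX, ← mul_smul,
    hU.phiAt_eq hP hF hFc hw (mul_mem (T_le_NK hh) hk) hX, ← mul_smul, mul_assoc]

theorem IsFine.phiAt_image {w : GLn n} (hw : w ∈ D.NGc) :
    phiAt Bc P U w '' D.V U = ⋃ k : D.NK, {x | ∃ Y ∈ D.psi B Bc P w '' U,
      x = ((k : GLn n) * w) • eta D.T (Y : Mat n)} := by
  ext x
  simp only [Set.mem_image, Set.mem_iUnion, Set.mem_ofPred_eq]
  constructor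
  · rintro ⟨_, ⟨k, hk, X, hX, rfl⟩, rfl⟩
    exact ⟨⟨k, hk⟩, _, ⟨X, hX, rfl⟩, hU.phiAt_eq hP hF hFc hw hk hX⟩
  · rintro ⟨⟨k, hk⟩, _, ⟨X, hX, rfl⟩, rfl⟩
    exact ⟨_, ⟨k, hk, X, hX, rfl⟩, hU.phiAt_eq hP hF hFc hw hk hX⟩

theorem IsFine.isOpen_psi_image {w : GLn n} (hw : w ∈ D.NGc) : IsOpen (D.psi B Bc P w '' U) :=
  (psiEquiv hP hF hFc hw).toContinuousLinearEquiv.toHomeomorph.isOpenMap _ hU.isOpen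

omit hP hF hFc in
theorem IsFine.psi_image_subset {w : GLn n} (hw : w ∈ D.NGc) : D.psi B Bc P w '' U ⊆ cC.O := by
  rintro _ ⟨X, hX, rfl⟩
  exact hU.psi_mem w hw X hX

theorem IsFine.isOpen_phiAt_image {w : GLn n} (hw : w ∈ D.NGc) :
    IsOpenInCosetSpace D.Gc (phiAt Bc P U w '' D.V U) := by
  rw [hU.phiAt_image hP hF hFc hw]
  exact IsOpenInCosetSpace.iUnion fun k => cC.isOpen_smul_eta_image D.isClosed_T perp_le_lieSub
    D.isClosed_Gc D.T_le_Gc (hU.isOpen_psi_image hP hF hFc hw) (hU.psi_image_subset hw)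
    (NGc_le_Gc (mul_mem (NK_le_NGc k.2) hw))

omit hP hF hFc in
theorem IsFine.isOpen_V : IsOpenInCosetSpace D.G (D.V U) := by
  rw [V_eq_iUnion]
  exact IsOpenInCosetSpace.iUnion fun k => cG.isOpen_smul_eta_image D.isClosed_T perp_le_lieSub
    D.isClosed_G D.T_le_G hU.isOpen hU.subset (NK_le_G k.2)

omit hP hF hFc in
theorem IsFine.isInvariantNhd_V (h0 : 0 ∈ U) : IsInvariantNhd D.G (D.V U) where
  isOpen := hU.isOpen_V
  invariant := by
    rintro h hh _ ⟨k, hk, X, hX, rfl⟩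
    exact ⟨h * k, mul_mem (T_le_NK hh) hk, X, hX, (mul_smul _ _ _).symm⟩
  fixed := by
    rintro _ ⟨g, hg, rfl⟩ hfix
    have hgT := mem_normalizer_of_fixed hfix
    -- The fixed point is the centre X = 0 of a chart of V, because the normaliser of `T` in `G`
    -- lies in `K`.
    refine mem_V_iff.mpr ⟨g, ⟨normalizer_le_K hg hgT, hgT⟩, 0, h0, 1, D.T.one_mem, ?_⟩
    rw [Submodule.coe_zero, expGL_zero, mul_one, mul_one]

variable {w : D.WeylCosets → D.NGc} (hw : ∀ q, D.weylClass (w q) = q)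
include hw

theorem IsFine.isInvariantNhd_image (h0 : 0 ∈ U) :
    IsInvariantNhd D.Gc ((fun p : (GLn n ⧸ D.T) × D.WeylCosets => phiAt Bc P U (w p.2) p.1) ''
      (D.V U ×ˢ Set.univ)) where
  isOpen := by
    have h1 : (fun p : (GLn n ⧸ D.T) × D.WeylCosets => phiAt Bc P U (w p.2) p.1) ''
        (D.V U ×ˢ Set.univ) = ⋃ q, phiAt Bc P U (w q) '' D.V U := by
      ext x
      simp only [Set.mem_image, Set.mem_prod, Set.mem_univ, and_true, Prod.exists, Set.mem_iUnion]
      exact exists_comm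
    rw [h1]
    exact IsOpenInCosetSpace.iUnion fun q => hU.isOpen_phiAt_image hP hF hFc (w q).2
  invariant := by
    rintro h hh _ ⟨⟨x, q⟩, ⟨hx, -⟩, rfl⟩
    refine ⟨(h • x, q), ⟨(hU.isInvariantNhd_V h0).invariant h hh x hx, Set.mem_univ _⟩, ?_⟩
    exact hU.phiAt_smul hP hF hFc (w q).2 hh hx
  fixed := by
    rintro _ ⟨g, hg, rfl⟩ hfix
    have hgN : g ∈ D.NGc := ⟨hg, mem_normalizer_of_fixed hfix⟩
    -- Here g = k w t for the fixed representative w of its class, so gT is the image of the centre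
    -- of the chart at k.
    obtain ⟨k, hk, t, ht, h⟩ := exists_of_weylClass_eq (hw (D.weylClass ⟨g, hgN⟩))
    refine ⟨(k • eta D.T ((0 : D.tPerp B) : Mat n), D.weylClass ⟨g, hgN⟩),
      ⟨⟨k, hk, 0, h0, rfl⟩, Set.mem_univ _⟩, ?_⟩
    refine (hU.phiAt_eq hP hF hFc (w _).2 hk h0).trans ?_
    rw [psi_zero hP hF hFc (w _).2, eq_comm, smul_eta_eq_iff]
    refine ⟨t, ht, ?_⟩
    simp only [Submodule.coe_zero, expGL_zero, mul_one]
    exact h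

/-- By `psi_mul_NK`, the pair (k w, ψ_w X) agrees with (k w, ψ_{kw}(Ad(k)X)); invariance under
N_K(T) keeps Ad(k)X in the neighbourhood. -/
theorem IsFine.image_eq_Vc (hinv : AdInvariant D.NK U) :
    (fun p : (GLn n ⧸ D.T) × D.WeylCosets => phiAt Bc P U (w p.2) p.1) '' (D.V U ×ˢ Set.univ) =
      D.Vc Bc P U := by
  have hmem : ∀ k ∈ D.NK, ∀ X ∈ U, ∃ X' ∈ U, (X' : Mat n) = Ad k (X : Mat n) := by
    intro k hk X hX
    have h := hF.Ad_mem_perp hP (NK_le_G hk) hk.2 X.2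
    exact ⟨⟨_, h⟩, hinv k hk X ⟨_, h⟩ rfl hX, rfl⟩
  ext x
  constructor
  · rintro ⟨⟨_, q⟩, ⟨⟨k, hk, X, hX, rfl⟩, -⟩, rfl⟩
    obtain ⟨X', hX', h⟩ := hmem k hk X hX
    refine ⟨k * w q, mul_mem (NK_le_NGc hk) (w q).2, X', hX', ?_⟩
    rw [psi_mul_NK hP hF hFc (w q).2 hk h]
    exact hU.phiAt_eq hP hF hFc (w q).2 hk hX
  · rintro ⟨v, hv, X, hX, rfl⟩
    obtain ⟨k, hk, t, ht, h⟩ := exists_of_weylClass_eq (hw (D.weylClass ⟨v, hv⟩))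
    set q := D.weylClass ⟨v, hv⟩
    change v = k * w q * t at h
    obtain ⟨X', hX', h'⟩ := hmem k⁻¹ (inv_mem hk) X hX
    have h'' : (X : Mat n) = Ad k (X' : Mat n) := by rw [h', Ad_Ad_inv]
    refine ⟨(k • eta D.T (X' : Mat n), q), ⟨⟨k, hk, X', hX', rfl⟩, Set.mem_univ _⟩, ?_⟩
    refine (hU.phiAt_eq hP hF hFc (w q).2 hk hX').trans ?_
    rw [h, psi_mul_T hP hF hFc (mul_mem (NK_le_NGc hk) (w q).2) ht,
      psi_mul_NK hP hF hFc (w q).2 hk h'', mul_smul_eta ht, Ad_Ad_inv]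

end

end InnerFormData
end ShelstadGeometry

/-! ### The map φ as a diffeomorphism onto an open set -/

namespace ShelstadGeometry
namespace InnerFormData
open Filter
variable {n : ℕ} {D : InnerFormData n}
variable {P : Set (Functional D.T)} {B Bc : Mat n →ₗ[ℝ] Mat n →ₗ[ℝ] ℝ}

theorem contDiff_exp_coe (m : Submodule ℝ (Mat n)) :
    ContDiff ℝ ∞ fun X : m => NormedSpace.exp (X : Mat n) :=
  ((contDiff_matrix_exp n).of_le le_top).comp m.subtypeL.contDiff

/-- The smooth map `a ↦ g exp(x(a))`, for a smooth map `x`. -/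
theorem contDiffOn_mul_exp {E : Type*} [NormedAddCommGroup E] [NormedSpace ℝ E]
    {m : Submodule ℝ (Mat n)} (g : GLn n) {x : E → m} {N : Set E} (hx : ContDiffOn ℝ ∞ x N) :
    ContDiffOn ℝ ∞ (fun a => ((g * expGL (x a : Mat n) : GLn n) : Mat n)) N := by
  simp only [Units.val_mul, coe_expGL]
  exact contDiffOn_matrix_mul contDiffOn_const ((contDiff_exp_coe m).comp_contDiffOn hx)

section
variable (hP : D.IsPos P) (hF : D.IsFormWithInner D.G B) (hFc : D.IsFormWithInner D.Gc Bc)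
  {cG : SliceChart D.G D.T (D.tPerp B)} {cC : SliceChart D.Gc D.T (D.tPerpC Bc)}
  {U : Set (D.tPerp B)} (hU : IsFine cG cC P U)

theorem IsFine.isSmall (hU : IsFine cG cC P U) : D.IsSmall Bc P U where
  isOpen := by
    have h := cG.isOpen_smul_eta_image D.isClosed_T perp_le_lieSub D.isClosed_G D.T_le_G hU.isOpen
      hU.subset D.G.one_mem
    have h1 : {x : GLn n ⧸ D.T | ∃ X ∈ U, x = (1 : GLn n) • eta D.T (X : Mat n)} =
        (fun X : D.tPerp B => eta D.T (X : Mat n)) '' U := by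
      ext x
      simp [eq_comm]
    rwa [h1] at h
  inverse := by
    classical
    have hinj : ∀ X ∈ U, ∀ X' ∈ U, eta D.T (X : Mat n) = eta D.T (X' : Mat n) → X = X' :=
      fun X hX X' hX' h => cG.eq_of_smul_eta_eq (k := 1) (hU.subset hX) (hU.subset hX')
        (by rw [one_smul, one_smul, h])
    let f : GLn n ⧸ D.T → Mat n := fun x =>
      if h : ∃ X ∈ U, eta D.T (X : Mat n) = x then h.choose else 0
    have hf : ∀ X ∈ U, f (eta D.T (X : Mat n)) = X := fun X hX => by
      have h : ∃ X' ∈ U, eta D.T (X' : Mat n) = eta D.T (X : Mat n) := ⟨X, hX, rfl⟩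
      simp only [f, dif_pos h]
      rw [hinj _ h.choose_spec.1 X hX h.choose_spec.2]
    refine ⟨f, hf, ?_⟩
    rintro g ⟨hg, X, hX, h⟩
    obtain ⟨t, ht, rfl⟩ := smul_eta_eq_iff.mp (h.symm.trans (one_smul (GLn n) _).symm)
    obtain ⟨N, x, ζ, hN, hgN, hx, -, hxU, hdec⟩ :=
      cG.local_decomp D.T_le_G hU.isOpen hU.subset D.G.one_mem hX ht
    refine ⟨N, hN, hgN, fun a => (x a : Mat n),
      (D.tPerp B).subtypeL.contDiff.comp_contDiffOn hx, fun b hb hbN => ?_⟩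
    have h1 : (b : GLn n ⧸ D.T) = (1 : GLn n) • eta D.T (x b : Mat n) :=
      smul_eta_eq_iff.mpr ⟨_, mul_mem (expGL_mem D.isClosed_T (ζ b).2) ht, hdec b hb.1 hbN⟩
    simp only [h1, one_smul]
    exact hf _ (hxU _ hbN)
  disjoint k hk k' hk' X hX X' hX' h :=
    hU.disjoint k (NK_le_NGc hk) k' (NK_le_NGc hk') X hX X' hX' h
  disjoint_c v hv v' hv' X hX X' hX' h :=
    hU.disjoint_c v hv v' hv' v hv v' hv' X hX X' hX' h

include hP hF hFc hU

/-- Disjointness on the compact side gives (kw)⁻¹k'w ∈ T, and conjugation by w turns this into k⁻¹k'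
∈ T. After absorbing this element, injectivity of the chart of Gc/T and of ψ_w remains. -/
theorem IsFine.phiAt_injOn {w : GLn n} (hw : w ∈ D.NGc) :
    Set.InjOn (phiAt Bc P U w) (D.V U) := by
  rintro _ ⟨k, hk, X, hX, rfl⟩ _ ⟨k', hk', X', hX', rfl⟩ h
  rw [hU.phiAt_eq hP hF hFc hw hk hX, hU.phiAt_eq hP hF hFc hw hk' hX'] at h
  have ht := hU.disjoint_c _ (mul_mem (NK_le_NGc hk) hw) _ (mul_mem (NK_le_NGc hk') hw) w hw w hw
    X hX X' hX' h
  have ht' : k⁻¹ * k' ∈ D.T := by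
    have h1 := (Subgroup.mem_normalizer_iff.mp hw.2 _).mp ht
    have h2 : w * ((k * w)⁻¹ * (k' * w)) * w⁻¹ = k⁻¹ * k' := by group
    rwa [h2] at h1
  obtain ⟨t, rfl⟩ : ∃ t, k' = k * t := ⟨k⁻¹ * k', by group⟩
  rw [inv_mul_cancel_left] at ht'
  obtain ⟨X1, hX1⟩ : ∃ X1 : D.tPerp B, (X1 : Mat n) = Ad t (X' : Mat n) :=
    ⟨⟨_, hF.Ad_mem_perp hP (D.T_le_G ht') (mem_normalizer_of_mem_T ht') X'.2⟩, rfl⟩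
  have hX1U := hU.invariant _ ht' X' X1 hX1 hX'
  have h1 : k * t * w = k * w * (w⁻¹ * t * w) := by group
  rw [h1, mul_smul_eta ((Subgroup.mem_normalizer_iff''.mp hw.2 t).mp ht'),
    ← psi_Ad hP hF hFc hw ht' hX1] at h
  have h2 := cC.eq_of_smul_eta_eq (hU.psi_mem w hw X hX) (hU.psi_mem w hw X1 hX1U) h
  rw [mul_smul_eta ht', ← hX1, (psi_bijective hP hF hFc hw).1 h2]

/-- Near a point of V the factor k can be kept constant, so k w exp(ψ_w x(g)) is a smooth local
lift; the inverse is lifted likewise, by k exp(ψ_w⁻¹ y(g)). -/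
theorem IsFine.smoothMapOn_phiAt {w : GLn n} (hw : w ∈ D.NGc) :
    SmoothMapOn D.G D.Gc (D.V U) (phiAt Bc P U w) := by
  rintro g ⟨hg, hgV⟩
  obtain ⟨k, hk, X, hX, t, ht, rfl⟩ := mem_V_iff.mp hgV
  obtain ⟨N, x, ζ, hN, hgN, hx, -, hxU, hdec⟩ :=
    cG.local_decomp D.T_le_G hU.isOpen hU.subset (NK_le_G hk) hX ht
  refine ⟨{g | (g : Mat n) ∈ N}, hN.preimage continuous_coe, hgN,
    fun g => k * w * expGL (D.psi B Bc P w (x g) : Mat n), ?_, ?_⟩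
  · rintro b ⟨hb, hbN⟩
    refine ⟨mul_mem (NGc_le_Gc (mul_mem (NK_le_NGc hk) hw))
      (expGL_mem D.isClosed_Gc (D.psi B Bc P w _).2.1), ?_⟩
    have h1 : (b : GLn n ⧸ D.T) = k • eta D.T (x b : Mat n) :=
      smul_eta_eq_iff.mpr ⟨_, mul_mem (expGL_mem D.isClosed_T (ζ b).2) ht, hdec b hb.1 hbN⟩
    rw [h1, hU.phiAt_eq hP hF hFc hw hk (hxU _ hbN)]
    rfl
  · rintro b ⟨hb, hbN⟩
    refine ⟨N, hN, hbN, fun a => ((k * w * expGL (D.psi B Bc P w (x a) : Mat n) : GLn n) : Mat n),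
      ?_, fun _ _ _ => rfl⟩
    refine contDiffOn_mul_exp (k * w) (x := fun a => D.psi B Bc P w (x a)) ?_
    exact (psiEquiv hP hF hFc hw).toContinuousLinearEquiv.contDiff.comp_contDiffOn hx

theorem IsFine.exists_smooth_inverse {w : GLn n} (hw : w ∈ D.NGc) :
    ∃ F' : GLn n ⧸ D.T → GLn n ⧸ D.T, (∀ x ∈ D.V U, F' (phiAt Bc P U w x) = x) ∧
      SmoothMapOn D.Gc D.G (phiAt Bc P U w '' D.V U) F' := by
  have hinj := hU.phiAt_injOn hP hF hFc hw
  have hne : Nonempty (GLn n ⧸ D.T) := ⟨((1 : GLn n) : GLn n ⧸ D.T)⟩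
  have hF' : ∀ x ∈ D.V U, Function.invFunOn (phiAt Bc P U w) (D.V U) (phiAt Bc P U w x) = x :=
    fun x hx => hinj.leftInvOn_invFunOn hx
  refine ⟨_, hF', ?_⟩
  rintro g ⟨hg, hgV⟩
  rw [hU.phiAt_image hP hF hFc hw] at hgV
  obtain ⟨⟨k, hk⟩, Y, hY, h⟩ := Set.mem_iUnion.mp hgV
  obtain ⟨t, ht, rfl⟩ := smul_eta_eq_iff.mp h
  have hkw := mul_mem (NK_le_NGc hk) hw
  obtain ⟨N, y, ζ, hN, hgN, hy, -, hyU, hdec⟩ := cC.local_decomp D.T_le_Gc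
    (hU.isOpen_psi_image hP hF hFc hw) (hU.psi_image_subset hw) (NGc_le_Gc hkw) hY ht
  let ψ := psiEquiv hP hF hFc hw
  refine ⟨{g | (g : Mat n) ∈ N}, hN.preimage continuous_coe, hgN,
    fun g => k * expGL (ψ.symm (y g) : Mat n), ?_, ?_⟩
  · rintro b ⟨hb, hbN⟩
    refine ⟨mul_mem (NK_le_G hk) (expGL_mem D.isClosed_G (ψ.symm (y b)).2.1), ?_⟩
    obtain ⟨X, hX, hXy⟩ := hyU _ hbN
    have h2 : ψ.symm (y b) = X := by
      rw [← hXy]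
      exact ψ.symm_apply_apply X
    have h1 : (b : GLn n ⧸ D.T) = (k * w) • eta D.T (y b : Mat n) :=
      smul_eta_eq_iff.mpr ⟨_, mul_mem (expGL_mem D.isClosed_T (ζ b).2) ht, hdec b hb.1 hbN⟩
    rw [h1, ← hXy, ← hU.phiAt_eq hP hF hFc hw hk hX, hF' _ ⟨k, hk, X, hX, rfl⟩]
    change _ = ((k * expGL (ψ.symm (y b) : Mat n) : GLn n) : GLn n ⧸ D.T)
    rw [h2]
    rfl
  · rintro b ⟨hb, hbN⟩
    refine ⟨N, hN, hbN, fun a => ((k * expGL (ψ.symm (y a) : Mat n) : GLn n) : Mat n),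
      ?_, fun _ _ _ => rfl⟩
    refine contDiffOn_mul_exp k (x := fun a => ψ.symm (y a)) ?_
    exact ψ.toContinuousLinearEquiv.symm.contDiff.comp_contDiffOn hy

-- Images of distinct components are disjoint: a common point forces v' ∈ N_K(T) v T.
omit hP hF hFc in
theorem IsFine.weylClass_eq_of_smul_eta_eq {v v' : D.NGc} {k k' : GLn n} (hk : k ∈ D.NK)
    (hk' : k' ∈ D.NK) {X X' : D.tPerp B} (hX : X ∈ U) (hX' : X' ∈ U)
    (h : (k * v) • eta D.T (D.psi B Bc P v X : Mat n) =
      (k' * v') • eta D.T (D.psi B Bc P v' X' : Mat n)) : D.weylClass v = D.weylClass v' := by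
  have ht := hU.disjoint_c _ (mul_mem (NK_le_NGc hk) v.2) _
    (mul_mem (NK_le_NGc hk') v'.2) v v.2 v' v'.2 X hX X' hX' h
  refine weylClass_eq (mul_mem (inv_mem hk') hk) ht ?_
  generalize (v : GLn n) = a
  generalize (v' : GLn n) = b
  group

theorem IsFine.isDiffeoOntoOpen {w : D.WeylCosets → D.NGc} (hw : ∀ q, D.weylClass (w q) = q) :
    IsDiffeoOntoOpen D.G D.Gc (D.V U)
      (fun p : (GLn n ⧸ D.T) × D.WeylCosets => phiAt Bc P U (w p.2) p.1) where
  injOn := by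
    rintro ⟨x, q⟩ ⟨hx, -⟩ ⟨x', q'⟩ ⟨hx', -⟩ h
    have h' : phiAt Bc P U (w q) x = phiAt Bc P U (w q') x' := h
    have hxV : x ∈ D.V U := hx
    have hxV' : x' ∈ D.V U := hx'
    have hqq' : q = q' := by
      obtain ⟨k, hk, X, hX, hx⟩ := hxV
      obtain ⟨k', hk', X', hX', hx'⟩ := hxV'
      rw [hx, hx', hU.phiAt_eq hP hF hFc (w q).2 hk hX,
        hU.phiAt_eq hP hF hFc (w q').2 hk' hX'] at h'
      rw [← hw q, ← hw q', hU.weylClass_eq_of_smul_eta_eq hk hk' hX hX' h']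
    subst hqq'
    exact congrArg (·, q) (hU.phiAt_injOn hP hF hFc (w q).2 hxV hxV' h')
  isOpen_image q := by
    have h := hU.isOpen_phiAt_image hP hF hFc (w q).2
    exact h
  smooth q := by
    have h := hU.smoothMapOn_phiAt hP hF hFc (w q).2
    exact h
  smooth_inverse q := by
    have h := hU.exists_smooth_inverse hP hF hFc (w q).2
    exact h

end

end InnerFormData
end ShelstadGeometry

namespace ShelstadGeometry
namespace InnerFormData
open Filter
variable {n : ℕ} {D : InnerFormData n}
variable {P : Set (Functional D.T)} {B Bc : Mat n →ₗ[ℝ] Mat n →ₗ[ℝ] ℝ}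

/-! ### Line bundles -/

/-- A simultaneous decomposition of `g` in `G` and `y` in `Gc`, where `yT` is the image of `gT`. -/
structure IsDecomp (Bc : Mat n →ₗ[ℝ] Mat n →ₗ[ℝ] ℝ) (P : Set (Functional D.T))
    (U : Set (D.tPerp B)) (w g y k : GLn n) (X : D.tPerp B) (t t' : D.T) : Prop where
  mem_NK : k ∈ D.NK
  mem_U : X ∈ U
  left : g = k * expGL (X : Mat n) * t
  right : y = k * w * expGL (D.psi B Bc P w X : Mat n) * t'

/-- The relation between the fibre coordinates of the two line bundles. -/
noncomputable def transition (χ χ' : D.T →* Circle) (t t' : D.T) : ℂ := (((χ' t)⁻¹ * χ t' : Circle) : ℂ)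

open Classical in
/-- The isomorphism of line bundles, in the coordinates given by `g` and `y`. -/
noncomputable def lineIsoCoord (Bc : Mat n →ₗ[ℝ] Mat n →ₗ[ℝ] ℝ) (P : Set (Functional D.T))
    (U : Set (D.tPerp B)) (w : GLn n) (χ χ' : D.T →* Circle) (a : GLn n × GLn n) : ℂ :=
  if h : ∃ z : ℂ, ∃ k X t t', IsDecomp Bc P U w a.1 a.2 k X t t' ∧ z = transition χ χ' t t'
  then h.choose else 1

open Classical in
/-- The isomorphism of line bundles. -/
noncomputable def lineIso (Bc : Mat n →ₗ[ℝ] Mat n →ₗ[ℝ] ℝ) (P : Set (Functional D.T))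
    (U : Set (D.tPerp B)) (w : GLn n) (χ χ' : D.T →* Circle) (x : GLn n ⧸ D.T) (L : LineTotal χ) :
    LineTotal χ' :=
  if h : ∃ L' : LineTotal χ', ∃ g y z k X t t', IsDecomp Bc P U w g y k X t t' ∧
    x = (g : GLn n ⧸ D.T) ∧ L = LineTotal.mk χ y z ∧
      L' = LineTotal.mk χ' g (transition χ χ' t t' * z)
  then h.choose else LineTotal.mk χ' 1 0

theorem LineTotal_mk_eq_iff {χ : D.T →* Circle} {g g' : GLn n} {z z' : ℂ} :
    LineTotal.mk χ g z = LineTotal.mk χ g' z' ↔ ∃ t : D.T, g = g' * t ∧ z' = (χ t : ℂ) * z :=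
  Quotient.eq (r := lineSetoid χ)

section
variable (hP : D.IsPos P) (hF : D.IsFormWithInner D.G B) (hFc : D.IsFormWithInner D.Gc Bc)
  {cG : SliceChart D.G D.T (D.tPerp B)} {cC : SliceChart D.Gc D.T (D.tPerpC Bc)}
  {U : Set (D.tPerp B)} (hU : IsFine cG cC P U)
include hP hF hFc hU

/-- Passing to another decomposition by s ∈ T changes t by the factor s and t' by w⁻¹sw; the twisted
character is defined so that the two contributions cancel. -/
theorem IsFine.transition_eq {w : GLn n} (hw : w ∈ D.NGc) (χ : D.T →* Circle)
    {g y k k₂ : GLn n} {X X₂ : D.tPerp B} {t t' t₂ t₂' : D.T}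
    (h : IsDecomp Bc P U w g y k X t t') (h₂ : IsDecomp Bc P U w g y k₂ X₂ t₂ t₂') :
    transition χ (twistChar χ w hw.2) t t' = transition χ (twistChar χ w hw.2) t₂ t₂' := by
  have h1 : (g : GLn n ⧸ D.T) = k • eta D.T (X : Mat n) := smul_eta_eq_iff.mpr ⟨t, t.2, h.left⟩
  have h2 : (g : GLn n ⧸ D.T) = k₂ • eta D.T (X₂ : Mat n) :=
    smul_eta_eq_iff.mpr ⟨t₂, t₂.2, h₂.left⟩
  obtain ⟨s, hs, rfl, hX⟩ := hU.exists_eq hP hF h.mem_NK h₂.mem_NK h.mem_U h₂.mem_U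
    (h1.symm.trans h2)
  have hr : w⁻¹ * s * w ∈ D.T := (Subgroup.mem_normalizer_iff''.mp hw.2 s).mp hs
  have hψ := psi_Ad hP hF hFc hw hs hX
  have ht : t = ⟨s, hs⟩ * t₂ := by
    ext1
    have h3 := h.left.symm.trans h₂.left
    rw [hX, expGL_Ad] at h3
    have h4 : k * (s * expGL (X₂ : Mat n) * s⁻¹) * (t : GLn n) =
        k * s * expGL (X₂ : Mat n) * (s⁻¹ * t) := by group
    rw [h4] at h3
    exact (inv_mul_eq_iff_eq_mul.mp (mul_left_cancel h3))
  have ht' : t' = ⟨w⁻¹ * s * w, hr⟩ * t₂' := by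
    ext1
    have h3 := h.right.symm.trans h₂.right
    rw [hψ, expGL_Ad] at h3
    have h4 : k * w * ((w⁻¹ * s * w) * expGL (D.psi B Bc P w X₂ : Mat n) * (w⁻¹ * s * w)⁻¹) *
        (t' : GLn n) = k * s * w * expGL (D.psi B Bc P w X₂ : Mat n) *
          ((w⁻¹ * s * w)⁻¹ * t') := by group
    rw [h4] at h3
    exact (inv_mul_eq_iff_eq_mul.mp (mul_left_cancel h3))
  have hχ : twistChar χ w hw.2 ⟨s, hs⟩ = χ ⟨w⁻¹ * s * w, hr⟩ := rfl
  unfold transition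
  rw [ht, ht', map_mul, map_mul, hχ]
  congr 1
  generalize χ ⟨w⁻¹ * s * w, hr⟩ = a
  rw [mul_inv, mul_comm a⁻¹, mul_assoc, inv_mul_cancel_left]

theorem IsFine.lineIsoCoord_eq {w : GLn n} (hw : w ∈ D.NGc) (χ : D.T →* Circle)
    {g y k : GLn n} {X : D.tPerp B} {t t' : D.T} (h : IsDecomp Bc P U w g y k X t t') :
    lineIsoCoord Bc P U w χ (twistChar χ w hw.2) (g, y) =
      transition χ (twistChar χ w hw.2) t t' := by
  have h1 : ∃ z : ℂ, ∃ k X t t', IsDecomp Bc P U w (g, y).1 (g, y).2 k X t t' ∧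
      z = transition χ (twistChar χ w hw.2) t t' := ⟨_, k, X, t, t', h, rfl⟩
  rw [lineIsoCoord, dif_pos h1]
  obtain ⟨k₂, X₂, t₂, t₂', h2, h3⟩ := h1.choose_spec
  rw [h3]
  exact hU.transition_eq hP hF hFc hw χ h2 h

/-- Changing the representatives g and y by elements of `T` changes t and t' on the right, which
matches the relations defining the two bundles; so the value does not depend on the choices. -/
theorem IsFine.lineIso_eq {w : GLn n} (hw : w ∈ D.NGc) (χ : D.T →* Circle)
    {g y k : GLn n} {X : D.tPerp B} {t t' : D.T} (h : IsDecomp Bc P U w g y k X t t') (z : ℂ) :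
    lineIso Bc P U w χ (twistChar χ w hw.2) (g : GLn n ⧸ D.T) (LineTotal.mk χ y z) =
      LineTotal.mk (twistChar χ w hw.2) g (transition χ (twistChar χ w hw.2) t t' * z) := by
  set χ' := twistChar χ w hw.2 with hχ'
  have h1 : ∃ L' : LineTotal χ', ∃ g' y' z' k X t t', IsDecomp Bc P U w g' y' k X t t' ∧
      (g : GLn n ⧸ D.T) = (g' : GLn n ⧸ D.T) ∧ LineTotal.mk χ y z = LineTotal.mk χ y' z' ∧
      L' = LineTotal.mk χ' g' (transition χ χ' t t' * z') :=
    ⟨_, g, y, z, k, X, t, t', h, rfl, rfl, rfl⟩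
  rw [lineIso, dif_pos h1]
  obtain ⟨g₂, y₂, z₂, k₂, X₂, t₂, t₂', h2, hg, hL, h3⟩ := h1.choose_spec
  rw [h3]
  obtain ⟨r, hy, hz⟩ := LineTotal_mk_eq_iff.mp hL
  obtain ⟨s, hs⟩ : ∃ s : D.T, g = g₂ * s :=
    ⟨⟨g₂⁻¹ * g, QuotientGroup.eq.mp hg.symm⟩, (mul_inv_cancel_left _ _).symm⟩
  have hd : IsDecomp Bc P U w g₂ y₂ k X (t * s⁻¹) (t' * r⁻¹) := by
    refine ⟨h.mem_NK, h.mem_U, ?_, ?_⟩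
    · rw [← mul_inv_eq_iff_eq_mul.mpr hs, h.left]
      simp only [Subgroup.coe_mul, Subgroup.coe_inv, mul_assoc]
    · rw [← mul_inv_eq_iff_eq_mul.mpr hy, h.right]
      simp only [Subgroup.coe_mul, Subgroup.coe_inv, mul_assoc]
  rw [hU.transition_eq hP hF hFc hw χ h2 hd]
  refine (LineTotal_mk_eq_iff.mpr ⟨s, hs, ?_⟩).symm
  rw [hz, ← mul_assoc, ← mul_assoc]
  congr 1
  unfold transition
  rw [← Circle.coe_mul, ← Circle.coe_mul, ← hχ', map_mul, map_mul, map_inv, map_inv]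
  congr 1
  generalize χ' t = a
  generalize χ' s = b
  generalize χ t' = c
  generalize χ r = e
  rw [mul_inv, inv_inv, mul_comm a⁻¹ b, mul_assoc, mul_assoc, mul_assoc, inv_mul_cancel,
    mul_one]

/-- Equivariance holds because replacing g, y, k by sg, sy, sk leaves t and t' unchanged. For
smoothness, k is kept fixed near a point, and t and t' vary through exponentials of smooth
coordinates. -/
theorem IsFine.pullbackLineIso {w : GLn n} (hw : w ∈ D.NGc) {χ : D.T →* Circle}
    (hχ : Continuous χ) :
    PullbackLineIso D.G D.Gc χ (twistChar χ w hw.2) (D.V U) (phiAt Bc P U w) := by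
  set χ' := twistChar χ w hw.2 with hχ'
  refine ⟨lineIso Bc P U w χ χ', lineIsoCoord Bc P U w χ χ', ?_, ?_⟩
  · rintro g ⟨hg, hgV⟩ y hy hgy
    obtain ⟨k, hk, X, hX, t, ht, h⟩ := mem_V_iff.mp hgV
    have hgk : (g : GLn n ⧸ D.T) = k • eta D.T (X : Mat n) := smul_eta_eq_iff.mpr ⟨t, ht, h⟩
    rw [hgk, hU.phiAt_eq hP hF hFc hw hk hX, eq_comm, smul_eta_eq_iff] at hgy
    obtain ⟨t', ht', hy'⟩ := hgy
    have hdec : IsDecomp Bc P U w g y k X ⟨t, ht⟩ ⟨t', ht'⟩ := ⟨hk, hX, h, hy'⟩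
    rw [hU.lineIsoCoord_eq hP hF hFc hw χ hdec]
    refine ⟨Circle.coe_ne_zero _, fun z => hU.lineIso_eq hP hF hFc hw χ hdec z, fun s hs z => ?_⟩
    refine hU.lineIso_eq hP hF hFc hw χ (g := s * g) (y := s * y) (k := s * k) (X := X)
      ⟨mul_mem (T_le_NK hs) hk, hX, ?_, ?_⟩ z
    · rw [h]
      simp only [mul_assoc]
    · rw [hy']
      simp only [mul_assoc]
  · rintro ⟨g, y⟩ ⟨⟨hg, hgV⟩, hy, hgy⟩
    simp only at hg hgV hy hgy
    obtain ⟨k, hk, X, hX, t, ht, h⟩ := mem_V_iff.mp hgV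
    have hgk : (g : GLn n ⧸ D.T) = k • eta D.T (X : Mat n) := smul_eta_eq_iff.mpr ⟨t, ht, h⟩
    rw [hgk, hU.phiAt_eq hP hF hFc hw hk hX, eq_comm, smul_eta_eq_iff] at hgy
    obtain ⟨t', ht', hy'⟩ := hgy
    have hkw := mul_mem (NK_le_NGc hk) hw
    obtain ⟨N, x, ζ, hN, hgN, hx, hζ, hxU, hdec⟩ :=
      cG.local_decomp D.T_le_G hU.isOpen hU.subset (NK_le_G hk) hX ht
    obtain ⟨N', x', ζ', hN', hgN', hx', hζ', hxU', hdec'⟩ := cC.local_decomp D.T_le_Gc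
      (hU.isOpen_psi_image hP hF hFc hw) (hU.psi_image_subset hw) (NGc_le_Gc hkw)
      (Set.mem_image_of_mem _ hX) ht'
    rw [← h] at hgN
    rw [← hy'] at hgN'
    have hχs := (contDiff_char_expGL (continuous_twistChar hχ hw.2)).comp_contDiffOn hζ
    have hχs' := (contDiff_char_expGL hχ).comp_contDiffOn hζ'
    refine ⟨N ×ˢ N', hN.prod hN', ⟨hgN, hgN'⟩, fun a =>
      ((χ' ⟨expGL (ζ a.1 : Mat n), expGL_mem D.isClosed_T (ζ a.1).2⟩ : ℂ) * (χ' ⟨t, ht⟩ : ℂ))⁻¹ *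
      ((χ ⟨expGL (ζ' a.2 : Mat n), expGL_mem D.isClosed_T (ζ' a.2).2⟩ : ℂ) * (χ ⟨t', ht'⟩ : ℂ)),
      ?_, ?_⟩
    · have h1 := hχs.comp contDiff_fst.contDiffOn (s := N ×ˢ N') (fun p hp => hp.1)
      have h2 := hχs'.comp contDiff_snd.contDiffOn (s := N ×ˢ N') (fun p hp => hp.2)
      refine ContDiffOn.mul (ContDiffOn.inv (h1.mul contDiffOn_const) fun p _ => ?_)
        (h2.mul contDiffOn_const)
      exact mul_ne_zero (Circle.coe_ne_zero _) (Circle.coe_ne_zero _)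
    · rintro ⟨a, b⟩ ⟨⟨ha, haV⟩, hb, hab⟩ ⟨haN, hbN⟩
      simp only at ha haV hb hab haN hbN
      have e1 := hdec a ha haN
      have e2 := hdec' b hb hbN
      have hak : (a : GLn n ⧸ D.T) = k • eta D.T (x a : Mat n) :=
        smul_eta_eq_iff.mpr ⟨_, mul_mem (expGL_mem D.isClosed_T (ζ a).2) ht, e1⟩
      have hbk : (b : GLn n ⧸ D.T) = (k * w) • eta D.T (x' b : Mat n) :=
        smul_eta_eq_iff.mpr ⟨_, mul_mem (expGL_mem D.isClosed_T (ζ' b).2) ht', e2⟩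
      rw [hak, hU.phiAt_eq hP hF hFc hw hk (hxU _ haN), hbk] at hab
      have e3 := cC.eq_of_smul_eta_eq (hU.psi_mem w hw _ (hxU _ haN))
        (hU.psi_image_subset hw (hxU' _ hbN)) hab
      have hd : IsDecomp Bc P U w a b k (x a)
          (⟨_, expGL_mem D.isClosed_T (ζ a).2⟩ * ⟨t, ht⟩)
          (⟨_, expGL_mem D.isClosed_T (ζ' b).2⟩ * ⟨t', ht'⟩) :=
        ⟨hk, hxU _ haN, e1, by rw [e3]; exact e2⟩
      rw [hU.lineIsoCoord_eq hP hF hFc hw χ hd, transition, map_mul, map_mul, Circle.coe_mul,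
        Circle.coe_inv, Circle.coe_mul, Circle.coe_mul]

end

end InnerFormData
end ShelstadGeometry

namespace ShelstadGeometry
open Filter

/-! ### Homotopies of linear complex structures -/

section conjStr
variable {E : Type*} [NormedAddCommGroup E] [NormedSpace ℝ E]

/-- The continuous endomorphisms of a normed space. -/
abbrev EndC (E : Type*) [NormedAddCommGroup E] [NormedSpace ℝ E] : Type _ := E →L[ℝ] E

/-- The segment `(1 - s) + s a` from the identity to `a`. -/
noncomputable def segOp (a : EndC E) (s : ℝ) : EndC E := 1 - s • (1 - a)

/-- The conjugate of `J` under `(1 - s) + s a`. -/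
noncomputable def conjStr (J a : EndC E) (s : ℝ) : EndC E :=
  Ring.inverse (segOp a s) * J * segOp a s

theorem norm_smul_one_sub_lt {a : EndC E} (ha : ‖a - 1‖ < 1) {s : ℝ}
    (hs : s ∈ Set.Icc (0 : ℝ) 1) : ‖s • (1 - a)‖ < 1 := by
  rw [norm_smul, norm_sub_rev, Real.norm_of_nonneg hs.1]
  exact (mul_le_of_le_one_left (norm_nonneg _) hs.2).trans_lt ha

theorem isUnit_segOp [CompleteSpace E] {a : EndC E} {s : ℝ} (h : ‖s • (1 - a)‖ < 1) :
    IsUnit (segOp a s) := isUnit_one_sub_of_norm_lt_one h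

theorem segOp_mul_conjStr (J : EndC E) {a : EndC E} {s : ℝ} (h : IsUnit (segOp a s)) :
    segOp a s * conjStr J a s = J * segOp a s := by
  rw [conjStr, mul_assoc, ← mul_assoc, Ring.mul_inverse_cancel _ h, one_mul]

theorem segOp_injective {a : EndC E} {s : ℝ} (h : IsUnit (segOp a s)) :
    Function.Injective (segOp a s) := by
  intro x y hxy
  have h1 := congrArg (Ring.inverse (segOp a s) : EndC E) hxy
  have h2 : ∀ z, (Ring.inverse (segOp a s) : EndC E) (segOp a s z) = z := fun z =>
    congrArg (fun b : EndC E => b z) (Ring.inverse_mul_cancel _ h)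
  rwa [h2, h2] at h1

theorem conjStr_conjStr {J a : EndC E} {s : ℝ} (h : IsUnit (segOp a s))
    (hJ : ∀ x, J (J x) = -x) (x : E) : conjStr J a s (conjStr J a s x) = -x := by
  have h1 : ∀ y, segOp a s (conjStr J a s y) = J (segOp a s y) := fun y =>
    congrArg (fun b : EndC E => b y) (segOp_mul_conjStr J h)
  apply segOp_injective h
  rw [h1, h1, hJ, map_neg]

theorem segOp_zero (a : EndC E) : segOp a 0 = 1 := by rw [segOp, zero_smul, sub_zero]

theorem segOp_one (a : EndC E) : segOp a 1 = a := by rw [segOp, one_smul, sub_sub_cancel]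

theorem conjStr_zero (J a : EndC E) : conjStr J a 0 = J := by
  rw [conjStr, segOp_zero, Ring.inverse_one, one_mul, mul_one]

theorem contDiffOn_conjStr [CompleteSpace E] {F : Type*} [NormedAddCommGroup F] [NormedSpace ℝ F]
    (J : EndC E) {b : F → ℝ} {a : F → EndC E} {O : Set F} (hb : ContDiffOn ℝ ∞ b O)
    (ha : ContDiffOn ℝ ∞ a O) (h : ∀ x ∈ O, ‖b x • (1 - a x)‖ < 1) :
    ContDiffOn ℝ ∞ (fun x => conjStr J (a x) (b x)) O := by
  have h1 : ContDiffOn ℝ ∞ (fun x => segOp (a x) (b x)) O :=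
    contDiffOn_const.sub (hb.smul (contDiffOn_const.sub ha))
  have h2 : ContDiffOn ℝ ∞ (fun x => Ring.inverse (segOp (a x) (b x))) O := fun x hx => by
    obtain ⟨u, hu⟩ := isUnit_segOp (h x hx)
    have h3 := contDiffAt_ringInverse (n := ∞) ℝ u
    rw [hu] at h3
    exact h3.comp_contDiffWithinAt x (h1 x hx)
  exact (h2.mul contDiffOn_const).mul h1

/-- The composition of the partial derivative of `f` at `(x, 0)`, with respect to the second
variable, with a linear map. -/
noncomputable def partialOp {F : Type*} [NormedAddCommGroup F] [NormedSpace ℝ F] (f : E × E → F)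
    (l : F →L[ℝ] E) (x : E) : EndC E :=
  l ∘L fderiv ℝ f (x, 0) ∘L ContinuousLinearMap.inr ℝ E E

theorem contDiffOn_partialOp {F : Type*} [NormedAddCommGroup F] [NormedSpace ℝ F] {f : E × E → F}
    {W : Set (E × E)} (hW : IsOpen W) (hf : ContDiffOn ℝ ∞ f W) (l : F →L[ℝ] E) {O : Set E}
    (hO : ∀ x ∈ O, (x, (0 : E)) ∈ W) : ContDiffOn ℝ ∞ (partialOp f l) O := by
  have h := hf.fderiv_of_isOpen (m := ∞) hW le_rfl
  have h2 : ContDiffOn ℝ ∞ (fun x : E => fderiv ℝ f (x, 0)) O :=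
    h.comp (contDiff_prodMk_left (0 : E)).contDiffOn hO
  exact contDiffOn_const.clm_comp (h2.clm_comp contDiffOn_const)

theorem hasDerivAt_partial {F : Type*} [NormedAddCommGroup F] [NormedSpace ℝ F] {f : E × E → F}
    {W : Set (E × E)} (hW : IsOpen W) (hf : ContDiffOn ℝ ∞ f W) {x : E} (hx : (x, (0 : E)) ∈ W)
    (v : E) : HasDerivAt (fun s : ℝ => f (x, s • v)) (fderiv ℝ f (x, 0) (0, v)) 0 := by
  have h1 : DifferentiableAt ℝ f (x, (0 : ℝ) • v) := by
    rw [zero_smul]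
    exact (hf.contDiffAt (hW.mem_nhds hx)).differentiableAt (by simp)
  have h2 : HasDerivAt (fun s : ℝ => (x, s • v)) ((0 : E), v) 0 := by
    have h := (hasDerivAt_id (0 : ℝ)).smul_const v
    rw [one_smul] at h
    exact (hasDerivAt_const (0 : ℝ) x).prodMk h
  have h3 := h1.hasFDerivAt.comp_hasDerivAt (0 : ℝ) h2
  rw [zero_smul] at h3
  exact h3

end conjStr

/-- A linear projection onto a complement `m` of `t`. -/
theorem exists_projection {n : ℕ} {m t : Submodule ℝ (Mat n)} (h : ∀ X ∈ m, X ∈ t → X = 0) :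
    ∃ p : Mat n →ₗ[ℝ] m, (∀ X : m, p X = X) ∧ ∀ Z ∈ t, p Z = 0 := by
  obtain ⟨l, hl⟩ := (t.mkQ ∘ₗ m.subtype).exists_leftInverse_of_injective
    ((LinearMap.ker_eq_bot').mpr fun X hX =>
      Subtype.ext (h X X.2 ((Submodule.Quotient.mk_eq_zero t).mp hX)))
  refine ⟨l ∘ₗ t.mkQ, fun X => congrArg (fun g : m →ₗ[ℝ] m => g X) hl, fun Z hZ => ?_⟩
  change l (t.mkQ Z) = 0
  rw [Submodule.mkQ_apply, (Submodule.Quotient.mk_eq_zero t).mpr hZ, map_zero]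

end ShelstadGeometry

namespace ShelstadGeometry
namespace InnerFormData
open Filter
variable {n : ℕ} {D : InnerFormData n}
variable {P : Set (Functional D.T)} {B Bc : Mat n →ₗ[ℝ] Mat n →ₗ[ℝ] ℝ}

/-! ### The tangent map of `φ` -/

section
variable (hP : D.IsPos P) (hF : D.IsFormWithInner D.G B) (hFc : D.IsFormWithInner D.Gc Bc)

theorem IsFormWithInner.exists_projection {H : Subgroup (GLn n)}
    (hF : D.IsFormWithInner H B) :
    ∃ p : Mat n →ₗ[ℝ] perp H D.T B, (∀ X : perp H D.T B, p X = X) ∧ ∀ Z ∈ lieAlg D.T, p Z = 0 :=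
  ShelstadGeometry.exists_projection (t := lieSub D.T) fun _ hX h => hF.eq_zero_of_mem_perp hX h

/-- The map `ψ_w` as a continuous linear isomorphism. -/
noncomputable def psiL {w : GLn n} (hw : w ∈ D.NGc) : D.tPerp B ≃L[ℝ] D.tPerpC Bc :=
  (psiEquiv hP hF hFc hw).toContinuousLinearEquiv

/-- The map `(X, V) ↦ exp(-ψ X) exp(ψ X')`, where `exp(X) exp(V) T = exp(X') T`. -/
noncomputable def displacement (cG : SliceChart D.G D.T (D.tPerp B)) {w : GLn n} (hw : w ∈ D.NGc)
    (p : D.tPerp B × D.tPerp B) : Mat n :=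
  NormedSpace.exp (-(psiL hP hF hFc hw p.1 : D.tPerpC Bc) : Mat n) *
    NormedSpace.exp ((psiL hP hF hFc hw
      (cG.f (NormedSpace.exp (p.1 : Mat n) * NormedSpace.exp (p.2 : Mat n))) : D.tPerpC Bc) : Mat n)

/-- The domain of `displacement`. -/
def displacementDomain (cG : SliceChart D.G D.T (D.tPerp B)) : Set (D.tPerp B × D.tPerp B) :=
  {p | NormedSpace.exp (p.1 : Mat n) * NormedSpace.exp (p.2 : Mat n) ∈ cG.N}

theorem contDiff_exp_mul_exp (m : Submodule ℝ (Mat n)) :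
    ContDiff ℝ ∞ fun p : m × m => NormedSpace.exp (p.1 : Mat n) * NormedSpace.exp (p.2 : Mat n) := by
  rw [← contDiffOn_univ]
  exact contDiffOn_matrix_mul ((contDiff_exp_coe m).comp contDiff_fst).contDiffOn
    ((contDiff_exp_coe m).comp contDiff_snd).contDiffOn

theorem isOpen_displacementDomain (cG : SliceChart D.G D.T (D.tPerp B)) :
    IsOpen (displacementDomain cG) :=
  cG.isOpen_N.preimage (contDiff_exp_mul_exp _).continuous

theorem mem_displacementDomain {cG : SliceChart D.G D.T (D.tPerp B)} {X : D.tPerp B}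
    (hX : X ∈ cG.O) : (X, (0 : D.tPerp B)) ∈ displacementDomain cG := by
  change NormedSpace.exp (X : Mat n) * NormedSpace.exp ((0 : D.tPerp B) : Mat n) ∈ cG.N
  rw [Submodule.coe_zero, NormedSpace.exp_zero, mul_one]
  exact cG.exp_mem X hX

theorem contDiffOn_displacement (cG : SliceChart D.G D.T (D.tPerp B)) {w : GLn n}
    (hw : w ∈ D.NGc) :
    ContDiffOn ℝ ∞ (displacement hP hF hFc cG hw) (displacementDomain cG) := by
  refine contDiffOn_matrix_mul ?_ ?_
  · exact ((contDiff_exp_coe _).comp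
      ((psiL hP hF hFc hw).contDiff.neg.comp contDiff_fst)).contDiffOn
  · exact (contDiff_exp_coe _).comp_contDiffOn ((psiL hP hF hFc hw).contDiff.comp_contDiffOn
      (cG.contDiffOn_f.comp (contDiff_exp_mul_exp _).contDiffOn fun _ h => h))

/-- The map `A_X` with `d = Ad(t'⁻¹) ∘ ψ ∘ A_X ∘ Ad(t)` for the tangent map `d` of `φ` at
`g = k exp(X) t`, in terms of the representative `y = k w exp(ψ X) t'` of the image. -/
noncomputable def tangentOp (cG : SliceChart D.G D.T (D.tPerp B)) {w : GLn n} (hw : w ∈ D.NGc)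
    (X : D.tPerp B) : EndC (D.tPerp B) :=
  partialOp (displacement hP hF hFc cG hw)
    (((psiL hP hF hFc hw).symm : D.tPerpC Bc →L[ℝ] D.tPerp B) ∘L
      LinearMap.toContinuousLinearMap (hFc.exists_projection).choose) X

theorem contDiffOn_tangentOp (cG : SliceChart D.G D.T (D.tPerp B)) {w : GLn n} (hw : w ∈ D.NGc) :
    ContDiffOn ℝ ∞ (tangentOp hP hF hFc cG hw) cG.O :=
  contDiffOn_partialOp (isOpen_displacementDomain cG) (contDiffOn_displacement hP hF hFc cG hw) _
    fun _ hX => mem_displacementDomain hX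

/-- The curve x(s) is the slice coordinate of exp(X) exp(sV). The velocity of exp(-ψX) exp(ψx(s))
lies in the Lie algebra of `Gc`, and `tangentOp` extracts its component orthogonal to 𝔱; the rest is
Z. -/
theorem exists_curve (cG : SliceChart D.G D.T (D.tPerp B)) {w : GLn n} (hw : w ∈ D.NGc)
    {X : D.tPerp B} (hX : X ∈ cG.O) (V : D.tPerp B) :
    ∃ x : ℝ → D.tPerp B, Tendsto x (𝓝 0) (𝓝 X) ∧ x 0 = X ∧
      (∀ᶠ s in 𝓝 (0 : ℝ), ∃ t ∈ D.T,
        expGL (X : Mat n) * expGL (s • (V : Mat n)) = expGL (x s : Mat n) * t) ∧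
      ∃ Z ∈ lieAlg D.T, HasDerivAt (fun s => (((expGL (D.psi B Bc P w X : Mat n))⁻¹ *
          expGL (D.psi B Bc P w (x s) : Mat n) : GLn n) : Mat n))
        ((D.psi B Bc P w (tangentOp hP hF hFc cG hw X V) : Mat n) + Z) 0 := by
  have hX0 := mem_displacementDomain hX
  have hW := isOpen_displacementDomain cG
  have hd := hasDerivAt_partial hW (contDiffOn_displacement hP hF hFc cG hw) hX0 V
  have hcs : Continuous fun s : ℝ => (X, s • V) :=
    continuous_const.prodMk (continuous_id.smul continuous_const)
  have hc0 : Tendsto (fun s : ℝ => (X, s • V)) (𝓝 0) (𝓝 (X, 0)) :=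
    hcs.tendsto' 0 _ (by rw [zero_smul])
  have hfX : cG.f (NormedSpace.exp (X : Mat n) * NormedSpace.exp ((0 : D.tPerp B) : Mat n)) = X := by
    rw [Submodule.coe_zero, NormedSpace.exp_zero, mul_one, cG.f_exp X hX]
  have hfc : ContinuousAt (fun p : D.tPerp B × D.tPerp B =>
      cG.f (NormedSpace.exp (p.1 : Mat n) * NormedSpace.exp (p.2 : Mat n))) (X, 0) :=
    ((cG.contDiffOn_f.comp (contDiff_exp_mul_exp _).contDiffOn fun _ h => h).continuousOn
      (s := displacementDomain cG)).continuousAt (hW.mem_nhds hX0)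
  let x : ℝ → D.tPerp B := fun s =>
    cG.f (NormedSpace.exp (X : Mat n) * NormedSpace.exp ((s • V : D.tPerp B) : Mat n))
  have hx0 : x 0 = X := by
    simp only [x, zero_smul]
    exact hfX
  have hxt : Tendsto x (𝓝 0) (𝓝 X) := by
    have h := hfc.tendsto.comp hc0
    simp only [hfX] at h
    exact h
  set τ : ℝ → GLn n := fun s => (expGL (D.psi B Bc P w X : Mat n))⁻¹ *
    expGL (D.psi B Bc P w (x s) : Mat n) with hτ
  have hτd : ∀ s, (τ s : Mat n) = displacement hP hF hFc cG hw (X, s • V) := fun s => by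
    rw [hτ, ← expGL_neg]
    rfl
  have hτ0 : τ 0 = 1 := by
    simp only [hτ, hx0, inv_mul_cancel]
  have hder : HasDerivAt (fun s => (τ s : Mat n))
      (fderiv ℝ (displacement hP hF hFc cG hw) (X, 0) (0, V)) 0 := by
    simp only [hτd]
    exact hd
  have hθ := mem_lieAlg_of_hasDerivAt D.isClosed_Gc hτ0 hder (Eventually.of_forall fun s =>
    mul_mem (inv_mem (expGL_mem D.isClosed_Gc (D.psi B Bc P w X).2.1))
      (expGL_mem D.isClosed_Gc (D.psi B Bc P w (x s)).2.1))
  obtain ⟨Y, hY, hZ⟩ := hFc.exists_perp hP hθ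
  refine ⟨x, hxt, hx0, ?_, _, hZ, ?_⟩
  · filter_upwards [hc0.eventually (hW.mem_nhds hX0)] with s hs
    refine ⟨_, expGL_mem D.isClosed_T (cG.z (NormedSpace.exp (X : Mat n) *
      NormedSpace.exp ((s • V : D.tPerp B) : Mat n))).2, ?_⟩
    refine cG.eq_mul (expGL (X : Mat n) * expGL ((s • V : D.tPerp B) : Mat n)) ?_ hs
    exact mul_mem (expGL_mem D.isClosed_G X.2.1) (expGL_mem D.isClosed_G (s • V).2.1)
  · have hp := hFc.exists_projection.choose_spec
    have h1 : D.psi B Bc P w (tangentOp hP hF hFc cG hw X V) = ⟨Y, hY⟩ := by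
      have h2 : D.psi B Bc P w (tangentOp hP hF hFc cG hw X V) = hFc.exists_projection.choose
          (fderiv ℝ (displacement hP hF hFc cG hw) (X, 0) (0, V)) :=
        (psiL hP hF hFc hw).apply_symm_apply _
      rw [h2, ← hp.1 ⟨Y, hY⟩, ← sub_eq_zero, ← map_sub]
      exact hp.2 _ hZ
    rw [h1, add_sub_cancel]
    exact hder

end

end InnerFormData
end ShelstadGeometry

/-! ### Properties of the operators A_X and the tangent map of φ -/

namespace ShelstadGeometry
namespace InnerFormData
open Filter
variable {n : ℕ} {D : InnerFormData n}
variable {P : Set (Functional D.T)} {B Bc : Mat n →ₗ[ℝ] Mat n →ₗ[ℝ] ℝ}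

theorem hasDerivAt_mul_mul {c : ℝ → Mat n} {v : Mat n} {s : ℝ} (hc : HasDerivAt c v s)
    (a b : Mat n) : HasDerivAt (fun r => a * c r * b) (a * v * b) s := by
  have h1 := hasDerivAt_matrix_mul (hasDerivAt_matrix_mul (hasDerivAt_const s a) hc)
    (hasDerivAt_const s b)
  refine h1.congr_deriv ?_
  rw [zero_mul, zero_add, mul_zero, add_zero]

section
variable (hP : D.IsPos P) (hF : D.IsFormWithInner D.G B) (hFc : D.IsFormWithInner D.Gc Bc)

theorem IsFormWithInner.eq_of_add_eq_add {H : Subgroup (GLn n)} (hF : D.IsFormWithInner H B)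
    {Y Y' : perp H D.T B} {Z Z' : Mat n} (hZ : Z ∈ lieAlg D.T) (hZ' : Z' ∈ lieAlg D.T)
    (h : (Y : Mat n) + Z = Y' + Z') : Y = Y' := by
  have h1 : (Y : Mat n) - Y' = Z' - Z := by
    rw [sub_eq_sub_iff_add_eq_add, h]
    exact add_comm _ _
  refine sub_eq_zero.mp (Subtype.ext (hF.eq_zero_of_mem_perp (Y - Y').2 ?_))
  rw [Submodule.coe_sub, h1]
  exact (lieAlg D.T).sub_mem hZ' hZ

theorem eventually_eq_of_expGL_mul {cG : SliceChart D.G D.T (D.tPerp B)} {x x' : ℝ → D.tPerp B}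
    {X : D.tPerp B} (hX : X ∈ cG.O) (hx : Tendsto x (𝓝 0) (𝓝 X)) (hx' : Tendsto x' (𝓝 0) (𝓝 X))
    (h : ∀ᶠ s in 𝓝 (0 : ℝ), ∃ t ∈ D.T, expGL (x s : Mat n) = expGL (x' s : Mat n) * t) :
    ∀ᶠ s in 𝓝 (0 : ℝ), x s = x' s := by
  filter_upwards [hx.eventually (cG.isOpen_O.mem_nhds hX),
    hx'.eventually (cG.isOpen_O.mem_nhds hX), h] with s h1 h2 ⟨t, ht, h3⟩
  exact cG.inj _ h1 _ h2 t ht h3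

/-- At X = 0 the slice coordinate of exp(sV) is sV itself, so the velocity is ψV. -/
theorem tangentOp_zero (cG : SliceChart D.G D.T (D.tPerp B)) {w : GLn n} (hw : w ∈ D.NGc) :
    tangentOp hP hF hFc cG hw 0 = 1 := by
  ext1 V
  obtain ⟨x, hx, hx0, hxt, Z, hZ, hd⟩ := exists_curve hP hF hFc cG hw cG.zero_mem V
  have hsV : Tendsto (fun s : ℝ => s • V) (𝓝 0) (𝓝 0) :=
    (continuous_id.smul continuous_const).tendsto' (0 : ℝ) (0 : D.tPerp B) (zero_smul ℝ V)
  have h1 : ∀ᶠ s in 𝓝 (0 : ℝ), s • V = x s := by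
    refine eventually_eq_of_expGL_mul cG.zero_mem hsV hx ?_
    filter_upwards [hxt] with s ⟨t, ht, h⟩
    refine ⟨t, ht, ?_⟩
    rw [Submodule.coe_zero, expGL_zero, one_mul] at h
    exact h
  have h2 := hasDerivAt_coe_expGL_smul (D.psi B Bc P w V : Mat n)
  have h3 : HasDerivAt (fun s : ℝ => (expGL (s • (D.psi B Bc P w V : Mat n)) : Mat n))
      ((D.psi B Bc P w (tangentOp hP hF hFc cG hw 0 V) : Mat n) + Z) 0 := by
    refine hd.congr_of_eventuallyEq ?_
    filter_upwards [h1] with s hs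
    rw [← hs, psi_zero hP hF hFc hw, Submodule.coe_zero, expGL_zero, inv_one, one_mul,
      psi_smul hP hF hFc hw]
    rfl
  have h4 := hFc.eq_of_add_eq_add hZ (lieAlg D.T).zero_mem ((h3.unique h2).trans (add_zero _).symm)
  exact (psiEquiv hP hF hFc hw).injective h4

/-- Conjugation by t carries the defining curve for (X, V) to the one for (X', V'), by uniqueness of
slice coordinates; comparing velocities orthogonal to 𝔱 gives the claim. -/
theorem tangentOp_Ad (cG : SliceChart D.G D.T (D.tPerp B)) {w : GLn n} (hw : w ∈ D.NGc)
    {t : GLn n} (ht : t ∈ D.T) {X X' V V' : D.tPerp B} (hX : X ∈ cG.O) (hX' : X' ∈ cG.O)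
    (hXX' : (X' : Mat n) = Ad t X) (hVV' : (V' : Mat n) = Ad t V) :
    (tangentOp hP hF hFc cG hw X' V' : Mat n) = Ad t (tangentOp hP hF hFc cG hw X V) := by
  have htn := mem_normalizer_of_mem_T ht
  have htw : w⁻¹ * t * w ∈ D.T := (Subgroup.mem_normalizer_iff''.mp hw.2 t).mp ht
  set a := AdPerp hP hF (D.T_le_G ht) htn with ha
  have hac : Continuous a := a.continuous_of_finiteDimensional
  have haX : a X = X' := Subtype.ext hXX'.symm
  obtain ⟨x, hx, hx0, hxt, Z, hZ, hd⟩ := exists_curve hP hF hFc cG hw hX V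
  obtain ⟨x', hx', hx0', hxt', Z', hZ', hd'⟩ := exists_curve hP hF hFc cG hw hX' V'
  have h1 : ∀ᶠ s in 𝓝 (0 : ℝ), x' s = a (x s) := by
    refine eventually_eq_of_expGL_mul hX' hx' (haX ▸ (hac.tendsto X).comp hx) ?_
    filter_upwards [hxt, hxt'] with s ⟨r, hr, h⟩ ⟨r', hr', h'⟩
    refine ⟨t * r * t⁻¹ * r'⁻¹, mul_mem (mul_mem (mul_mem ht hr) (inv_mem ht)) (inv_mem hr'), ?_⟩
    change _ = expGL (Ad t (x s : Mat n)) * _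
    have h2 : expGL (X' : Mat n) * expGL (s • (V' : Mat n)) =
        t * (expGL (X : Mat n) * expGL (s • (V : Mat n))) * t⁻¹ := by
      rw [hXX', hVV', ← Ad_rsmul, expGL_Ad, expGL_Ad]
      group
    rw [h2, h] at h'
    rw [eq_mul_inv_of_mul_eq h'.symm, expGL_Ad]
    group
  have h2 : HasDerivAt (fun s => (((expGL (D.psi B Bc P w X' : Mat n))⁻¹ *
      expGL (D.psi B Bc P w (x' s) : Mat n) : GLn n) : Mat n)) (Ad (w⁻¹ * t * w)
        ((D.psi B Bc P w (tangentOp hP hF hFc cG hw X V) : Mat n) + Z)) 0 := by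
    refine (hasDerivAt_mul_mul hd ((w⁻¹ * t * w : GLn n) : Mat n)
      (((w⁻¹ * t * w)⁻¹ : GLn n) : Mat n)).congr_of_eventuallyEq ?_
    filter_upwards [h1] with s hs
    rw [← Units.val_mul, ← Units.val_mul, psi_Ad hP hF hFc hw ht hXX', hs,
      psi_Ad hP hF hFc hw ht (X := x s) (X' := a (x s)) rfl, expGL_Ad, expGL_Ad]
    congr 1
    group
  have h3 := h2.unique hd'
  rw [Ad_add, ← psi_Ad hP hF hFc hw ht (X' := a (tangentOp hP hF hFc cG hw X V)) rfl] at h3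
  have h4 := hFc.eq_of_add_eq_add (Ad_mem_T (mem_normalizer_of_mem_T htw) hZ) hZ' h3
  exact (congrArg Subtype.val ((psiEquiv hP hF hFc hw).injective h4)).symm

/-- This is continuity of A_X at A_0 = 1; the bound keeps the whole segment from 1 to A_X
invertible. -/
theorem eventually_norm_tangentOp_sub_one_lt (cG : SliceChart D.G D.T (D.tPerp B)) {w : GLn n}
    (hw : w ∈ D.NGc) : ∀ᶠ X : D.tPerp B in 𝓝 0, ‖tangentOp hP hF hFc cG hw X - 1‖ < 1 := by
  have h := (contDiffOn_tangentOp hP hF hFc cG hw).continuousOn.continuousAt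
    (cG.isOpen_O.mem_nhds cG.zero_mem)
  have h1 : ContinuousAt (fun X => ‖tangentOp hP hF hFc cG hw X - 1‖) 0 :=
    (h.sub continuousAt_const).norm
  refine h1.eventually (gt_mem_nhds ?_)
  simp only [tangentOp_zero, sub_self, norm_zero, zero_lt_one]

/-- The tangent map of `φ` at `g = k exp(X) t`, for the representative `y = k w exp(ψ X) t'`. -/
noncomputable def tangentMap (cG : SliceChart D.G D.T (D.tPerp B)) {w : GLn n} (hw : w ∈ D.NGc)
    (X : D.tPerp B) {t t' : GLn n} (ht : t ∈ D.T) (ht' : t' ∈ D.T) : D.tPerp B →ₗ[ℝ] D.tPerpC Bc :=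
  AdPerp hP hFc (D.T_le_Gc (inv_mem ht')) (mem_normalizer_of_mem_T (inv_mem ht')) ∘ₗ
    (psiEquiv hP hF hFc hw).toLinearMap ∘ₗ
    (tangentOp hP hF hFc cG hw X : D.tPerp B →ₗ[ℝ] D.tPerp B) ∘ₗ
    AdPerp hP hF (D.T_le_G ht) (mem_normalizer_of_mem_T ht)

/-- Moving t past exp(sV) replaces V by Ad(t)V, and then k w exp(ψx(s)) t' lifts the image curve.
Taking t' out on the right contributes Ad(t'⁻¹). -/
theorem IsFine.hasTangentMap {cG : SliceChart D.G D.T (D.tPerp B)}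
    {cC : SliceChart D.Gc D.T (D.tPerpC Bc)} {U : Set (D.tPerp B)} (hU : IsFine cG cC P U)
    {w : GLn n} (hw : w ∈ D.NGc) {k : GLn n} (hk : k ∈ D.NK) {X : D.tPerp B} (hX : X ∈ U)
    {t t' : GLn n} (ht : t ∈ D.T) (ht' : t' ∈ D.T) :
    D.HasTangentMap (phiAt Bc P U w) (k * expGL (X : Mat n) * t)
      (k * w * expGL (D.psi B Bc P w X : Mat n) * t') (tangentMap hP hF hFc cG hw X ht ht') := by
  intro V
  set V₁ := AdPerp hP hF (D.T_le_G ht) (mem_normalizer_of_mem_T ht) V with hV₁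
  obtain ⟨x, hx, hx0, hxt, Z, hZ, hd⟩ := exists_curve hP hF hFc cG hw (hU.subset hX) V₁
  refine ⟨fun s => k * w * expGL (D.psi B Bc P w (x s) : Mat n) * t', ?_, ?_, Ad t'⁻¹ Z,
    Ad_mem_T (mem_normalizer_of_mem_T (inv_mem ht')) hZ, ?_⟩
  · simp only [hx0]
  · filter_upwards [hxt, hx.eventually (hU.isOpen.mem_nhds hX)] with s ⟨r, hr, h⟩ hxU
    refine ⟨mul_mem (mul_mem (NGc_le_Gc (mul_mem (NK_le_NGc hk) hw))
      (expGL_mem D.isClosed_Gc (D.psi B Bc P w (x s)).2.1)) (D.T_le_Gc ht'), ?_⟩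
    have h1 : ((k * expGL (X : Mat n) * t * expGL (s • (V : Mat n)) : GLn n) : GLn n ⧸ D.T) =
        k • eta D.T (x s : Mat n) := by
      refine smul_eta_eq_iff.mpr ⟨r * t, mul_mem hr ht, ?_⟩
      have h2 : expGL (s • (V₁ : Mat n)) = t * expGL (s • (V : Mat n)) * t⁻¹ := by
        rw [hV₁, coe_AdPerp, ← Ad_rsmul, expGL_Ad]
      have h3 : k * expGL (X : Mat n) * t * expGL (s • (V : Mat n)) =
          k * (expGL (X : Mat n) * (t * expGL (s • (V : Mat n)) * t⁻¹)) * t := by group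
      rw [h3, ← h2, h]
      group
    rw [h1, hU.phiAt_eq hP hF hFc hw hk hxU]
    exact (smul_eta_eq_iff.mpr ⟨t', ht', rfl⟩).symm
  · refine ((hasDerivAt_mul_mul hd ((k * w * expGL (D.psi B Bc P w X : Mat n) : GLn n) : Mat n)
      (t' : Mat n)).congr_of_eventuallyEq (Eventually.of_forall fun s => ?_)).congr_deriv ?_
    · simp only
      rw [← Units.val_mul, ← Units.val_mul]
      congr 1
      group
    · have h1 : (tangentMap hP hF hFc cG hw X ht ht' V : Mat n) =
          Ad t'⁻¹ (D.psi B Bc P w (tangentOp hP hF hFc cG hw X V₁) : Mat n) := rfl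
      rw [h1, ← Ad_add]
      generalize (D.psi B Bc P w (tangentOp hP hF hFc cG hw X V₁) : Mat n) + Z = Y
      simp only [Ad, Units.val_mul, mul_assoc, inv_inv]
      simp only [← mul_assoc, Units.mul_inv_cancel_right]

end

end InnerFormData
end ShelstadGeometry

namespace ShelstadGeometry
namespace InnerFormData
open Filter
variable {n : ℕ} {D : InnerFormData n}
variable {P : Set (Functional D.T)} {B Bc : Mat n →ₗ[ℝ] Mat n →ₗ[ℝ] ℝ}

/-! ### The homotopy of almost complex structures -/

/-- The relation `J = Ad(t)⁻¹ C_X Ad(t)`, for a decomposition `g = k exp(X) t`. -/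
def IsConjAt (U : Set (D.tPerp B)) (C : D.tPerp B → D.tPerp B → D.tPerp B) (g : GLn n)
    (J : Module.End ℝ (D.tPerp B)) : Prop :=
  ∃ k ∈ D.NK, ∃ X ∈ U, ∃ t ∈ D.T, g = k * expGL (X : Mat n) * t ∧
    ∀ V V' : D.tPerp B, (V' : Mat n) = Ad t V → (C X V' : Mat n) = Ad t (J V)

open Classical in
/-- The endomorphism `Ad(t)⁻¹ C_X Ad(t)`, for `g = k exp(X) t`. -/
noncomputable def conjAt (U : Set (D.tPerp B)) (C : D.tPerp B → D.tPerp B → D.tPerp B)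
    (g : GLn n) : Module.End ℝ (D.tPerp B) :=
  if h : ∃ J, IsConjAt U C g J then h.choose else 0

section
variable (hP : D.IsPos P) (hF : D.IsFormWithInner D.G B) (hFc : D.IsFormWithInner D.Gc Bc)
  {cG : SliceChart D.G D.T (D.tPerp B)} {cC : SliceChart D.Gc D.T (D.tPerpC Bc)}
  {U : Set (D.tPerp B)} (hU : IsFine cG cC P U)
include hP hF hU

/-- Two decompositions of one element are related by s ∈ T with k = k's, X' = Ad(s)X and t = s⁻¹t'.
Equivariance of C makes Ad(t)⁻¹C_X Ad(t) the same for both. -/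
theorem IsFine.conjAt_spec {C : D.tPerp B → EndC (D.tPerp B)}
    (hC : ∀ t ∈ D.T, ∀ X ∈ U, ∀ X' ∈ U, ∀ V V' : D.tPerp B, (X' : Mat n) = Ad t X →
      (V' : Mat n) = Ad t V → (C X' V' : Mat n) = Ad t (C X V))
    {k : GLn n} (hk : k ∈ D.NK) {X : D.tPerp B} (hX : X ∈ U) {t : GLn n} (ht : t ∈ D.T)
    {V V' : D.tPerp B} (hV : (V' : Mat n) = Ad t V) :
    (C X V' : Mat n) =
      Ad t (conjAt U (fun X => C X) (k * expGL (X : Mat n) * t) V) := by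
  have hn : ∀ {r}, r ∈ D.T → r ∈ Subgroup.normalizer (D.T : Set (GLn n)) := mem_normalizer_of_mem_T
  have h : ∃ J, IsConjAt U (fun X => C X) (k * expGL (X : Mat n) * t) J := by
    refine ⟨AdPerp hP hF (D.T_le_G (inv_mem ht)) (hn (inv_mem ht)) ∘ₗ
      (C X : D.tPerp B →ₗ[ℝ] D.tPerp B) ∘ₗ AdPerp hP hF (D.T_le_G ht) (hn ht),
      k, hk, X, hX, t, ht, rfl, fun V V' hV => ?_⟩
    have h1 : V' = AdPerp hP hF (D.T_le_G ht) (hn ht) V := Subtype.ext hV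
    rw [h1]
    exact (Ad_Ad_inv t _).symm
  rw [conjAt, dif_pos h]
  obtain ⟨k', hk', X', hX', t', ht', he, hJ⟩ := h.choose_spec
  generalize h.choose = J at hJ
  have h1 : k' • eta D.T (X' : Mat n) = k • eta D.T (X : Mat n) :=
    (smul_eta_eq_iff.mpr ⟨t', ht', he⟩).symm.trans (smul_eta_eq_iff.mpr ⟨t, ht, rfl⟩)
  obtain ⟨s, hs, rfl, hXX'⟩ := hU.exists_eq hP hF hk' hk hX' hX h1
  have hts : t = s⁻¹ * t' := by
    rw [hXX', expGL_Ad] at he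
    have h2 : k' * (s * expGL (X : Mat n) * s⁻¹) * t' =
      k' * s * expGL (X : Mat n) * (s⁻¹ * t') := by group
    rw [h2] at he
    exact mul_left_cancel he
  have h2 : (AdPerp hP hF (D.T_le_G hs) (hn hs) V' : Mat n) = Ad t' V := by
    rw [coe_AdPerp, hV, hts, Ad_mul, Ad_Ad_inv]
  have h3 := hJ V _ h2
  rw [hC s hs X hX X' hX' V' _ hXX' rfl] at h3
  rw [hts, Ad_mul, ← h3, Ad_inv_Ad]

include hFc

/-- The family of endomorphisms `A_s⁻¹ J A_s`, with `A_s = (1 - s) + s A` for `A = A_X`. -/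
noncomputable abbrev homotopyOp (cG : SliceChart D.G D.T (D.tPerp B)) {w : GLn n} (hw : w ∈ D.NGc)
    (J : EndC (D.tPerp B)) (s : ℝ) (X : D.tPerp B) : EndC (D.tPerp B) :=
  conjStr J (tangentOp hP hF hFc cG hw X) s

/-- Both J and A_X are equivariant, hence so is A_s; the identity is checked after applying the
injective operator A_s. -/
theorem IsFine.homotopyOp_Ad {w : GLn n} (hw : w ∈ D.NGc)
    (hA : ∀ X ∈ U, ‖tangentOp hP hF hFc cG hw X - 1‖ < 1) {J : EndC (D.tPerp B)}
    (hJ : ∀ t ∈ D.T, ∀ V V' : D.tPerp B, (V' : Mat n) = Ad t V → (J V' : Mat n) = Ad t (J V))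
    {s : ℝ} (hs : s ∈ Set.Icc (0 : ℝ) 1) {t : GLn n} (ht : t ∈ D.T) {X X' : D.tPerp B}
    (hX : X ∈ U) (hX' : X' ∈ U) {V V' : D.tPerp B} (hXX' : (X' : Mat n) = Ad t X)
    (hVV' : (V' : Mat n) = Ad t V) :
    (homotopyOp hP hF hFc cG hw J s X' V' : Mat n) =
      Ad t (homotopyOp hP hF hFc cG hw J s X V) := by
  have hu : ∀ X ∈ U, IsUnit (segOp (tangentOp hP hF hFc cG hw X) s) := fun X hX =>
    have := completeSpace_of_finiteDimensional (D.tPerp B)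
    isUnit_segOp (norm_smul_one_sub_lt (hA X hX) hs)
  have h1 : ∀ X ∈ U, ∀ V, segOp (tangentOp hP hF hFc cG hw X) s
      (homotopyOp hP hF hFc cG hw J s X V) = J (segOp (tangentOp hP hF hFc cG hw X) s V) :=
    fun X hX V => congrArg (fun b : EndC (D.tPerp B) => b V) (segOp_mul_conjStr J (hu X hX))
  have h2 : ∀ V V' : D.tPerp B, (V' : Mat n) = Ad t V →
      (segOp (tangentOp hP hF hFc cG hw X') s V' : Mat n) =
        Ad t (segOp (tangentOp hP hF hFc cG hw X) s V) := by
    intro V V' h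
    have h3 : ∀ (a : EndC (D.tPerp B)) (V : D.tPerp B),
        (segOp a s V : Mat n) = V - s • (V - (a V : Mat n)) := fun a V => rfl
    rw [h3, h3, tangentOp_Ad hP hF hFc cG hw ht (hU.subset hX) (hU.subset hX') hXX' h, h, Ad_sub,
      Ad_rsmul, Ad_sub]
  set a := AdPerp hP hF (D.T_le_G ht) (mem_normalizer_of_mem_T ht) with ha
  have h3 : homotopyOp hP hF hFc cG hw J s X' V' = a (homotopyOp hP hF hFc cG hw J s X V) := by
    apply segOp_injective (hu X' hX')
    rw [h1 X' hX']
    apply Subtype.ext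
    rw [h2 (homotopyOp hP hF hFc cG hw J s X V) _ rfl, h1 X hX]
    exact hJ t ht _ _ (h2 V V' hVV')
  rw [h3]
  rfl

/-- At s = 0 the conjugating operator is the identity, which gives J. At s = 1 it is A_X, and the
tangent map Ad(t'⁻¹) ψ_w A_X Ad(t) intertwines the conjugated structure with that of Gc/T, as ψ_w
and the actions of `T` are complex linear. -/
theorem IsFine.holomorphicUpToHomotopy {w : GLn n} (hw : w ∈ D.NGc)
    (hA : ∀ X ∈ U, ‖tangentOp hP hF hFc cG hw X - 1‖ < 1) :
    D.HolomorphicUpToHomotopy B Bc (D.twistRoots w P) P (D.V U) (phiAt Bc P U w) := by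
  have hcs := completeSpace_of_finiteDimensional (D.tPerp B)
  have hn : ∀ {r}, r ∈ D.T → r ∈ Subgroup.normalizer (D.T : Set (GLn n)) := mem_normalizer_of_mem_T
  have hS : D.IsPos (D.twistRoots w P) := hP.twistRoots (mem_GC_of_mem_NGc hw) hw.2
  set J : EndC (D.tPerp B) := LinearMap.toContinuousLinearMap (cpxStr hS hF)
  have hJ : ∀ t ∈ D.T, ∀ V V' : D.tPerp B, (V' : Mat n) = Ad t V → (J V' : Mat n) = Ad t (J V) :=
    fun t ht V V' h => coe_cpxStr_Ad hS hF ht h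
  let C : ℝ → D.tPerp B → EndC (D.tPerp B) := homotopyOp hP hF hFc cG hw J
  let j : ℝ → GLn n → Module.End ℝ (D.tPerp B) := fun s => conjAt U fun X => C s X
  have hj : ∀ s ∈ Set.Icc (0 : ℝ) 1, ∀ k ∈ D.NK, ∀ X ∈ U, ∀ t ∈ D.T, ∀ V V' : D.tPerp B,
      (V' : Mat n) = Ad t V → (C s X V' : Mat n) = Ad t (j s (k * expGL (X : Mat n) * t) V) :=
    fun s hs k hk X hX t ht V V' hV => hU.conjAt_spec hP hF
      (fun t ht X hX X' hX' V V' h h' =>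
        hU.homotopyOp_Ad hP hF hFc hw hA hJ hs ht hX hX' h h') hk hX ht hV
  have hu : ∀ s ∈ Set.Icc (0 : ℝ) 1, ∀ X ∈ U,
      IsUnit (segOp (tangentOp hP hF hFc cG hw X) s) := fun s hs X hX =>
    isUnit_segOp (norm_smul_one_sub_lt (hA X hX) hs)
  have inj : ∀ (t : GLn n) (Y Y' : D.tPerp B), Ad t Y = Ad t Y' → Y = Y' := fun t Y Y' h =>
    Subtype.ext ((adEquiv t).injective h)
  have hjc : ∀ s ∈ Set.Icc (0 : ℝ) 1, ∀ k ∈ D.NK, ∀ X ∈ U, ∀ t, ∀ ht : t ∈ D.T, ∀ V,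
      C s X (AdPerp hP hF (D.T_le_G ht) (hn ht) V) =
        AdPerp hP hF (D.T_le_G ht) (hn ht) (j s (k * expGL (X : Mat n) * t) V) :=
    fun s hs k hk X hX t ht V => Subtype.ext (hj s hs k hk X hX t ht V _ rfl)
  refine ⟨j, ⟨?_, ?_, ?_, ?_⟩, ?_, ?_⟩
  · rintro s hs g ⟨hg, hgV⟩ V
    obtain ⟨k, hk, X, hX, t, ht, rfl⟩ := mem_V_iff.mp hgV
    apply inj t
    have h1 := hjc s hs k hk X hX t ht
    have h2 : AdPerp hP hF (D.T_le_G ht) (hn ht) (j s (k * expGL (X : Mat n) * t)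
        (j s (k * expGL (X : Mat n) * t) V)) = AdPerp hP hF (D.T_le_G ht) (hn ht) (-V) := by
      rw [← h1, ← h1, conjStr_conjStr (hu s hs X hX) (cpxStr_cpxStr hS hF), map_neg]
    exact congrArg Subtype.val h2
  · rintro s hs g ⟨hg, hgV⟩ r hr V V' hV
    obtain ⟨k, hk, X, hX, t, ht, rfl⟩ := mem_V_iff.mp hgV
    have h1 := hj s hs k hk X hX t ht V' _ (coe_AdPerp hP hF (D.T_le_G ht) (hn ht) V')
    have h2 := hj s hs k hk X hX (t * r) (mul_mem ht hr) V
      (AdPerp hP hF (D.T_le_G ht) (hn ht) V') (by rw [coe_AdPerp, hV, Ad_mul])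
    rw [h1, Ad_mul, ← mul_assoc] at h2
    exact (adEquiv t).injective h2
  · rintro s hs g ⟨hg, hgV⟩ r hr
    obtain ⟨k, hk, X, hX, t, ht, rfl⟩ := mem_V_iff.mp hgV
    ext1 V
    apply inj t
    have h1 := hj s hs k hk X hX t ht V _ (coe_AdPerp hP hF (D.T_le_G ht) (hn ht) V)
    have h2 := hj s hs (r * k) (mul_mem (T_le_NK hr) hk) X hX t ht V _
      (coe_AdPerp hP hF (D.T_le_G ht) (hn ht) V)
    rw [← h1, h2]
    simp only [mul_assoc]
  · rintro V ⟨s, g⟩ ⟨hs, hg, hgV⟩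
    obtain ⟨k, hk, X, hX, t, ht, rfl⟩ := mem_V_iff.mp hgV
    obtain ⟨N, x, ζ, hN, hgN, hx, hζ, hxU, hdec⟩ :=
      cG.local_decomp D.T_le_G hU.isOpen hU.subset (NK_le_G hk) hX ht
    -- The projection turns Ad(u)V, a smooth function with values in all matrices, into a smooth
    -- function with values in the complement.
    obtain ⟨p, hp, -⟩ := hF.exists_projection
    let u : Mat n → GLn n := fun a => expGL (ζ a : Mat n) * t
    have huT : ∀ a, u a ∈ D.T := fun a => mul_mem (expGL_mem D.isClosed_T (ζ a).2) ht
    have hus : ContDiffOn ℝ ∞ (fun a => (u a : Mat n)) N :=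
      contDiffOn_matrix_mul ((contDiff_exp_coe _).comp_contDiffOn hζ) contDiffOn_const
    have hus' : ContDiffOn ℝ ∞ (fun a => ((u a)⁻¹ : GLn n).val) N := by
      have h : (fun a => ((u a)⁻¹ : GLn n).val) =
          fun a => ((t⁻¹ * expGL ((-ζ a : lieSub D.T) : Mat n) : GLn n) : Mat n) := by
        funext a
        rw [mul_inv_rev, ← expGL_neg]
        rfl
      rw [h]
      exact contDiffOn_mul_exp _ hζ.neg
    have hAx : ContDiffOn ℝ ∞ (fun a : ℝ × Mat n => tangentOp hP hF hFc cG hw (x a.2))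
        (Set.univ ×ˢ N) :=
      ((contDiffOn_tangentOp hP hF hFc cG hw).comp hx fun a ha => hU.subset (hxU a ha)).comp
        contDiff_snd.contDiffOn fun a ha => ha.2
    have hcont : ContinuousOn
        (fun a : ℝ × Mat n => ‖a.1 • (1 - tangentOp hP hF hFc cG hw (x a.2))‖) (Set.univ ×ˢ N) :=
      (contDiff_fst.contDiffOn.smul (contDiffOn_const.sub hAx)).continuousOn.norm
    -- Smoothness is required on an open set of pairs (s, a), so s may leave [0, 1]; invertibility
    -- is secured by the open condition ‖s(1 - A)‖ < 1.
    have hO := hcont.isOpen_inter_preimage (isOpen_univ.prod hN) (isOpen_Iio (a := (1 : ℝ)))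
    set O := (Set.univ ×ˢ N) ∩ (fun a : ℝ × Mat n =>
      ‖a.1 • (1 - tangentOp hP hF hFc cG hw (x a.2))‖) ⁻¹' Set.Iio 1
    have hsub : O ⊆ Set.univ ×ˢ N := Set.inter_subset_left
    have hsnd : Set.MapsTo Prod.snd O N := fun a ha => (hsub ha).2
    have hCs : ContDiffOn ℝ ∞ (fun a : ℝ × Mat n => C a.1 (x a.2)) O :=
      contDiffOn_conjStr J contDiff_fst.contDiffOn (hAx.mono hsub) fun a ha => ha.2
    have hu2 := hus.comp contDiff_snd.contDiffOn hsnd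
    have hu2' := hus'.comp contDiff_snd.contDiffOn hsnd
    have hps : ContDiff ℝ ∞ p := (LinearMap.toContinuousLinearMap p).contDiff
    have hV : ContDiffOn ℝ ∞ (fun a : ℝ × Mat n =>
        p ((u a.2 : Mat n) * (V : Mat n) * ((u a.2)⁻¹ : GLn n).val)) O :=
      hps.comp_contDiffOn (contDiffOn_matrix_mul (contDiffOn_matrix_mul hu2 contDiffOn_const) hu2')
    refine ⟨O, hO, ⟨⟨trivial, hgN⟩, norm_smul_one_sub_lt (hA _ (hxU _ hgN)) hs⟩,
      fun a => ((u a.2)⁻¹ : GLn n).val *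
        (C a.1 (x a.2) (p ((u a.2 : Mat n) * (V : Mat n) * ((u a.2)⁻¹ : GLn n).val)) : Mat n) *
        (u a.2 : Mat n), ?_, ?_⟩
    · exact contDiffOn_matrix_mul (contDiffOn_matrix_mul hu2'
        ((D.tPerp B).subtypeL.contDiff.comp_contDiffOn (hCs.clm_apply hV))) hu2
    · rintro ⟨r, b⟩ ⟨hr, hb, hbV⟩ hbO
      have hbN := hsnd hbO
      have h1 := hj r hr k hk (x b) (hxU b hbN) (u b) (huT b) V _
        (coe_AdPerp hP hF (D.T_le_G (huT b)) (hn (huT b)) V)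
      rw [← hdec b hb hbN] at h1
      have h2 : p (Ad (u b) V) = AdPerp hP hF (D.T_le_G (huT b)) (hn (huT b)) V :=
        hp (AdPerp hP hF (D.T_le_G (huT b)) (hn (huT b)) V)
      have h3 : (j r b V : Mat n) = Ad (u b)⁻¹ (C r (x b) (p (Ad (u b) V)) : Mat n) := by
        rw [h2, h1, Ad_inv_Ad]
      simp only [h3, Ad, inv_inv]
  · rintro g ⟨hg, hgV⟩ V
    obtain ⟨k, hk, X, hX, t, ht, rfl⟩ := mem_V_iff.mp hgV
    have h0 : (0 : ℝ) ∈ Set.Icc (0 : ℝ) 1 := Set.left_mem_Icc.mpr zero_le_one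
    have h1 := hj 0 h0 k hk X hX t ht V _ (coe_AdPerp hP hF (D.T_le_G ht) (hn ht) V)
    have h2 : C 0 X = J := conjStr_zero _ _
    rw [h2, hJ t ht V _ (coe_AdPerp hP hF (D.T_le_G ht) (hn ht) V)] at h1
    rw [← inj t _ _ h1]
    exact proj_cpxStr hS hF V
  · rintro g ⟨hg, hgV⟩ y hy hgy
    obtain ⟨k, hk, X, hX, t, ht, rfl⟩ := mem_V_iff.mp hgV
    rw [smul_eta_eq_iff.mpr ⟨t, ht, rfl⟩, hU.phiAt_eq hP hF hFc hw hk hX, eq_comm,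
      smul_eta_eq_iff] at hgy
    obtain ⟨t', ht', rfl⟩ := hgy
    refine ⟨_, hU.hasTangentMap hP hF hFc hw hk hX ht ht', fun V => ?_⟩
    have h1 : (1 : ℝ) ∈ Set.Icc (0 : ℝ) 1 := Set.right_mem_Icc.mpr zero_le_one
    set V₁ := AdPerp hP hF (D.T_le_G ht) (hn ht) V with hV₁
    have h2 : tangentOp hP hF hFc cG hw X (C 1 X V₁) = J (tangentOp hP hF hFc cG hw X V₁) := by
      have h3 := congrArg (fun b : EndC (D.tPerp B) => b V₁) (segOp_mul_conjStr J (hu 1 h1 X hX))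
      simp only [segOp_one] at h3
      exact h3
    set d := tangentMap hP hF hFc cG hw X ht ht' with hd
    have h4 : d (j 1 (k * expGL (X : Mat n) * t) V) = cpxStr hP hFc (d V) := by
      have h5 : d (j 1 (k * expGL (X : Mat n) * t) V) =
          AdPerp hP hFc (D.T_le_Gc (inv_mem ht')) (hn (inv_mem ht'))
            (D.psi B Bc P w (tangentOp hP hF hFc cG hw X (C 1 X V₁))) := by
        rw [hjc 1 h1 k hk X hX t ht V]
        rfl
      rw [h5, h2]
      have h6 : D.psi B Bc P w (J (tangentOp hP hF hFc cG hw X V₁)) =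
          cpxStr hP hFc (D.psi B Bc P w (tangentOp hP hF hFc cG hw X V₁)) :=
        psi_cpxStr hP hF hFc hw hS _
      rw [h6]
      exact (Subtype.ext (coe_cpxStr_Ad hP hFc (inv_mem ht') rfl)).symm
    rw [h4, proj_cpxStr]

end

end InnerFormData
end ShelstadGeometry


theorem mainTheorem2 (n : ℕ) (D : InnerFormData n)
    (P : Set (Functional D.T)) (hP : D.IsPositiveSystem P)
    (B Bc : Mat n →ₗ[ℝ] Mat n →ₗ[ℝ] ℝ)
    (hB : IsInvariantInner D.T (lieAlg D.G) B)
    (hBc : IsInvariantInner D.T (lieAlg D.Gc) Bc)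
    (w : D.WeylCosets → D.NGc) (hw : ∀ q, D.weylClass (w q) = q) :
    ∃ O : Set (D.tPerp B), IsOpen O ∧ 0 ∈ O ∧ AdInvariant D.T O ∧
      ∀ U : Set (D.tPerp B), U ⊆ O → IsOpen U → 0 ∈ U → AdInvariant D.T U →
        D.IsSmall Bc P U ∧
        ∃ φ : (GLn n ⧸ D.T) × D.WeylCosets → GLn n ⧸ D.T,
          (∀ k ∈ D.NK, ∀ X ∈ U, ∀ q,
            φ (k • eta D.T (X : Mat n), q) =
              (k * (w q : GLn n)) • eta D.T (D.psi B Bc P (w q : GLn n) X : Mat n)) ∧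
          IsInvariantNhd D.G (D.V U) ∧
          IsInvariantNhd D.Gc (φ '' (D.V U ×ˢ Set.univ)) ∧
          (AdInvariant D.NK U → φ '' (D.V U ×ˢ Set.univ) = D.Vc Bc P U) ∧
          (∀ h ∈ D.T, ∀ x ∈ D.V U, ∀ q, φ (h • x, q) = h • φ (x, q)) ∧
          IsDiffeoOntoOpen D.G D.Gc (D.V U) φ ∧
          (∀ q, D.HolomorphicUpToHomotopy B Bc (D.twistRoots (w q : GLn n) P) P (D.V U)
            (fun x => φ (x, q))) ∧
          (∀ χ : D.T →* Circle, Continuous χ → ∀ q,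
            PullbackLineIso D.G D.Gc χ (twistChar χ (w q : GLn n) (w q).2.2) (D.V U)
              (fun x => φ (x, q))) := by
  have hF := InnerFormData.isFormWithInner_G hB
  have hFc := InnerFormData.isFormWithInner_Gc hBc
  have hP' := hP.isPos
  obtain ⟨cG⟩ := hF.nonempty_sliceChart hP'
  obtain ⟨cC⟩ := hFc.nonempty_sliceChart hP'
  -- There are finitely many classes, so one neighbourhood bounds A_X - 1 for all representatives.
  have hfin : Finite D.WG := InnerFormData.finite_WG hFc
  have hp : ∀ᶠ X : D.tPerp B in 𝓝 0, ∀ q : D.WeylCosets,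
      ‖InnerFormData.tangentOp hP' hF hFc cG (w q).2 X - 1‖ < 1 :=
    Filter.eventually_all.mpr fun q =>
      InnerFormData.eventually_norm_tangentOp_sub_one_lt hP' hF hFc cG (w q).2
  obtain ⟨O, hO, h0, hinv, hfine⟩ := InnerFormData.exists_isFine hP' hF hFc cG cC hp
  refine ⟨O, hO, h0, hinv, fun U hUO hUo hU0 hUinv => ?_⟩
  obtain ⟨hU, hA⟩ := hfine U hUO hUo hUinv
  refine ⟨hU.isSmall, fun p => InnerFormData.phiAt Bc P U (w p.2) p.1,
    fun k hk X hX q => hU.phiAt_eq hP' hF hFc (w q).2 hk hX,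
    hU.isInvariantNhd_V hU0, ?_, ?_, ?_, ?_, ?_, ?_⟩
  · have h := hU.isInvariantNhd_image hP' hF hFc hw hU0
    exact h
  · intro h
    have h1 := hU.image_eq_Vc hP' hF hFc hw h
    exact h1
  · intro h hh x hx q
    have h1 := hU.phiAt_smul hP' hF hFc (w q).2 hh hx
    exact h1
  · have h := hU.isDiffeoOntoOpen hP' hF hFc hw
    exact h
  · intro q
    have h := hU.holomorphicUpToHomotopy hP' hF hFc (w q).2 fun X hX => hA X hX q
    exact h
  · intro χ hχ q
    have h := hU.pullbackLineIso hP' hF hFc (w q).2 hχ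
    exact h
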